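/- Let $n\ge 1$, let $\mathbb D^n=\{z\in\mathbb C^n:|z_i|<1 \text{ for all } i\}$ and let $\bar{\mathbb D}^n$ be its closure. Let $Z_{(0,1)}(\bar{\mathbb D}^n)$ be the space of $(0,1)$-forms $g=\sum_{j=1}^n g_j\,d\bar z_j$ with $g_j\in C(\bar{\mathbb D}^n)$ that are $\bar\partial$-closed on $\mathbb D^n$ in the sense of distributions; the equation $\bar\partial u=g$ is also understood in the sense of distributions on $\mathbb D^n$. For integers $k\ge0$ and $0<\alpha<1$ let $Z^{k+\alpha}_{(0,1)}(\bar{\mathbb D}^n)$ be the subspace of forms all of whose coefficients are of Hölder class $C^{k+\alpha}$. Define the following operators. (i) The Cauchy torus integral: for $u\in C(\bar{\mathbb D}^n)$ and $z\in\mathbb D^n$, $$K[u](z)=\frac1{(2\pi i)^n}\int_{(\partial\mathbb D)^n}\frac{u(\zeta)}{\prod_{j=1}^n(\zeta_j-z_j)}\,d\zeta_1\wedge\dots\wedge d\zeta_n .$$ (ii) Henkin's operator: for $g\in Z_{(0,1)}(\bar{\mathbb D}^n)$ and $z\in\bar{\mathbb D}^n$, $$H[g](z)=-\sum_{r=0}^{n-1}\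 \sum_{J}\ \int_{\gamma_J(z)}g(\zeta)\wedge\frac1{(2\pi i)^{n-r}}\bigwedge_{s=1}^{n-r}\frac{d\zeta_{k_s}}{\zeta_{k_s}-z_{k_s}} ,$$ where $J=(j_1,\dots,j_r)$ runs over the ordered $r$-tuples of distinct indices with $|z_{j_1}|\ge\dots\ge|z_{j_r}|$ (indices of equal modulus being listed in increasing order, so that each $r$-element set of indices occurs exactly once), $k_1<\dots<k_{n-r}$ are the indices not in $J$, and $$\gamma_J(z)=\{\zeta\in\bar{\mathbb D}^n:\ \zeta_{j}=z_{j}\text{ for } j\in J,\ |\zeta_{k_1}|=\dots=|\zeta_{k_{n-r}}|=\rho \text{ with } \rho\le|z_j| \text{ for all } j\in J\}$$ is parametrized by $\zeta_{k_s}=\rho e^{i\theta_s}$ and oriented by $d\rho\wedge d\theta_1\wedge\dots\wedge d\theta_{n-r}$. (iii) The Nijenhuis–Woolf operator: $T[g]=\sum_{j=1}^n T_jS_{j-1}\cdots S_1[g_j]$ on $\mathbb D^n$, where $$T_j[f](z)=\frac1{2\pi i}\int_{\mathbb D}\frac{f(z_1,\dots,\zeta_j,\dots,z_n)}{\zeta_j-z_j}\,d\zeta_j\wedge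 d\bar\zeta_j,\qquad S_j[f](z)=\frac1{2\pi i}\int_{\partial\mathbb D}\frac{f(z_1,\dots,\zeta_j,\dots,z_n)}{\zeta_j-z_j}\,d\zeta_j .$$ Then there is a linear operator $L:Z_{(0,1)}(\bar{\mathbb D}^n)\to C(\bar{\mathbb D}^n)$ such that $\bar\partial L[g]=g$ and $K[L[g]]=0$ on $\mathbb D^n$ for every $g\in Z_{(0,1)}(\bar{\mathbb D}^n)$. It is characterized by this: if $u\in C(\bar{\mathbb D}^n)$ satisfies $\bar\partial u=g$ and $K[u]=0$ on $\mathbb D^n$, then $u=L[g]$. Furthermore, $L[g]=H[g]$ on $\bar{\mathbb D}^n$ for every $g\in Z_{(0,1)}(\bar{\mathbb D}^n)$, and for all integers $k\ge0$, all $0<\alpha<1$ and all $g\in Z^{k+\alpha}_{(0,1)}(\bar{\mathbb D}^n)$ we have $L[g]=T[g]$ on $\mathbb D^n$. -/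

import Mathlib

noncomputable section

namespace Polydisc

open MeasureTheory Complex
open scoped ContDiff NNReal

/-- The open unit polydisc `𝔻ⁿ`. -/
def polydisc (n : ℕ) : Set (Fin n → ℂ) := {z | ∀ i, ‖z i‖ < 1}

/-- The closed unit polydisc. -/
def closedPolydisc (n : ℕ) : Set (Fin n → ℂ) := {z | ∀ i, ‖z i‖ ≤ 1}

/-- Extension by zero of a function on the closed polydisc. It only serves to write integrals and
derivatives over `ℂⁿ`; its values off the closed polydisc are never used. -/
def zeroExt {n : ℕ} (u : C(closedPolydisc n, ℂ)) (z : Fin n → ℂ) : ℂ :=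
  open Classical in if h : z ∈ closedPolydisc n then u ⟨z, h⟩ else 0

/-- The classical Wirtinger derivative `∂φ/∂z̄_j`. -/
def wirtingerBar {n : ℕ} (j : Fin n) (φ : (Fin n → ℂ) → ℂ) (z : Fin n → ℂ) : ℂ :=
  (1 / 2) * (fderiv ℝ φ z (Pi.single j 1) + I * fderiv ℝ φ z (Pi.single j I))

/-- Complex-valued test functions: smooth with compact support in the open polydisc. -/
def IsTest {n : ℕ} (φ : (Fin n → ℂ) → ℂ) : Prop :=
  ContDiff ℝ ∞ φ ∧ HasCompactSupport φ ∧ tsupport φ ⊆ polydisc n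

/-- The continuous `(0,1)`-form `g = ∑ g_j dz̄_j` is `∂̄`-closed in the sense of distributions on the
open polydisc: `∂g_j/∂z̄_k = ∂g_k/∂z̄_j` for all `j, k`. -/
def IsDbarClosed {n : ℕ} (g : Fin n → C(closedPolydisc n, ℂ)) : Prop :=
  ∀ φ : (Fin n → ℂ) → ℂ, IsTest φ → ∀ j k : Fin n,
    ∫ z in polydisc n, zeroExt (g j) z * wirtingerBar k φ z =
      ∫ z in polydisc n, zeroExt (g k) z * wirtingerBar j φ z

/-- `∂̄u = g` in the sense of distributions on the open polydisc. -/
def IsDbarSolution {n : ℕ} (u : C(closedPolydisc n, ℂ))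
    (g : Fin n → C(closedPolydisc n, ℂ)) : Prop :=
  ∀ φ : (Fin n → ℂ) → ℂ, IsTest φ → ∀ j : Fin n,
    ∫ z in polydisc n, zeroExt u z * wirtingerBar j φ z =
      - ∫ z in polydisc n, zeroExt (g j) z * φ z

lemma isCompact_closedPolydisc (n : ℕ) : IsCompact (closedPolydisc n) := by
  have h : closedPolydisc n = Set.univ.pi fun _ => Metric.closedBall (0 : ℂ) 1 := by
    ext z; simp [closedPolydisc]
  rw [h]
  exact isCompact_univ_pi fun _ => isCompact_closedBall _ _

lemma polydisc_subset (n : ℕ) : polydisc n ⊆ closedPolydisc n := fun _ hz i => (hz i).le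

lemma continuousOn_zeroExt {n : ℕ} (u : C(closedPolydisc n, ℂ)) :
    ContinuousOn (zeroExt u) (closedPolydisc n) := by
  rw [continuousOn_iff_continuous_domRestrict]
  have h : (closedPolydisc n).domRestrict (zeroExt u) = u := by
    ext z
    exact dif_pos z.2
  rw [h]
  exact u.continuous

lemma IsTest.integrableOn {n : ℕ} {φ : (Fin n → ℂ) → ℂ} (hφ : IsTest φ)
    (u : C(closedPolydisc n, ℂ)) (j : Fin n) :
    IntegrableOn (fun z => zeroExt u z * wirtingerBar j φ z) (polydisc n) := by
  have hd : Continuous (fderiv ℝ φ) := hφ.1.continuous_fderiv (by simp)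
  have hw : Continuous (wirtingerBar j φ) := by
    unfold wirtingerBar
    fun_prop
  exact (((continuousOn_zeroExt u).mul hw.continuousOn).integrableOn_compact
    (isCompact_closedPolydisc n)).mono_set (polydisc_subset n)

lemma zeroExt_add {n : ℕ} (u v : C(closedPolydisc n, ℂ)) (z : Fin n → ℂ) :
    zeroExt (u + v) z = zeroExt u z + zeroExt v z := by
  unfold zeroExt; split_ifs <;> simp

lemma zeroExt_smul {n : ℕ} (c : ℂ) (u : C(closedPolydisc n, ℂ)) (z : Fin n → ℂ) :
    zeroExt (c • u) z = c * zeroExt u z := by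
  unfold zeroExt; split_ifs <;> simp

/-- The space of continuous `∂̄`-closed `(0,1)`-forms on the closed polydisc. -/
def closedForms (n : ℕ) : Submodule ℂ (Fin n → C(closedPolydisc n, ℂ)) where
  carrier := {g | IsDbarClosed g}
  zero_mem' := by
    intro φ _ j k
    simp [zeroExt]
  add_mem' := by
    intro g h hg hh φ hφ j k
    simp only [Pi.add_apply, zeroExt_add, add_mul]
    rw [integral_add (hφ.integrableOn _ _) (hφ.integrableOn _ _),
      integral_add (hφ.integrableOn _ _) (hφ.integrableOn _ _), hg φ hφ j k, hh φ hφ j k]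
  smul_mem' := by
    intro c g hg φ hφ j k
    simp only [Pi.smul_apply, zeroExt_smul, mul_assoc]
    rw [integral_const_mul, integral_const_mul, hg φ hφ j k]

/-- Membership of a function in the Hölder space `C^{k+α}`: all derivatives up to order `k` exist,
are continuous and bounded on the open polydisc, and those of order `k` are `α`-Hölder there. -/
def IsHolder {n : ℕ} (k : ℕ) (α : ℝ≥0) (u : C(closedPolydisc n, ℂ)) : Prop :=
  ContDiffOn ℝ k (zeroExt u) (polydisc n) ∧
  (∀ m ≤ k, ∃ C : ℝ, ∀ z ∈ polydisc n, ‖iteratedFDeriv ℝ m (zeroExt u) z‖ ≤ C) ∧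
  ∃ C : ℝ≥0, HolderOnWith C α (iteratedFDeriv ℝ k (zeroExt u)) (polydisc n)

/-- The Cauchy torus integral
`K[u](z) = (2πi)⁻ⁿ ∫_{(∂𝔻)ⁿ} u(ζ) / ∏ (ζ_j - z_j) dζ_1 ∧ ⋯ ∧ dζ_n`. -/
def cauchyTorus {n : ℕ} (u : (Fin n → ℂ) → ℂ) (z : Fin n → ℂ) : ℂ :=
  ((2 * Real.pi * I) ^ n)⁻¹ *
    torusIntegral (fun ζ : Fin n → ℂ => u ζ / ∏ j, (ζ j - z j)) 0 (fun _ => 1)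

/-- `S_j[f](z) = (2πi)⁻¹ ∫_{∂𝔻} f(z_1, …, ζ_j, …, z_n) / (ζ_j - z_j) dζ_j`. -/
def cauchyCircle {n : ℕ} (j : Fin n) (f : (Fin n → ℂ) → ℂ) (z : Fin n → ℂ) : ℂ :=
  (2 * Real.pi * I)⁻¹ * circleIntegral (fun w => f (Function.update z j w) / (w - z j)) 0 1

/-- `T_j[f](z) = (2πi)⁻¹ ∫_𝔻 f(z_1, …, ζ_j, …, z_n) / (ζ_j - z_j) dζ_j ∧ dζ̄_j`, where
`dζ ∧ dζ̄ = -2i dA` with `dA` the Lebesgue measure of the plane. -/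
def cauchyDisc {n : ℕ} (j : Fin n) (f : (Fin n → ℂ) → ℂ) (z : Fin n → ℂ) : ℂ :=
  (2 * Real.pi * I)⁻¹ *
    ∫ w in Metric.ball (0 : ℂ) 1, f (Function.update z j w) / (w - z j) * (-2 * I)

/-- The composition of the first `m` of the operators `S_j`, the first one being applied first. -/
def cauchyCircles {n : ℕ} : ℕ → ((Fin n → ℂ) → ℂ) → (Fin n → ℂ) → ℂ
  | 0, f => f
  | m + 1, f => if h : m < n then cauchyCircle ⟨m, h⟩ (cauchyCircles m f) else cauchyCircles m f

/-- The Nijenhuis–Woolf operator `T[g] = ∑_j T_j S_{j-1} ⋯ S_1 [g_j]`, at points of the open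
polydisc. -/
def nijenhuisWoolf {n : ℕ} (g : Fin n → C(closedPolydisc n, ℂ)) (z : Fin n → ℂ) : ℂ :=
  ∑ j : Fin n, cauchyDisc j (cauchyCircles (j : ℕ) (zeroExt (g j))) z

/-- The indices that do not occur in the tuple `J`. -/
abbrev Rest {n r : ℕ} (J : Fin r ↪ Fin n) : Type := {k : Fin n // ∀ a, J a ≠ k}

/-- The point `ζ` with `ζ_j = z_j` for `j` in `J` and `ζ_k = ρ e^{iθ_k}` for the other indices. -/
def henkinPoint {n r : ℕ} (J : Fin r ↪ Fin n) (z : Fin n → ℂ) (ρ : ℝ) (θ : Rest J → ℝ) :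
    Fin n → ℂ :=
  fun i => if h : ∀ a, J a ≠ i then ρ * exp (θ ⟨i, h⟩ * I) else z i

/-- The parameter domain of
`γ_J(z) = {ζ : ζ_j = z_j for j in J, |ζ_k| = ρ for the other k, ρ ≤ 1, ρ ≤ |z_j| for j in J}`
in the coordinates `(ρ, θ)`. -/
def henkinDomain {n r : ℕ} (J : Fin r ↪ Fin n) (z : Fin n → ℂ) : Set (ℝ × (Rest J → ℝ)) :=
  {p | (0 ≤ p.1 ∧ p.1 ≤ 1 ∧ ∀ a, p.1 ≤ ‖z (J a)‖) ∧ ∀ k, 0 ≤ p.2 k ∧ p.2 k ≤ 2 * Real.pi}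

/-- The integral over `γ_J(z)` of `g ∧ (2πi)^{-(n-r)} ⋀_k dζ_k / (ζ_k - z_k)`, where `γ_J(z)` is
oriented by `dρ ∧ dθ_{k_1} ∧ ⋯ ∧ dθ_{k_{n-r}}`. The pullback of
`dζ̄_s ∧ dζ_{k_1} ∧ ⋯ ∧ dζ_{k_{n-r}}` under `ζ_k = ρ e^{iθ_k}` is
`2iρ ∏_{k ≠ s} (iρ e^{iθ_k}) dρ ∧ dθ_{k_1} ∧ ⋯ ∧ dθ_{k_{n-r}}`
(for a single variable, `dζ̄ ∧ dζ = 2iρ dρ ∧ dθ`), and `dζ̄_j` pulls back to zero for `j` in `J`. -/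
def henkinIntegral {n r : ℕ} (J : Fin r ↪ Fin n) (g : Fin n → C(closedPolydisc n, ℂ))
    (z : Fin n → ℂ) : ℂ :=
  ((2 * Real.pi * I) ^ (n - r))⁻¹ *
    ∫ p in henkinDomain J z,
      ∑ s : Rest J, zeroExt (g s) (henkinPoint J z p.1 p.2) *
        (2 * I * p.1 * ∏ k ∈ Finset.univ.erase s, (I * p.1 * exp (p.2 k * I))) /
          ∏ k : Rest J, (henkinPoint J z p.1 p.2 k - z k)

/-- The tuple `J` lists its indices by decreasing `|z_j|`; equal moduli are listed by increasing
index, so that every set of indices is listed by exactly one tuple. -/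
def IsDecreasing {n r : ℕ} (z : Fin n → ℂ) (J : Fin r ↪ Fin n) : Prop :=
  ∀ a b : Fin r, a < b →
    ‖z (J b)‖ < ‖z (J a)‖ ∨ (‖z (J b)‖ = ‖z (J a)‖ ∧ J a < J b)

/-- Henkin's operator `H[g](z) = - ∑_{r < n} ∑_{|J| = r} ∫_{γ_J(z)} g ∧ H_J(·, z)`, where `J` runs
over the ordered `r`-tuples of distinct indices with `|z_{j_1}| ≥ ⋯ ≥ |z_{j_r}|`. -/
def henkin {n : ℕ} (g : Fin n → C(closedPolydisc n, ℂ)) (z : Fin n → ℂ) : ℂ :=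
  open Classical in
  - ∑ r ∈ Finset.range n, ∑ J : Fin r ↪ Fin n,
      if IsDecreasing z J then henkinIntegral J g z else 0

end Polydisc

end

/-!
Mollifying a dilated weak solution of `∂̄v = g` with a product kernel shows that `g` is a uniform
limit of linear combinations of forms `∂̄p` with `p = ∏ u_i(z_i)`; if `v` is continuous up to the
boundary, then `v` is the limit of the same combinations of the functions `p`. Hence an identity
between functionals that are bounded in the supremum norm need only be checked on these `p`. There
every operator factors into one-variable operators, which the Cauchy–Green formula
`S u + T (∂u/∂z̄) = u` on the disc relates:

* `T[∂̄p] = p - ∏ S u_i`, by telescoping;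
* `H[∂̄p] = p - ∏ (u_i - T (∂u_i/∂z̄))`, since the sum over the tuples `J` is a Leibniz rule in
  `ρ`: the `ρ`-derivative of the mean of `u_k(ζ) ζ / (ζ - z_k)` over the circle `|ζ| = ρ` is an
  integral of `∂u_k/∂z̄` over this circle, and its jump `u_k(z_k)` at `ρ = |z_k|` is compensated by
  the factor `u_k(z_k)`, present for `ρ ≤ |z_k|`, of the tuples that contain `k`;
* `p = K[p] + T[∂̄p]`.

Every closed form has the weak solution `T[g]`, by integration by parts for products. So `H = T` in
the open polydisc for all closed forms, and `u = K[u] + T[∂̄u]` gives `K[H[g]] = 0` and uniqueness.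
The kernels of `H[g](z)` are bounded in `L¹` uniformly in `z`, which makes `H[g]` a uniform limit of
continuous functions on the closed polydisc.
-/

noncomputable section

namespace Polydisc

open MeasureTheory Complex Set Filter
open scoped ContDiff NNReal Real Topology

variable {n : ℕ}

/-! ### Uniform integrability of the Henkin kernel -/

lemma exists_setIntegral_abs_sub_rpow_le {b : ℝ} (hb₀ : 0 ≤ b) (hb : b < 1) {s : Set ℝ}
    (hs : volume s ≠ ⊤) :
    ∃ C, ∀ c, IntegrableOn (fun x => |x - c| ^ (-b)) s ∧ ∫ x in s, |x - c| ^ (-b) ≤ C := by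
  set G : ℝ → ℝ := (Metric.ball 0 1).indicator fun x => |x| ^ (-b) with hG
  have hmeas : Measurable fun x : ℝ => |x| ^ (-b) := by fun_prop
  have hGint : Integrable G := by
    refine IntegrableOn.integrable_indicator ?_ measurableSet_ball
    refine integrableOn_ball_of_norm_le_rpow (by simp) (α := b) (C := 1) (by simpa using hb)
      (.of_forall fun x => ?_) hmeas.aestronglyMeasurable
    rw [Real.norm_of_nonneg (by positivity), one_mul, Real.norm_eq_abs]
  have hG₀ : ∀ x, 0 ≤ G x := fun x => indicator_nonneg (fun _ _ => by positivity) x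
  have hle : ∀ x, |x| ^ (-b) ≤ G x + 1 := fun x => by
    by_cases h : x ∈ Metric.ball 0 1
    · simp [hG, indicator_of_mem h]
    · rw [hG, indicator_of_notMem h, zero_add]
      exact Real.rpow_le_one_of_one_le_of_nonpos (by simpa using h) (by linarith)
  have hone : IntegrableOn (fun _ => (1 : ℝ)) s := integrableOn_const hs
  refine ⟨(∫ x, G x) + ∫ _x in s, (1 : ℝ), fun c => ?_⟩
  have hGc : Integrable fun x => G (x - c) := hGint.comp_sub_right c
  have hinteg : IntegrableOn (fun x => |x - c| ^ (-b)) s := by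
    refine (hGc.integrableOn.add hone).mono'
      (hmeas.comp (measurable_id.sub_const c)).aestronglyMeasurable (.of_forall fun x => ?_)
    rw [Real.norm_of_nonneg (by positivity)]
    exact hle (x - c)
  refine ⟨hinteg, ?_⟩
  calc ∫ x in s, |x - c| ^ (-b) ≤ ∫ x in s, (G (x - c) + 1) :=
        integral_mono hinteg (hGc.integrableOn.add hone) fun x => hle (x - c)
    _ = (∫ x in s, G (x - c)) + ∫ _x in s, (1 : ℝ) := integral_add hGc.integrableOn hone
    _ ≤ (∫ x, G (x - c)) + ∫ _x in s, (1 : ℝ) := by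
        gcongr
        · exact .of_forall fun x => hG₀ _
        · exact Measure.restrict_le_self
    _ = (∫ x, G x) + ∫ _x in s, (1 : ℝ) := by rw [integral_sub_right_eq_self G c]

lemma mul_abs_div_pi_le_norm_sub {ρ t x : ℝ} (hρ : 0 ≤ ρ) (ht : 0 ≤ t) (hx : |x| ≤ π) :
    ρ * |x| / π ≤ ‖(ρ : ℂ) * exp (x * I) - t‖ := by
  have hre : ((ρ : ℂ) * exp (x * I) - t).re = ρ * Real.cos x - t := by
    simp [exp_ofReal_mul_I_re]
  have him : ((ρ : ℂ) * exp (x * I) - t).im = ρ * Real.sin x := by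
    simp [exp_ofReal_mul_I_im]
  rcases le_or_gt |x| (π / 2) with h | h
  · calc ρ * |x| / π = ρ * (1 / π * |x|) := by ring
      _ ≤ ρ * (2 / π * |x|) := by gcongr; norm_num
      _ ≤ ρ * |Real.sin x| := by gcongr; exact Real.mul_abs_le_abs_sin h
      _ = |((ρ : ℂ) * exp (x * I) - t).im| := by rw [him, abs_mul, abs_of_nonneg hρ]
      _ ≤ _ := abs_im_le_norm _
  · have hcos : Real.cos x ≤ 0 := by
      rw [← Real.cos_abs]
      exact Real.cos_nonpos_of_pi_div_two_le_of_le h.le (by linarith [Real.pi_pos])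
    calc ρ * |x| / π ≤ ρ := by rw [div_le_iff₀ Real.pi_pos]; gcongr
      _ ≤ _ := by
        rw [← sq_le_sq₀ hρ (norm_nonneg _), ← normSq_eq_norm_sq, normSq_apply, hre, him]
        nlinarith [Real.sin_sq_add_cos_sq x, mul_nonneg (mul_nonneg hρ ht) (neg_nonneg.2 hcos)]

lemma polar_sub_ne_zero {ρ : ℝ} {a : ℂ} (hρ : 0 ≤ ρ) (h : ρ ≠ ‖a‖) (θ : ℝ) :
    (ρ : ℂ) * exp (θ * I) - a ≠ 0 := by
  refine fun h₀ => h ?_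
  rw [← sub_eq_zero.1 h₀]
  simp [abs_of_nonneg hρ]

lemma norm_polar_sub_eq_norm_sub_arg (ρ : ℝ) (a : ℂ) (θ : ℝ) :
    ‖(ρ : ℂ) * exp (θ * I) - a‖ = ‖(ρ : ℂ) * exp ((θ - a.arg : ℝ) * I) - (‖a‖ : ℝ)‖ := by
  have h : (ρ : ℂ) * exp (θ * I) - a =
      exp (a.arg * I) * ((ρ : ℂ) * exp ((θ - a.arg : ℝ) * I) - (‖a‖ : ℝ)) := by
    have hexp : exp (θ * I) = exp (a.arg * I) * exp ((θ - a.arg : ℝ) * I) := by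
      rw [← exp_add]; congr 1; push_cast; ring
    rw [hexp]
    linear_combination norm_mul_exp_arg_mul_I a
  rw [h, norm_mul, norm_exp_ofReal_mul_I, one_mul]

lemma div_norm_polar_sub_le {s ρ x t : ℝ} (hs : 0 < s) (hs₁ : s < 1) (hρ : 0 ≤ ρ) (hρ₁ : ρ ≤ 1)
    (ht : 0 ≤ t) (hne : ρ ≠ t) (hx : |x| ≤ π) (hx₀ : x ≠ 0) :
    ρ / ‖(ρ : ℂ) * exp (x * I) - t‖ ≤ π ^ (1 - s) * |ρ - t| ^ (-s) * |x| ^ (-(1 - s)) := by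
  have hpi := Real.pi_pos
  set m := ‖(ρ : ℂ) * exp (x * I) - t‖
  rcases hρ.eq_or_lt with rfl | hρ₀
  · simp only [zero_div]; positivity
  have hradial : |ρ - t| ≤ m := by
    have := abs_norm_sub_norm_le ((ρ : ℂ) * exp (x * I)) t
    simpa [abs_of_nonneg hρ, abs_of_nonneg ht] using this
  have hangular : ρ * |x| / π ≤ m := mul_abs_div_pi_le_norm_sub hρ ht hx
  have hx' : 0 < |x| := abs_pos.2 hx₀
  have hd : 0 < |ρ - t| := abs_pos.2 (sub_ne_zero.2 hne)
  have hm₀ : 0 < m := hd.trans_le hradial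
  have hinterp : |ρ - t| ^ s * (ρ * |x| / π) ^ (1 - s) ≤ m := by
    calc _ ≤ m ^ s * m ^ (1 - s) := by gcongr
      _ = m := by rw [← Real.rpow_add hm₀]; simp
  rw [div_le_iff₀ hm₀]
  calc ρ = ρ ^ (1 : ℝ) := (Real.rpow_one ρ).symm
    _ ≤ ρ ^ (1 - s) := Real.rpow_le_rpow_of_exponent_ge hρ₀ hρ₁ (by linarith)
    _ = π ^ (1 - s) * |ρ - t| ^ (-s) * |x| ^ (-(1 - s)) *
        (|ρ - t| ^ s * (ρ * |x| / π) ^ (1 - s)) := by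
        rw [Real.div_rpow (by positivity) hpi.le, Real.mul_rpow hρ hx'.le,
          Real.rpow_neg hd.le, Real.rpow_neg hx'.le]
        have := (Real.rpow_pos_of_pos hpi (1 - s)).ne'
        have := (Real.rpow_pos_of_pos hd s).ne'
        have := (Real.rpow_pos_of_pos hx' (1 - s)).ne'
        field_simp
    _ ≤ _ := by gcongr

lemma continuous_div_norm_polar_sub {ρ : ℝ} {a : ℂ} (hρ : 0 ≤ ρ) (h : ρ ≠ ‖a‖) :
    Continuous fun θ : ℝ => ρ / ‖(ρ : ℂ) * exp (θ * I) - a‖ :=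
  continuous_const.div (by fun_prop) fun θ => norm_ne_zero_iff.2 (polar_sub_ne_zero hρ h θ)

lemma periodic_exp_mul_I : Function.Periodic (fun θ : ℝ => exp (θ * I)) (2 * π) := fun θ => by
  simpa [add_mul] using exp_periodic (θ * I)

lemma setIntegral_Icc_eq_setIntegral_Ioc_of_periodic {E : Type*} [NormedAddCommGroup E]
    [NormedSpace ℝ E] {F : ℝ → E} (hF : Function.Periodic F (2 * π)) :
    ∫ θ in Icc 0 (2 * π), F θ = ∫ θ in Ioc (-π) π, F θ := by
  rw [integral_Icc_eq_integral_Ioc, ← intervalIntegral.integral_of_le (by positivity),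
    ← intervalIntegral.integral_of_le (by linarith [Real.pi_pos])]
  convert hF.intervalIntegral_add_eq 0 (-π) using 2 <;> ring

lemma integral_div_norm_polar_sub_eq (ρ : ℝ) (a : ℂ) :
    ∫ θ in Icc 0 (2 * π), ρ / ‖(ρ : ℂ) * exp (θ * I) - a‖ =
      ∫ x in Ioc (-π) π, ρ / ‖(ρ : ℂ) * exp (x * I) - (‖a‖ : ℝ)‖ := by
  set F : ℝ → ℝ := fun x => ρ / ‖(ρ : ℂ) * exp (x * I) - (‖a‖ : ℝ)‖
  have hF : Function.Periodic F (2 * π) :=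
    periodic_exp_mul_I.comp fun w => ρ / ‖(ρ : ℂ) * w - (‖a‖ : ℝ)‖
  have hrot : ∀ θ : ℝ, ρ / ‖(ρ : ℂ) * exp (θ * I) - a‖ = F (θ - a.arg) := fun θ => by
    rw [norm_polar_sub_eq_norm_sub_arg]
  simp_rw [hrot]
  rw [← setIntegral_Icc_eq_setIntegral_Ioc_of_periodic hF, integral_Icc_eq_integral_Ioc,
    integral_Icc_eq_integral_Ioc, ← intervalIntegral.integral_of_le (by positivity),
    ← intervalIntegral.integral_of_le (by positivity), intervalIntegral.integral_comp_sub_right]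
  convert hF.intervalIntegral_add_eq (0 - a.arg) 0 using 2 <;> ring

lemma exists_integral_div_norm_polar_sub_le {s : ℝ} (hs : 0 < s) (hs₁ : s < 1) :
    ∃ C : ℝ, 0 ≤ C ∧ ∀ (ρ : ℝ) (a : ℂ), 0 ≤ ρ → ρ ≤ 1 → ρ ≠ ‖a‖ →
      ∫ θ in Icc 0 (2 * π), ρ / ‖(ρ : ℂ) * exp (θ * I) - a‖ ≤ C * |ρ - ‖a‖| ^ (-s) := by
  obtain ⟨C, hC⟩ := exists_setIntegral_abs_sub_rpow_le (b := 1 - s) (s := Ioc (-π) π)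
    (by linarith) (by linarith) measure_Ioc_lt_top.ne
  obtain ⟨hinteg, hle⟩ := hC 0
  simp only [sub_zero] at hinteg hle
  have hC₀ : 0 ≤ C := (integral_nonneg fun x => by positivity).trans hle
  refine ⟨π ^ (1 - s) * C, by positivity, fun ρ a hρ hρ₁ hne => ?_⟩
  have hne' : ρ ≠ ‖((‖a‖ : ℝ) : ℂ)‖ := by simpa using hne
  rw [integral_div_norm_polar_sub_eq]
  calc ∫ x in Ioc (-π) π, ρ / ‖(ρ : ℂ) * exp (x * I) - (‖a‖ : ℝ)‖
      ≤ ∫ x in Ioc (-π) π, π ^ (1 - s) * |ρ - ‖a‖| ^ (-s) * |x| ^ (-(1 - s)) := by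
        refine integral_mono_ae ?_ (hinteg.const_mul _) ?_
        · exact (continuous_div_norm_polar_sub hρ hne').integrableOn_Ioc
        · filter_upwards [ae_restrict_of_ae (Measure.ae_ne volume 0),
            ae_restrict_mem measurableSet_Ioc] with x hx₀ hx
          exact div_norm_polar_sub_le hs hs₁ hρ hρ₁ (norm_nonneg a) hne
            (abs_le.2 ⟨hx.1.le, hx.2⟩) hx₀
    _ = π ^ (1 - s) * |ρ - ‖a‖| ^ (-s) * ∫ x in Ioc (-π) π, |x| ^ (-(1 - s)) :=
        integral_const_mul _ _
    _ ≤ π ^ (1 - s) * |ρ - ‖a‖| ^ (-s) * C := by gcongr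
    _ = _ := by ring

-- The exponent is small enough for the largest factor alone to control the whole product.
lemma prod_rpow_neg_le {ι : Type*} [Fintype ι] {x : ι → ℝ} (hx : ∀ k, 0 < x k)
    (hx₁ : ∀ k, x k ≤ 1) :
    ∏ k, x k ^ (-(1 / (2 * (Fintype.card ι + 1 : ℝ)))) ≤ 1 + ∑ k, x k ^ (-(1 / 2 : ℝ)) := by
  set s : ℝ := 1 / (2 * (Fintype.card ι + 1 : ℝ)) with hs
  have hs₀ : 0 ≤ s := by positivity
  rcases isEmpty_or_nonempty ι with h | h
  · simp
  obtain ⟨k, hk⟩ := Finite.exists_min x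
  calc ∏ j, x j ^ (-s) ≤ ∏ _j : ι, x k ^ (-s) :=
        Finset.prod_le_prod (fun j _ => (Real.rpow_pos_of_pos (hx j) _).le) fun j _ =>
          Real.rpow_le_rpow_of_nonpos (hx k) (hk j) (by linarith)
    _ = x k ^ (-s * Fintype.card ι) := by
        rw [Finset.prod_const, Finset.card_univ, Real.rpow_mul (hx k).le, Real.rpow_natCast]
    _ ≤ x k ^ (-(1 / 2 : ℝ)) := by
        refine Real.rpow_le_rpow_of_exponent_ge (hx k) (hx₁ k) ?_
        have : s * Fintype.card ι ≤ 1 / 2 := by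
          rw [hs, div_mul_eq_mul_div, one_mul, div_le_iff₀ (by positivity)]
          linarith
        linarith
    _ ≤ ∑ j, x j ^ (-(1 / 2 : ℝ)) :=
        Finset.single_le_sum (f := fun j => x j ^ (-(1 / 2 : ℝ)))
          (fun j _ => (Real.rpow_pos_of_pos (hx j) _).le) (Finset.mem_univ k)
    _ ≤ _ := by linarith

/-- Lebesgue measure on the cube `[0, 2π]^ι` of angles. -/
def angleMeasure (ι : Type*) [Fintype ι] : Measure (ι → ℝ) :=
  Measure.pi fun _ : ι => volume.restrict (Icc 0 (2 * π))

instance (ι : Type*) [Fintype ι] : IsFiniteMeasure (angleMeasure ι) := by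
  unfold angleMeasure; infer_instance

/-- Lebesgue measure on `[0, 1] × [0, 2π]^ι`, the polar coordinates `(ρ, θ)` of the points
`(ρ e^{iθ_k})_k` all of whose coordinates have the same modulus. -/
def polarMeasure (ι : Type*) [Fintype ι] : Measure (ℝ × (ι → ℝ)) :=
  (volume.restrict (Icc 0 1)).prod (angleMeasure ι)

/-- The modulus `∏ ρ / |ρ e^{iθ_k} - a_k|` of the Henkin kernel in polar coordinates. -/
def polarKernel {ι : Type*} [Fintype ι] (a : ι → ℂ) (p : ℝ × (ι → ℝ)) : ℝ :=
  ∏ k, p.1 / ‖(p.1 : ℂ) * exp (p.2 k * I) - a k‖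

lemma ae_mem_Icc_and_ne_norm {ι : Type*} [Countable ι] (a : ι → ℂ) :
    ∀ᵐ ρ ∂volume.restrict (Icc 0 1), ρ ∈ Icc (0 : ℝ) 1 ∧ ∀ k, ρ ≠ ‖a k‖ :=
  (ae_restrict_mem measurableSet_Icc).and
    (ae_restrict_of_ae (ae_all_iff.2 fun _ => Measure.ae_ne _ _))

section PolarKernel

variable {ι : Type*} [Fintype ι]

lemma measurable_polarKernel (a : ι → ℂ) : Measurable (polarKernel a) := by
  refine Finset.measurable_prod _ fun k _ => measurable_fst.div (Measurable.norm ?_)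
  exact (Continuous.measurable (by fun_prop)).sub measurable_const

lemma integral_polarKernel_eq_prod (a : ι → ℂ) (ρ : ℝ) :
    ∫ θ, polarKernel a (ρ, θ) ∂angleMeasure ι =
      ∏ k, ∫ θ in Icc 0 (2 * π), ρ / ‖(ρ : ℂ) * exp (θ * I) - a k‖ :=
  integral_fintype_prod_eq_prod fun k (θ : ℝ) => ρ / ‖(ρ : ℂ) * exp (θ * I) - a k‖

lemma exists_integral_polarKernel_angle_le (ι : Type*) [Fintype ι] :
    ∃ C : ℝ, 0 ≤ C ∧ ∀ (a : ι → ℂ) (ρ : ℝ), (∀ k, ‖a k‖ ≤ 1) → ρ ∈ Icc (0 : ℝ) 1 →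
      (∀ k, ρ ≠ ‖a k‖) → ∫ θ, polarKernel a (ρ, θ) ∂angleMeasure ι ≤
        C * (1 + ∑ k, |ρ - ‖a k‖| ^ (-(1 / 2 : ℝ))) := by
  set s : ℝ := 1 / (2 * (Fintype.card ι + 1 : ℝ)) with hs
  have hs₁ : s < 1 := by
    rw [hs, div_lt_one (by positivity)]
    linarith [(Nat.cast_nonneg (Fintype.card ι) : (0 : ℝ) ≤ _)]
  obtain ⟨C, hC₀, hC⟩ := exists_integral_div_norm_polar_sub_le (s := s) (by positivity) hs₁
  refine ⟨C ^ Fintype.card ι, by positivity, fun a ρ ha ⟨hρ₀, hρ₁⟩ hne => ?_⟩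
  rw [integral_polarKernel_eq_prod]
  calc _ ≤ ∏ k, C * |ρ - ‖a k‖| ^ (-s) :=
        Finset.prod_le_prod (fun k _ => integral_nonneg fun θ => by positivity)
          fun k _ => hC ρ (a k) hρ₀ hρ₁ (hne k)
    _ = C ^ Fintype.card ι * ∏ k, |ρ - ‖a k‖| ^ (-s) := by
        rw [Finset.prod_mul_distrib, Finset.prod_const, Finset.card_univ]
    _ ≤ _ := by
        gcongr
        refine prod_rpow_neg_le (fun k => abs_pos.2 (sub_ne_zero.2 (hne k))) fun k => abs_le.2 ?_
        constructor <;> linarith [ha k, norm_nonneg (a k)]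

lemma integrable_polarKernel {a : ι → ℂ} (ha : ∀ k, ‖a k‖ ≤ 1) :
    Integrable (polarKernel a) (polarMeasure ι) := by
  obtain ⟨C, -, hC⟩ := exists_integral_polarKernel_angle_le ι
  obtain ⟨C', hC'⟩ := exists_setIntegral_abs_sub_rpow_le (b := 1 / 2) (s := Icc 0 1)
    (by norm_num) (by norm_num) measure_Icc_lt_top.ne
  have hmeas := measurable_polarKernel a
  rw [polarMeasure, integrable_prod_iff hmeas.aestronglyMeasurable]
  refine ⟨?_, Integrable.mono' (g := fun ρ => C * (1 + ∑ k, |ρ - ‖a k‖| ^ (-(1 / 2 : ℝ))))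
    (((integrable_const _).add (integrable_finsetSum _ fun k _ => (hC' ‖a k‖).1)).const_mul _)
    hmeas.norm.stronglyMeasurable.integral_prod_right.aestronglyMeasurable ?_⟩
  · filter_upwards [ae_mem_Icc_and_ne_norm a] with ρ hρ
    exact Integrable.fintype_prod (f := fun k (θ : ℝ) => ρ / ‖(ρ : ℂ) * exp (θ * I) - a k‖)
      fun k => (continuous_div_norm_polar_sub hρ.1.1 (hρ.2 k)).integrableOn_Icc
  · filter_upwards [ae_mem_Icc_and_ne_norm a] with ρ hρ
    have hnn : ∀ θ, 0 ≤ polarKernel a (ρ, θ) := fun θ =>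
      Finset.prod_nonneg fun k _ => div_nonneg hρ.1.1 (norm_nonneg _)
    rw [Real.norm_of_nonneg (integral_nonneg fun _ => norm_nonneg _)]
    simp_rw [Real.norm_of_nonneg (hnn _)]
    exact hC a ρ ha hρ.1 hρ.2

lemma exists_integral_polarKernel_le (ι : Type*) [Fintype ι] :
    ∃ C : ℝ, ∀ a : ι → ℂ, (∀ k, ‖a k‖ ≤ 1) → ∫ p, polarKernel a p ∂polarMeasure ι ≤ C := by
  obtain ⟨C, hC₀, hC⟩ := exists_integral_polarKernel_angle_le ι
  obtain ⟨C', hC'⟩ := exists_setIntegral_abs_sub_rpow_le (b := 1 / 2) (s := Icc 0 1)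
    (by norm_num) (by norm_num) measure_Icc_lt_top.ne
  refine ⟨C * (1 + ∑ _k : ι, C'), fun a ha => ?_⟩
  have hsum : Integrable (fun ρ => ∑ k, |ρ - ‖a k‖| ^ (-(1 / 2 : ℝ)))
      (volume.restrict (Icc 0 1)) := integrable_finsetSum _ fun k _ => (hC' ‖a k‖).1
  have hinteg := integrable_polarKernel ha
  rw [polarMeasure] at hinteg ⊢
  calc _ = ∫ ρ in Icc 0 1, ∫ θ, polarKernel a (ρ, θ) ∂angleMeasure ι := integral_prod _ hinteg
    _ ≤ ∫ ρ in Icc 0 1, C * (1 + ∑ k, |ρ - ‖a k‖| ^ (-(1 / 2 : ℝ))) := by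
        refine integral_mono_ae hinteg.integral_prod_left
          (((integrable_const _).add hsum).const_mul _) ?_
        filter_upwards [ae_mem_Icc_and_ne_norm a] with ρ hρ
        exact hC a ρ ha hρ.1 hρ.2
    _ = C * (1 + ∑ k, ∫ ρ in Icc 0 1, |ρ - ‖a k‖| ^ (-(1 / 2 : ℝ))) := by
        rw [integral_const_mul, integral_add (integrable_const _) hsum,
          integral_finsetSum _ fun k _ => (hC' ‖a k‖).1]
        simp
    _ ≤ _ := by
        gcongr with k
        exact (hC' ‖a k‖).2

end PolarKernel

/-! ### The Cauchy–Green formula on the unit disc -/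

/-- The Wirtinger derivative `∂f/∂z̄` of a function of one variable. -/
def dbar (f : ℂ → ℂ) (z : ℂ) : ℂ := (1 / 2) * (fderiv ℝ f z 1 + I * fderiv ℝ f z I)

/-- The one-variable Cauchy integral `S` over the unit circle. -/
def circleS (f : ℂ → ℂ) (a : ℂ) : ℂ :=
  (2 * π * I)⁻¹ * circleIntegral (fun w => f w / (w - a)) 0 1

/-- The one-variable Cauchy transform `T` on the unit disc; as in `cauchyDisc`, the factor `-2i`
turns Lebesgue measure into `dζ ∧ dζ̄`. -/
def discT (f : ℂ → ℂ) (a : ℂ) : ℂ :=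
  (2 * π * I)⁻¹ * ∫ w in Metric.ball (0 : ℂ) 1, f w / (w - a) * (-2 * I)

/-- The Cauchy integral `(2πi)⁻¹ ∫_{|w| = ρ} f(w) / (w - a) dw` over the circle of radius `ρ`,
written in the angle because Henkin's operator is. -/
def circleMean (f : ℂ → ℂ) (a : ℂ) (ρ : ℝ) : ℂ :=
  (2 * π * I)⁻¹ * ∫ θ in Icc 0 (2 * π),
    f (ρ * exp (θ * I)) * (I * ρ * exp (θ * I)) / (ρ * exp (θ * I) - a)

/-- The circle mean of `f - f a`, which unlike that of `f` is continuous in the radius also at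
`ρ = |a|`. -/
def circleRemainder (f : ℂ → ℂ) (a : ℂ) (ρ : ℝ) : ℂ := circleMean (fun z => f z - f a) a ρ

/-- The density in `ρ` of `(2πi)⁻¹ ∫ h(w) / (w - a) dw̄ ∧ dw` in polar coordinates `w = ρ e^{iθ}`,
where `dw̄ ∧ dw = 2iρ dρ ∧ dθ`. -/
def radialDensity (h : ℂ → ℂ) (a : ℂ) (ρ : ℝ) : ℂ :=
  (2 * π * I)⁻¹ * ∫ θ in Icc 0 (2 * π),
    h (ρ * exp (θ * I)) * (2 * I * ρ) / (ρ * exp (θ * I) - a)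

lemma continuousOn_dbar {f : ℂ → ℂ} {U : Set ℂ} (hU : IsOpen U) (hf : ContDiffOn ℝ 1 f U) :
    ContinuousOn (dbar f) U := by
  have hd : ContinuousOn (fderiv ℝ f) U := hf.continuousOn_fderiv_of_isOpen hU le_rfl
  unfold dbar
  fun_prop

lemma continuous_dbar {f : ℂ → ℂ} (hf : ContDiff ℝ 1 f) : Continuous (dbar f) :=
  continuousOn_univ.1 (continuousOn_dbar isOpen_univ hf.contDiffOn)

lemma dbar_eq_zero_of_differentiableAt {f : ℂ → ℂ} {a : ℂ} (hf : DifferentiableAt ℂ f a) :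
    dbar f a = 0 := by
  have hI : fderiv ℂ f a I = I * fderiv ℂ f a 1 := by
    rw [← smul_eq_mul, ← map_smul]
    simp
  rw [dbar, (hf.hasFDerivAt.restrictScalars ℝ).fderiv]
  simp only [ContinuousLinearMap.coe_restrictScalars', hI]
  linear_combination (1 / 2) * fderiv ℂ f a 1 * I_sq

lemma dbar_sub {f g : ℂ → ℂ} {a : ℂ} (hf : DifferentiableAt ℝ f a) (hg : DifferentiableAt ℝ g a) :
    dbar (fun z => f z - g z) a = dbar f a - dbar g a := by
  simp only [dbar, fderiv_fun_sub hf hg, sub_apply]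
  ring

lemma dbar_mul {f g : ℂ → ℂ} {a : ℂ} (hf : DifferentiableAt ℝ f a) (hg : DifferentiableAt ℝ g a) :
    dbar (fun z => f z * g z) a = f a * dbar g a + dbar f a * g a := by
  simp only [dbar, fderiv_fun_mul hf hg, add_apply, smul_apply, smul_eq_mul]
  ring

lemma dbar_sub_div_sub {f : ℂ → ℂ} {a w : ℂ} (hf : DifferentiableAt ℝ f w) (hw : w ≠ a) (c : ℂ) :
    dbar (fun z => (f z - c) / (z - a)) w = dbar f w / (w - a) := by
  have hinv : DifferentiableAt ℂ (fun z : ℂ => (z - a)⁻¹) w :=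
    (differentiableAt_id.sub_const a).inv (sub_ne_zero.2 hw)
  simp only [div_eq_mul_inv]
  rw [dbar_mul (hf.sub_const c) (hinv.restrictScalars ℝ), dbar_eq_zero_of_differentiableAt hinv,
    dbar_sub hf (differentiableAt_const c),
    dbar_eq_zero_of_differentiableAt (differentiableAt_const c)]
  ring

lemma dbar_comp_affine {f : ℂ → ℂ} (hf : Differentiable ℝ f) (c : ℂ) (s : ℝ) (z : ℂ) :
    dbar (fun z => f (c + s * z)) z = s * dbar f (c + s * z) := by
  have haff : HasFDerivAt (fun z : ℂ => c + s * z) (s • ContinuousLinearMap.id ℝ ℂ) z := by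
    simp only [← real_smul]
    exact ((hasFDerivAt_id z).const_smul s).const_add c
  have hcomp := ((hf (c + s * z)).hasFDerivAt.comp z haff).fderiv
  simp only [Function.comp_def] at hcomp
  have hsmul : ∀ v, fderiv ℝ f (c + s * z) (s • v) = s * fderiv ℝ f (c + s * z) v := fun v => by
    rw [map_smul, real_smul]
  simp only [dbar, hcomp, ContinuousLinearMap.comp_apply, smul_apply,
    ContinuousLinearMap.id_apply, hsmul]
  ring

lemma dbar_eq_zero_of_notMem_tsupport {f : ℂ → ℂ} {z : ℂ} (hz : z ∉ tsupport f) :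
    dbar f z = 0 := by
  simp [dbar, fderiv_of_notMem_tsupport ℝ hz]

lemma I_mul_apply_sub_apply_I_mul (L : ℂ →L[ℝ] ℂ) (e : ℂ) :
    I * L e - L (I * e) = I * (L 1 + I * L I) * (starRingEnd ℂ) e := by
  have hL : ∀ x y : ℝ, L (x + y * I) = x * L 1 + y * L I := fun x y => by
    have h : (x + y * I : ℂ) = x • (1 : ℂ) + y • I := by simp
    rw [h, map_add, map_smul, map_smul, real_smul, real_smul]
  have hIe : I * e = ((-e.im : ℝ) : ℂ) + (e.re : ℝ) * I := by
    apply Complex.ext <;> simp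
  have hconj : (starRingEnd ℂ) e = e.re - e.im * I := by
    apply Complex.ext <;> simp
  rw [hIe, hL, hconj]
  conv_lhs => rw [← re_add_im e, hL]
  push_cast
  simp only [add_re, ofReal_re, mul_re, I_re, mul_zero, ofReal_im, I_im, mul_one, sub_self,
    add_zero, add_im, mul_im, zero_add]
  linear_combination ((e.im : ℂ) * L 1 - (e.re : ℂ) * L I + (e.im : ℂ) * I * L I) * I_sq

/-- The derivative in `ρ` of the integrand `F(ρ e^{iθ}) iρ e^{iθ}` of `∫_{|w| = ρ} F(w) dw`. -/
def radialDeriv (F : ℂ → ℂ) (ρ θ : ℝ) : ℂ :=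
  fderiv ℝ F (ρ * exp (θ * I)) (exp (θ * I)) * (I * ρ * exp (θ * I)) +
    F (ρ * exp (θ * I)) * (I * exp (θ * I))

lemma hasDerivAt_radial {F : ℂ → ℂ} {ρ θ : ℝ} (hF : DifferentiableAt ℝ F (ρ * exp (θ * I))) :
    HasDerivAt (fun ρ : ℝ => F (ρ * exp (θ * I)) * (I * ρ * exp (θ * I)))
      (radialDeriv F ρ θ) ρ := by
  have hz : HasDerivAt (fun ρ : ℝ => (ρ : ℂ) * exp (θ * I)) (exp (θ * I)) ρ := by
    simpa using (ofRealCLM.hasDerivAt (x := ρ)).mul_const (exp (θ * I))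
  have hz' : HasDerivAt (fun ρ : ℝ => I * (ρ : ℂ) * exp (θ * I)) (I * exp (θ * I)) ρ := by
    simpa [mul_assoc] using hz.const_mul I
  exact (hF.hasFDerivAt.comp_hasDerivAt ρ hz).mul hz'

lemma hasDerivAt_angular {F : ℂ → ℂ} {ρ θ : ℝ} (hF : DifferentiableAt ℝ F (ρ * exp (θ * I))) :
    HasDerivAt (fun θ : ℝ => F (ρ * exp (θ * I)) * exp (θ * I))
      (radialDeriv F ρ θ - dbar F (ρ * exp (θ * I)) * (2 * I * ρ)) θ := by
  have he : HasDerivAt (fun θ : ℝ => exp (θ * I)) (exp (θ * I) * I) θ := by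
    simpa using ((hasDerivAt_id (θ : ℂ)).mul_const I).cexp.comp_ofReal
  have hz : HasDerivAt (fun θ : ℝ => (ρ : ℂ) * exp (θ * I)) (ρ * (exp (θ * I) * I)) θ :=
    he.const_mul _
  refine ((hF.hasFDerivAt.comp_hasDerivAt θ hz).mul he).congr_deriv ?_
  have hwirt := I_mul_apply_sub_apply_I_mul (fderiv ℝ F (ρ * exp (θ * I))) (exp (θ * I))
  have hconj : (starRingEnd ℂ) (exp (θ * I)) * exp (θ * I) = 1 := by
    rw [mul_comm, mul_conj, normSq_eq_norm_sq, norm_exp_ofReal_mul_I]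
    simp
  rw [← real_smul (x := ρ) (z := exp (θ * I) * I), map_smul, real_smul, mul_comm (exp _) I]
  simp only [radialDeriv, dbar]
  linear_combination (-ρ * exp (θ * I)) * hwirt - (I * ρ * (fderiv ℝ F (ρ * exp (θ * I)) 1 +
    I * fderiv ℝ F (ρ * exp (θ * I)) I)) * hconj

section Annulus

variable {F : ℂ → ℂ} {U : Set ℂ}

lemma continuousOn_radialDeriv (hU : IsOpen U) (hF : ContDiffOn ℝ 1 F U) :
    ContinuousOn (fun p : ℝ × ℝ => radialDeriv F p.1 p.2) {p | (p.1 : ℂ) * exp (p.2 * I) ∈ U} := by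
  have hpolar : ContinuousOn (fun p : ℝ × ℝ => (p.1 : ℂ) * exp (p.2 * I))
      {p | (p.1 : ℂ) * exp (p.2 * I) ∈ U} := by fun_prop
  have hd : ContinuousOn (fderiv ℝ F) U := hF.continuousOn_fderiv_of_isOpen hU le_rfl
  have hd' := hd.comp hpolar fun _ hp => hp
  have hF' := hF.continuousOn.comp hpolar fun _ hp => hp
  simp only [Function.comp_def] at hd' hF'
  exact ((hd'.clm_apply (by fun_prop)).mul (by fun_prop)).add (hF'.mul (by fun_prop))

lemma integral_radialDeriv (hU : IsOpen U) (hF : ContDiffOn ℝ 1 F U) {ρ : ℝ}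
    (hρ : ∀ θ : ℝ, (ρ : ℂ) * exp (θ * I) ∈ U) :
    ∫ θ in Icc 0 (2 * π), radialDeriv F ρ θ =
      ∫ θ in Icc 0 (2 * π), dbar F (ρ * exp (θ * I)) * (2 * I * ρ) := by
  have hrad : Continuous (radialDeriv F ρ) := continuousOn_univ.1 <|
    (continuousOn_radialDeriv hU hF).comp (f := fun θ : ℝ => (ρ, θ)) (by fun_prop) fun θ _ => hρ θ
  have hdbar : Continuous fun θ : ℝ => dbar F (ρ * exp (θ * I)) * (2 * I * ρ) :=
    ((continuousOn_dbar hU hF).comp_continuous (by fun_prop) hρ).mul_const _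
  rw [← sub_eq_zero, ← integral_sub hrad.integrableOn_Icc hdbar.integrableOn_Icc,
    integral_Icc_eq_integral_Ioc, ← intervalIntegral.integral_of_le (by positivity),
    intervalIntegral.integral_eq_sub_of_hasDerivAt (fun θ _ => hasDerivAt_angular
      ((hF.differentiableOn (by simp)).differentiableAt (hU.mem_nhds (hρ θ))))
      ((hrad.sub hdbar).intervalIntegrable _ _)]
  simp [exp_two_pi_mul_I]

-- Stokes' theorem on a thin annulus, where `d(F dw) = ∂̄F ∧ dw`.
lemma hasDerivAt_integral_polar (hU : IsOpen U) (hF : ContDiffOn ℝ 1 F U) {ρ₀ : ℝ}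
    (hρ₀ : ∀ θ : ℝ, (ρ₀ : ℂ) * exp (θ * I) ∈ U) :
    HasDerivAt (fun ρ : ℝ => ∫ θ in Icc 0 (2 * π), F (ρ * exp (θ * I)) * (I * ρ * exp (θ * I)))
      (∫ θ in Icc 0 (2 * π), dbar F (ρ₀ * exp (θ * I)) * (2 * I * ρ₀)) ρ₀ := by
  have hUpolar : IsOpen {p : ℝ × ℝ | (p.1 : ℂ) * exp (p.2 * I) ∈ U} :=
    hU.preimage (f := fun p : ℝ × ℝ => (p.1 : ℂ) * exp (p.2 * I)) (by fun_prop)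
  obtain ⟨δ, hδ, hsub⟩ : ∃ δ > 0, ∀ ρ ∈ Metric.closedBall ρ₀ δ, ∀ θ ∈ Icc 0 (2 * π),
      (ρ : ℂ) * exp (θ * I) ∈ U :=
    Metric.nhds_basis_closedBall.eventually_iff.1 <|
      isCompact_Icc.eventually_forall_of_forall_eventually fun θ _ => hUpolar.mem_nhds (hρ₀ θ)
  have hrad : ContinuousOn (fun p : ℝ × ℝ => radialDeriv F p.1 p.2)
      (Metric.closedBall ρ₀ δ ×ˢ Icc 0 (2 * π)) :=
    (continuousOn_radialDeriv hU hF).mono fun p hp => hsub p.1 hp.1 p.2 hp.2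
  obtain ⟨C, hC⟩ := ((isCompact_closedBall ρ₀ δ).prod isCompact_Icc).exists_bound_of_continuousOn
    hrad
  have hcont : ∀ ρ ∈ Metric.closedBall ρ₀ δ, ContinuousOn
      (fun θ : ℝ => F (ρ * exp (θ * I)) * (I * ρ * exp (θ * I))) (Icc 0 (2 * π)) := fun ρ hρ =>
    (hF.continuousOn.comp (f := fun θ : ℝ => (ρ : ℂ) * exp (θ * I)) (by fun_prop)
      (hsub ρ hρ)).mul (by fun_prop)
  have hmem := Metric.mem_closedBall_self (x := ρ₀) hδ.le
  rw [← integral_radialDeriv hU hF hρ₀]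
  refine (hasDerivAt_integral_of_dominated_loc_of_deriv_le (x₀ := ρ₀)
    (F := fun (ρ θ : ℝ) => F (ρ * exp (θ * I)) * (I * ρ * exp (θ * I))) (F' := radialDeriv F)
    (bound := fun _ => C) (Metric.closedBall_mem_nhds ρ₀ hδ) ?_
    (hcont ρ₀ hmem).integrableOn_Icc ?_ ?_ (integrable_const _) ?_).2
  · filter_upwards [Metric.closedBall_mem_nhds ρ₀ hδ] with ρ hρ
    exact (hcont ρ hρ).aestronglyMeasurable measurableSet_Icc
  · exact (hrad.comp (f := fun θ : ℝ => (ρ₀, θ)) (by fun_prop)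
      fun θ hθ => ⟨hmem, hθ⟩).aestronglyMeasurable measurableSet_Icc
  · filter_upwards [ae_restrict_mem measurableSet_Icc] with θ hθ ρ hρ
    exact hC (ρ, θ) ⟨hρ, hθ⟩
  · filter_upwards [ae_restrict_mem measurableSet_Icc] with θ hθ ρ hρ
    exact hasDerivAt_radial
      ((hF.differentiableOn (by simp)).differentiableAt (hU.mem_nhds (hsub ρ hρ θ hθ)))

end Annulus

lemma continuous_div_polar_sub {h : ℝ → ℂ} (hh : Continuous h) {a : ℂ} {ρ : ℝ}
    (hρ : 0 ≤ ρ) (hne : ρ ≠ ‖a‖) :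
    Continuous fun θ : ℝ => h θ / (ρ * exp (θ * I) - a) :=
  hh.div (by fun_prop) fun θ => polar_sub_ne_zero hρ hne θ

lemma hasDerivAt_circleRemainder {f : ℂ → ℂ} (hf : ContDiff ℝ 1 f) {a : ℂ} {ρ₀ : ℝ}
    (hρ₀ : 0 ≤ ρ₀) (hne : ρ₀ ≠ ‖a‖) :
    HasDerivAt (circleRemainder f a) (radialDensity (dbar f) a ρ₀) ρ₀ := by
  have hmem : ∀ θ : ℝ, (ρ₀ : ℂ) * exp (θ * I) ∈ ({a}ᶜ : Set ℂ) := fun θ =>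
    sub_ne_zero.1 (polar_sub_ne_zero hρ₀ hne θ)
  have hF : ContDiffOn ℝ 1 (fun z => (f z - f a) / (z - a)) {a}ᶜ := by
    simp only [div_eq_mul_inv]
    exact (hf.sub contDiff_const).contDiffOn.mul
      ((contDiff_id.sub contDiff_const).contDiffOn.inv fun z hz => sub_ne_zero.2 hz)
  have hderiv := (hasDerivAt_integral_polar isOpen_compl_singleton hF hmem).const_mul
    (2 * π * I : ℂ)⁻¹
  refine (hderiv.congr_deriv ?_).congr_of_eventuallyEq (.of_forall fun ρ => ?_)
  · rw [radialDensity]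
    congr 2 with θ
    rw [dbar_sub_div_sub (hf.differentiable (by simp)).differentiableAt (hmem θ),
      div_mul_eq_mul_div]
  · simp only [circleRemainder, circleMean, div_mul_eq_mul_div]

lemma exists_norm_sub_le {f : ℂ → ℂ} (hf : ContDiff ℝ 1 f) (R : ℝ) :
    ∃ C : ℝ, 0 ≤ C ∧ ∀ z w, ‖z‖ ≤ R → ‖w‖ ≤ R → ‖f z - f w‖ ≤ C * ‖z - w‖ := by
  obtain ⟨C, hC⟩ := (hf.locallyLipschitz.locallyLipschitzOn
    (s := Metric.closedBall 0 R)).exists_lipschitzOnWith_of_compact (isCompact_closedBall _ _)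
  refine ⟨C, C.2, fun z w hz hw => ?_⟩
  simpa [dist_eq_norm] using hC.dist_le_mul z (by simpa using hz) w (by simpa using hw)

lemma norm_sub_mul_polar_div_le {f : ℂ → ℂ} {C R : ℝ} (hC₀ : 0 ≤ C)
    (hC : ∀ z w, ‖z‖ ≤ R → ‖w‖ ≤ R → ‖f z - f w‖ ≤ C * ‖z - w‖) {a : ℂ} (ha : ‖a‖ ≤ R) {ρ : ℝ}
    (hρ : ρ ∈ Icc 0 R) (θ : ℝ) :
    ‖(f (ρ * exp (θ * I)) - f a) * (I * ρ * exp (θ * I)) / (ρ * exp (θ * I) - a)‖ ≤ C * ρ := by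
  have hle := hC (ρ * exp (θ * I)) a (by simpa [abs_of_nonneg hρ.1] using hρ.2) ha
  have hnorm : ‖I * ρ * exp (θ * I)‖ = ρ := by simp [abs_of_nonneg hρ.1]
  rw [norm_div, norm_mul, hnorm]
  refine div_le_of_le_mul₀ (norm_nonneg _) (mul_nonneg hC₀ hρ.1) ?_
  nlinarith [mul_le_mul_of_nonneg_right hle hρ.1]

lemma ae_polar_sub_ne_zero (a : ℂ) {ρ : ℝ} (hρ : ρ ≠ 0) :
    ∀ᵐ θ : ℝ, (ρ : ℂ) * exp (θ * I) - a ≠ 0 := by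
  have hcount : (circleMap 0 ρ ⁻¹' {a}).Countable :=
    (countable_singleton a).preimage_circleMap 0 hρ
  filter_upwards [hcount.ae_notMem volume] with θ hθ h₀
  exact hθ (by simp [circleMap, sub_eq_zero.1 h₀])

lemma continuousOn_circleRemainder {f : ℂ → ℂ} (hf : ContDiff ℝ 1 f) (R : ℝ) :
    ContinuousOn (fun p : ℂ × ℝ => circleRemainder f p.1 p.2)
      (Metric.closedBall 0 R ×ˢ Icc 0 R) := by
  obtain ⟨C, hC₀, hC⟩ := exists_norm_sub_le hf R
  have hbound : ∀ p ∈ Metric.closedBall (0 : ℂ) R ×ˢ Icc 0 R, ∀ θ : ℝ,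
      ‖(f (p.2 * exp (θ * I)) - f p.1) * (I * p.2 * exp (θ * I)) / (p.2 * exp (θ * I) - p.1)‖ ≤
        C * p.2 := fun p hp θ =>
    norm_sub_mul_polar_div_le hC₀ hC (by simpa using hp.1) hp.2 θ
  have hfc := hf.continuous
  rintro ⟨a₀, ρ₀⟩ hp₀
  refine ContinuousWithinAt.mul continuousWithinAt_const ?_
  refine continuousWithinAt_of_dominated (bound := fun _ => C * R) ?_ ?_ (integrable_const _) ?_
  · exact .of_forall fun p => Measurable.aestronglyMeasurable <|
      Measurable.div (Continuous.measurable (by fun_prop)) (Continuous.measurable (by fun_prop))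
  · filter_upwards [self_mem_nhdsWithin] with p hp
    exact .of_forall fun θ => (hbound p hp θ).trans (mul_le_mul_of_nonneg_left hp.2.2 hC₀)
  · rcases hp₀.2.1.eq_or_lt with rfl | hρ₀
    · refine .of_forall fun θ => ?_
      have hlim : Tendsto (fun p : ℂ × ℝ => C * p.2)
          (𝓝[Metric.closedBall 0 R ×ˢ Icc 0 R] (a₀, 0)) (𝓝 0) :=
        (Continuous.tendsto' (by fun_prop) _ _ (by simp)).mono_left nhdsWithin_le_nhds
      have hzero := squeeze_zero_norm' (by
        filter_upwards [self_mem_nhdsWithin] with p hp using hbound p hp θ) hlim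
      simpa [ContinuousWithinAt] using hzero
    · filter_upwards [ae_restrict_of_ae (ae_polar_sub_ne_zero a₀ hρ₀.ne')] with θ hθ
      exact ContinuousAt.continuousWithinAt (ContinuousAt.div (by fun_prop) (by fun_prop) hθ)

section PolarCoordinates

variable {h : ℂ → ℂ}

lemma measurable_polar_quotient (hh : Continuous h) (a : ℂ) : Measurable fun p : ℝ × ℝ =>
    h (p.1 * exp (p.2 * I)) * (2 * I * p.1) / (p.1 * exp (p.2 * I) - a) :=
  Measurable.div (Continuous.measurable (by fun_prop)) (Continuous.measurable (by fun_prop))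

lemma periodic_polar_quotient (h : ℂ → ℂ) (a : ℂ) (ρ : ℝ) : Function.Periodic
    (fun θ : ℝ => h (ρ * exp (θ * I)) * (2 * I * ρ) / (ρ * exp (θ * I) - a)) (2 * π) :=
  periodic_exp_mul_I.comp fun w => h (ρ * w) * (2 * I * ρ) / (ρ * w - a)

lemma exists_integral_norm_polar_quotient_le (hh : Continuous h) :
    ∃ C : ℝ, ∀ (ρ : ℝ) (a : ℂ), 0 ≤ ρ → ρ ≤ 1 → ρ ≠ ‖a‖ →
      ∫ θ in Icc 0 (2 * π), ‖h (ρ * exp (θ * I)) * (2 * I * ρ) / (ρ * exp (θ * I) - a)‖ ≤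
        C * |ρ - ‖a‖| ^ (-(1 / 2 : ℝ)) := by
  obtain ⟨C, hC⟩ := (isCompact_closedBall (0 : ℂ) 1).exists_bound_of_continuousOn hh.continuousOn
  have hC₀ : 0 ≤ C := (norm_nonneg _).trans (hC 0 (by simp))
  obtain ⟨C', -, hC'⟩ := exists_integral_div_norm_polar_sub_le (s := 1 / 2) (by norm_num)
    (by norm_num)
  refine ⟨2 * C * C', fun ρ a hρ hρ₁ hne => ?_⟩
  calc _ ≤ ∫ θ in Icc 0 (2 * π), 2 * C * (ρ / ‖(ρ : ℂ) * exp (θ * I) - a‖) := by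
        refine integral_mono (continuous_div_polar_sub (by fun_prop) hρ hne).norm.integrableOn_Icc
          ((continuous_div_norm_polar_sub hρ hne).integrableOn_Icc.const_mul _) fun θ => ?_
        have hle : ‖h (ρ * exp (θ * I))‖ ≤ C := hC _ (by simpa [abs_of_nonneg hρ] using hρ₁)
        simp only [norm_div, norm_mul, norm_I, mul_one, norm_real, Real.norm_of_nonneg hρ,
          RCLike.norm_ofNat]
        rw [← mul_div_assoc, mul_comm 2 C, ← mul_assoc]
        gcongr
    _ = 2 * C * ∫ θ in Icc 0 (2 * π), ρ / ‖(ρ : ℂ) * exp (θ * I) - a‖ := integral_const_mul _ _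
    _ ≤ 2 * C * (C' * |ρ - ‖a‖| ^ (-(1 / 2 : ℝ))) := by gcongr; exact hC' ρ a hρ hρ₁ hne
    _ = _ := by ring

lemma integrableOn_radialDensity (hh : Continuous h) (a : ℂ) :
    IntegrableOn (radialDensity h a) (Icc 0 1) := by
  obtain ⟨C, hC⟩ := exists_integral_norm_polar_quotient_le hh
  obtain ⟨C', hC'⟩ := exists_setIntegral_abs_sub_rpow_le (b := 1 / 2) (s := Icc 0 1)
    (by norm_num) (by norm_num) measure_Icc_lt_top.ne
  refine Integrable.const_mul (((hC' ‖a‖).1.const_mul C).mono' (measurable_polar_quotient hh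
    a).stronglyMeasurable.integral_prod_right.aestronglyMeasurable ?_) _
  filter_upwards [ae_restrict_mem measurableSet_Icc, ae_restrict_of_ae (Measure.ae_ne _ ‖a‖)]
    with ρ hρ hne
  exact (norm_integral_le_integral_norm _).trans (hC ρ a hρ.1 hρ.2 hne)

lemma integrableOn_polar_quotient (hh : Continuous h) (a : ℂ) :
    IntegrableOn (fun p : ℝ × ℝ =>
      h (p.1 * exp (p.2 * I)) * (2 * I * p.1) / (p.1 * exp (p.2 * I) - a))
      (Ioo 0 1 ×ˢ Ioc (-π) π) (volume.prod volume) := by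
  have hmeas := measurable_polar_quotient hh a
  obtain ⟨C, hC⟩ := exists_integral_norm_polar_quotient_le hh
  obtain ⟨C', hC'⟩ := exists_setIntegral_abs_sub_rpow_le (b := 1 / 2) (s := Ioo 0 1)
    (by norm_num) (by norm_num) measure_Ioo_lt_top.ne
  have hae : ∀ᵐ ρ : ℝ ∂volume.restrict (Ioo 0 1), ρ ∈ Ioo (0 : ℝ) 1 ∧ ρ ≠ ‖a‖ :=
    (ae_restrict_mem measurableSet_Ioo).and (ae_restrict_of_ae (Measure.ae_ne _ _))
  unfold IntegrableOn
  rw [← Measure.prod_restrict, integrable_prod_iff hmeas.aestronglyMeasurable]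
  refine ⟨?_, ((hC' ‖a‖).1.const_mul C).mono'
    hmeas.norm.stronglyMeasurable.integral_prod_right.aestronglyMeasurable ?_⟩
  · filter_upwards [hae] with ρ hρ
    exact (continuous_div_polar_sub (by fun_prop) hρ.1.1.le hρ.2).integrableOn_Ioc
  · filter_upwards [hae] with ρ hρ
    rw [Real.norm_of_nonneg (integral_nonneg fun _ => norm_nonneg _)]
    exact (setIntegral_Icc_eq_setIntegral_Ioc_of_periodic
      ((periodic_polar_quotient h a ρ).comp norm)).symm.trans_le (hC ρ a hρ.1.1.le hρ.1.2.le hρ.2)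

lemma setIntegral_ball_eq_setIntegral_polar (g : ℂ → ℂ) :
    ∫ w in Metric.ball (0 : ℂ) 1, g w =
      ∫ p in Ioo (0 : ℝ) 1 ×ˢ Ioo (-π) π, p.1 * g (p.1 * exp (p.2 * I)) := by
  have hpolar : ∀ p : ℝ × ℝ, Complex.polarCoord.symm p = p.1 * exp (p.2 * I) := fun p => by
    rw [Complex.polarCoord_symm_apply, exp_mul_I]
    push_cast
    rfl
  have hpre : polarCoord.target ∩ {p | p.1 < 1} = Ioo (0 : ℝ) 1 ×ˢ Ioo (-π) π := by
    ext p
    simp only [polarCoord_target, mem_inter_iff, mem_prod, mem_Ioi, mem_Ioo, mem_ofPred_eq]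
    tauto
  have hmeas : MeasurableSet {p : ℝ × ℝ | p.1 < 1} := measurableSet_lt measurable_fst (by fun_prop)
  rw [← integral_indicator measurableSet_ball, ← Complex.integral_comp_polarCoord_symm, ← hpre,
    ← setIntegral_indicator hmeas]
  refine setIntegral_congr_fun polarCoord.open_target.measurableSet fun p hp => ?_
  have hp₀ : 0 < p.1 := hp.1
  by_cases hp₁ : p.1 < 1
  · rw [indicator_of_mem (show p ∈ {p : ℝ × ℝ | p.1 < 1} from hp₁), indicator_of_mem, hpolar,
      real_smul]
    simpa [hpolar, abs_of_pos hp₀] using hp₁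
  · rw [indicator_of_notMem (show p ∉ {p : ℝ × ℝ | p.1 < 1} from hp₁), indicator_of_notMem,
      smul_zero]
    simpa [hpolar, abs_of_pos hp₀] using hp₁

lemma discT_eq_neg_integral_radialDensity (hh : Continuous h) (a : ℂ) :
    discT h a = - ∫ ρ in Icc 0 1, radialDensity h a ρ := by
  set G : ℝ × ℝ → ℂ := fun p => h (p.1 * exp (p.2 * I)) * (2 * I * p.1) / (p.1 * exp (p.2 * I) - a)
  have hG : IntegrableOn G (Ioo 0 1 ×ˢ Ioc (-π) π) (volume.prod volume) :=
    integrableOn_polar_quotient hh a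
  have hpolar : ∫ w in Metric.ball (0 : ℂ) 1, h w / (w - a) * (-2 * I) =
      - ∫ ρ in Icc 0 1, ∫ θ in Icc 0 (2 * π), G (ρ, θ) := by
    calc _ = ∫ p in Ioo (0 : ℝ) 1 ×ˢ Ioo (-π) π, - G p := by
          rw [setIntegral_ball_eq_setIntegral_polar]
          congr 1 with p
          simp only [G]
          ring
      _ = - ∫ ρ in Ioo (0 : ℝ) 1, ∫ θ in Ioo (-π) π, G (ρ, θ) := by
          rw [integral_neg, Measure.volume_eq_prod, setIntegral_prod _
            (hG.mono_set (prod_mono subset_rfl Ioo_subset_Ioc_self))]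
      _ = _ := by
          rw [integral_Icc_eq_integral_Ioo]
          congr 2 with ρ
          rw [← integral_Ioc_eq_integral_Ioo, setIntegral_Icc_eq_setIntegral_Ioc_of_periodic
            (periodic_polar_quotient h a ρ)]
  unfold discT radialDensity
  rw [hpolar, integral_const_mul, mul_neg]

end PolarCoordinates

lemma circleMean_eq_circleIntegral (f : ℂ → ℂ) (a : ℂ) (ρ : ℝ) :
    circleMean f a ρ = (2 * π * I)⁻¹ * circleIntegral (fun w => f w / (w - a)) 0 ρ := by
  rw [circleMean, circleIntegral, intervalIntegral.integral_of_le Real.two_pi_pos.le,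
    integral_Icc_eq_integral_Ioc]
  congr 2 with θ
  simp only [deriv_circleMap, circleMap, zero_add, smul_eq_mul]
  ring

lemma circleMean_one_eq_circleS (f : ℂ → ℂ) (a : ℂ) : circleMean f a 1 = circleS f a :=
  circleMean_eq_circleIntegral f a 1

lemma circleMean_const_one {a : ℂ} {ρ : ℝ} (hρ : 0 ≤ ρ) (hne : ρ ≠ ‖a‖) :
    circleMean (fun _ => 1) a ρ = if ‖a‖ < ρ then 1 else 0 := by
  rw [circleMean_eq_circleIntegral]
  split_ifs with h
  · simp only [one_div]
    rw [circleIntegral.integral_sub_inv_of_mem_ball (by simpa using h),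
      inv_mul_cancel₀ two_pi_I_ne_zero]
  · have hnz : ∀ z ∈ Metric.closedBall (0 : ℂ) ρ, z - a ≠ 0 := fun z hz h₀ => by
      rw [sub_eq_zero.1 h₀] at hz
      exact h (lt_of_le_of_ne (by simpa using hz) hne.symm)
    rw [circleIntegral_eq_zero_of_differentiable_on_off_countable hρ countable_empty, mul_zero]
    · exact ContinuousOn.div (by fun_prop) (by fun_prop) hnz
    · intro z hz
      fun_prop (disch := exact hnz z (Metric.ball_subset_closedBall hz.1))

lemma circleMean_eq {f : ℂ → ℂ} (hf : Continuous f) {a : ℂ} {ρ : ℝ} (hρ : 0 ≤ ρ) (hne : ρ ≠ ‖a‖) :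
    circleMean f a ρ = circleRemainder f a ρ + if ‖a‖ < ρ then f a else 0 := by
  have hjump : (if ‖a‖ < ρ then f a else 0) = f a * circleMean (fun _ => 1) a ρ := by
    rw [circleMean_const_one hρ hne]
    simp
  rw [hjump, circleRemainder, circleMean, circleMean, circleMean, mul_left_comm (f a), ← mul_add,
    ← integral_const_mul (f a), ← integral_add]
  · congr 2 with θ
    ring
  · exact (continuous_div_polar_sub (by fun_prop) hρ hne).integrableOn_Icc
  · exact (continuous_const.mul
      (continuous_div_polar_sub (by fun_prop) hρ hne)).integrableOn_Icc

@[simp] lemma circleRemainder_zero (f : ℂ → ℂ) (a : ℂ) : circleRemainder f a 0 = 0 := by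
  simp [circleRemainder, circleMean]

lemma continuousOn_circleRemainder_Icc {f : ℂ → ℂ} (hf : ContDiff ℝ 1 f) (a : ℂ) :
    ContinuousOn (circleRemainder f a) (Icc 0 1) :=
  (continuousOn_circleRemainder hf (max 1 ‖a‖)).comp (f := fun ρ : ℝ => (a, ρ)) (by fun_prop)
    fun ρ hρ => ⟨by simp, hρ.1, hρ.2.trans (le_max_left _ _)⟩

lemma circleRemainder_one_eq_neg_discT {f : ℂ → ℂ} (hf : ContDiff ℝ 1 f) (a : ℂ) :
    circleRemainder f a 1 = - discT (dbar f) a := by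
  have hinteg := integrableOn_radialDensity (continuous_dbar hf) a
  rw [discT_eq_neg_integral_radialDensity (continuous_dbar hf), neg_neg,
    integral_Icc_eq_integral_Ioc, ← intervalIntegral.integral_of_le zero_le_one,
    integral_eq_of_hasDerivAt_off_countable_of_le (circleRemainder f a) _ zero_le_one
      (countable_singleton ‖a‖) (continuousOn_circleRemainder_Icc hf a)
      (fun ρ hρ => hasDerivAt_circleRemainder hf hρ.1.1.le hρ.2), circleRemainder_zero, sub_zero]
  exact (intervalIntegrable_iff_integrableOn_Icc_of_le zero_le_one).2 hinteg

lemma circleS_add_discT_dbar {f : ℂ → ℂ} (hf : ContDiff ℝ 1 f) {a : ℂ} (ha : ‖a‖ < 1) :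
    circleS f a + discT (dbar f) a = f a := by
  rw [← circleMean_one_eq_circleS, circleMean_eq hf.continuous zero_le_one ha.ne', if_pos ha,
    circleRemainder_one_eq_neg_discT hf]
  ring

lemma continuousOn_discT_dbar {f : ℂ → ℂ} (hf : ContDiff ℝ 1 f) :
    ContinuousOn (discT (dbar f)) (Metric.closedBall 0 1) := by
  have hcont : ContinuousOn (fun a => circleRemainder f a 1) (Metric.closedBall 0 1) :=
    (continuousOn_circleRemainder hf 1).comp (f := fun a : ℂ => (a, (1 : ℝ))) (by fun_prop)
      fun a ha => ⟨ha, by simp⟩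
  simpa only [circleRemainder_one_eq_neg_discT hf, neg_neg] using hcont.fun_neg

lemma differentiableOn_circleS {f : ℂ → ℂ} (hf : Continuous f) :
    DifferentiableOn ℂ (circleS f) (Metric.ball 0 1) := by
  have hseries := hasFPowerSeriesOn_cauchy_integral (f := f) (c := 0) (R := 1)
    hf.continuousOn.circleIntegrable' (by simp)
  have hcauchy : (fun w => (2 * π * I : ℂ)⁻¹ • ∮ z in C(0, (1 : ℝ≥0)), (z - w)⁻¹ • f z) =
      circleS f := by
    ext w
    simp only [circleS, smul_eq_mul, NNReal.coe_one, div_eq_inv_mul]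
  rw [hcauchy] at hseries
  simpa only [Metric.eball_coe, NNReal.coe_one] using hseries.differentiableOn

lemma discT_dbar_rescale {f : ℂ → ℂ} (hf : Differentiable ℝ f) {x : ℂ} {R : ℝ} (hR : 0 < R)
    (hsupp : ∀ w : ℂ, 1 ≤ ‖w‖ → x + (-R : ℝ) * w ∉ tsupport f) :
    discT (dbar fun w => f (x + (-R : ℝ) * w)) 0 =
      ∫ t : ℂ, ((π : ℂ) * t)⁻¹ * dbar f (x - t) := by
  have hscale := Measure.integral_comp_smul (volume : Measure ℂ)
    (fun t => (π * t)⁻¹ * dbar f (x - t)) R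
  rw [finrank_real_complex, abs_of_pos (by positivity), eq_comm, inv_smul_eq_iff₀ (by positivity),
    real_smul, ← integral_const_mul] at hscale
  rw [discT, ← integral_indicator measurableSet_ball, ← integral_const_mul, hscale]
  congr 1 with w
  have hRC : (R : ℂ) ≠ 0 := by exact_mod_cast hR.ne'
  have hpi : (π : ℂ) ≠ 0 := by exact_mod_cast Real.pi_ne_zero
  have hsub : x + (-R : ℝ) * w = x - R • w := by simp [sub_eq_add_neg]
  by_cases hw : w ∈ Metric.ball (0 : ℂ) 1
  · rw [indicator_of_mem hw, dbar_comp_affine hf, hsub, sub_zero, real_smul]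
    rcases eq_or_ne w 0 with rfl | hw₀
    · simp
    push_cast
    field_simp [I_ne_zero]
  · have hz := dbar_eq_zero_of_notMem_tsupport (hsupp w (by simpa using hw))
    rw [indicator_of_notMem hw, ← hsub, hz, mul_zero, mul_zero, mul_zero]

-- Cauchy–Green on a disc containing the support, on whose boundary `f` vanishes.
lemma integral_inv_pi_mul_mul_dbar {f : ℂ → ℂ} (hf : ContDiff ℝ 1 f) (hc : HasCompactSupport f)
    (x : ℂ) : ∫ t : ℂ, ((π : ℂ) * t)⁻¹ * dbar f (x - t) = f x := by
  obtain ⟨R, hR, hball⟩ := hc.isBounded.subset_ball_lt 0 x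
  have hsupp : ∀ w : ℂ, 1 ≤ ‖w‖ → x + (-R : ℝ) * w ∉ tsupport f := fun w hw h => by
    have hlt := hball h
    rw [Metric.mem_ball, dist_eq_norm, add_sub_cancel_left, norm_mul, norm_real, norm_neg,
      Real.norm_of_nonneg hR.le] at hlt
    exact hlt.not_ge (le_mul_of_one_le_right hR.le hw)
  have hS : circleS (fun w => f (x + (-R : ℝ) * w)) 0 = 0 := by
    rw [circleS, circleIntegral.integral_congr (g := fun _ => 0) zero_le_one]
    · simp [circleIntegral]
    · intro w hw
      have hw₁ : 1 ≤ ‖w‖ := by simp_all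
      simp only [image_eq_zero_of_notMem_tsupport (hsupp w hw₁), zero_div]
  have hgreen := circleS_add_discT_dbar (f := fun w => f (x + (-R : ℝ) * w))
    (hf.comp (by fun_prop)) (a := 0) (by simp)
  rw [hS, zero_add, discT_dbar_rescale (hf.differentiable (by simp)) hR hsupp] at hgreen
  simpa using hgreen

lemma exists_dbar_eq {f : ℂ → ℂ} (hf : ContDiff ℝ ∞ f) (hc : HasCompactSupport f) :
    ∃ F : ℂ → ℂ, ContDiff ℝ ∞ F ∧ dbar F = f := by
  have hk : LocallyIntegrable (fun t : ℂ => ((π : ℂ) * t)⁻¹) := by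
    refine locallyIntegrable_of_norm_le_rpow (α := 1) (C := π⁻¹) (by simp) (by simp)
      (.of_forall fun t => ?_) (Measurable.aestronglyMeasurable (by fun_prop))
    rw [Real.rpow_neg_one]
    simp [abs_of_pos Real.pi_pos, mul_comm]
  set M := ContinuousLinearMap.mul ℝ ℂ
  have hf₁ : ContDiff ℝ 1 f := hf.of_le (by simp)
  have hdf : Continuous (fderiv ℝ f) := hf₁.continuous_fderiv (by simp)
  refine ⟨convolution (fun t : ℂ => ((π : ℂ) * t)⁻¹) f M volume,
    hc.contDiff_convolution_right _ hk hf, ?_⟩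
  ext x
  have hderiv : ∀ v, fderiv ℝ (convolution (fun t : ℂ => ((π : ℂ) * t)⁻¹) f M volume) x v =
      ∫ t, ((π : ℂ) * t)⁻¹ * fderiv ℝ f (x - t) v := fun v => by
    rw [(hc.hasFDerivAt_convolution_right M hk hf₁ x).fderiv,
      convolution_precompR_apply _ hk (hc.fderiv ℝ) hdf]
    rfl
  have hinteg : ∀ v, Integrable fun t => ((π : ℂ) * t)⁻¹ * fderiv ℝ f (x - t) v := fun v =>
    ((hc.fderiv_apply ℝ v).convolutionExists_right M hk (hdf.clm_apply continuous_const)) x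
  rw [← integral_inv_pi_mul_mul_dbar hf₁ hc x, dbar, hderiv, hderiv, ← integral_const_mul,
    ← integral_add (hinteg 1) ((hinteg I).const_mul I), ← integral_const_mul]
  congr 1 with t
  simp only [dbar]
  ring

lemma discT_dbar_eqOn {F : ℂ → ℂ} (hF : ContDiff ℝ 1 F) :
    EqOn (discT (dbar F)) (fun a => F a - circleS F a) (Metric.ball 0 1) := fun a ha => by
  simp only [← circleS_add_discT_dbar hF (a := a) (by simpa using ha), add_sub_cancel_left]

lemma contDiffOn_discT {f : ℂ → ℂ} (hf : ContDiff ℝ ∞ f) (hc : HasCompactSupport f) :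
    ContDiffOn ℝ 1 (discT f) (Metric.ball 0 1) := by
  obtain ⟨F, hF, rfl⟩ := exists_dbar_eq hf hc
  have hF₁ : ContDiff ℝ 1 F := hF.of_le (by simp)
  have hS := (differentiableOn_circleS hF.continuous).contDiffOn (n := 1) Metric.isOpen_ball
  exact (hF₁.contDiffOn.sub (hS.restrict_scalars ℝ)).congr (discT_dbar_eqOn hF₁)

lemma dbar_discT {f : ℂ → ℂ} (hf : ContDiff ℝ ∞ f) (hc : HasCompactSupport f) {a : ℂ}
    (ha : ‖a‖ < 1) : dbar (discT f) a = f a := by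
  obtain ⟨F, hF, rfl⟩ := exists_dbar_eq hf hc
  have hF₁ : ContDiff ℝ 1 F := hF.of_le (by simp)
  have hnhds : Metric.ball (0 : ℂ) 1 ∈ 𝓝 a := Metric.isOpen_ball.mem_nhds (by simpa using ha)
  have hS : DifferentiableAt ℂ (circleS F) a :=
    (differentiableOn_circleS hF.continuous).differentiableAt hnhds
  have hev : discT (dbar F) =ᶠ[𝓝 a] fun a => F a - circleS F a :=
    (discT_dbar_eqOn hF₁).eventuallyEq_of_mem hnhds
  have hdbar : dbar (discT (dbar F)) a = dbar (fun a => F a - circleS F a) a := by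
    rw [dbar, hev.fderiv_eq, dbar]
  rw [hdbar, dbar_sub ((hF₁.differentiable (by simp)) a) (hS.restrictScalars ℝ),
    dbar_eq_zero_of_differentiableAt hS, sub_zero]

/-! ### One-variable integral operators on the closed polydisc -/

section KernelOperator

variable {X Y W : Type*} [TopologicalSpace X] [CompactSpace X] [TopologicalSpace Y] [CompactSpace Y]
  [TopologicalSpace W] [SecondCountableTopology W] [MeasurableSpace W] [OpensMeasurableSpace W]
  {μ : Measure W} {k : W → ℂ}

lemma norm_smul_comp_le (c : ℂ) (p : C(X, Y)) (f : C(Y, ℂ)) : ‖c • f.comp p‖ ≤ ‖c‖ * ‖f‖ := by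
  rw [norm_smul]
  gcongr
  exact (ContinuousMap.norm_le _ (norm_nonneg _)).2 fun _ => f.norm_coe_le_norm _

lemma integrable_smul_comp (hk : Integrable k μ) (c : C(W, C(X, Y))) (f : C(Y, ℂ)) :
    Integrable (fun w => k w • f.comp (c w)) μ :=
  (hk.norm.mul_const ‖f‖).mono'
    (hk.1.smul (f.continuous_postcomp.comp c.continuous).aestronglyMeasurable)
    (.of_forall fun w => norm_smul_comp_le (k w) (c w) f)

open Classical in
/-- The bounded operator `f ↦ ∫ k(w) f(c(w, ·)) dμ(w)` on continuous functions; it is `0` by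
convention when the kernel `k` is not integrable. The Cauchy operators in one variable, the torus
integral and the integrals of Henkin's formula are all of this form. -/
def kernelOp (μ : Measure W) (k : W → ℂ) (c : C(W, C(X, Y))) : C(Y, ℂ) →L[ℂ] C(X, ℂ) :=
  if hk : Integrable k μ then
    LinearMap.mkContinuous
      { toFun := fun f => ∫ w, k w • f.comp (c w) ∂μ
        map_add' := fun f g => by
          rw [← integral_add (integrable_smul_comp hk c f) (integrable_smul_comp hk c g)]
          simp only [ContinuousMap.add_comp, smul_add]
        map_smul' := fun a f => by
          rw [RingHom.id_apply, ← integral_smul]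
          simp only [ContinuousMap.smul_comp, smul_comm a] }
      (∫ w, ‖k w‖ ∂μ) fun f => by
        rw [← integral_mul_const]
        exact norm_integral_le_of_norm_le (hk.norm.mul_const _)
          (.of_forall fun w => norm_smul_comp_le (k w) (c w) f)
  else 0

lemma norm_kernelOp_le (μ : Measure W) (k : W → ℂ) (c : C(W, C(X, Y))) :
    ‖kernelOp μ k c‖ ≤ ∫ w, ‖k w‖ ∂μ := by
  have h0 : 0 ≤ ∫ w, ‖k w‖ ∂μ := integral_nonneg fun _ => norm_nonneg _
  unfold kernelOp
  split_ifs
  · exact LinearMap.mkContinuous_norm_le _ h0 _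
  · simpa using h0

lemma kernelOp_apply (hk : Integrable k μ) (c : C(W, C(X, Y))) (f : C(Y, ℂ)) (x : X) :
    kernelOp μ k c f x = ∫ w, k w * f (c w x) ∂μ := by
  rw [kernelOp, dif_pos hk]
  exact ((ContinuousMap.evalCLM ℂ x).integral_comp_comm (integrable_smul_comp hk c f)).symm

/-- The functional `f ↦ ∫ k(w) f(c(w)) dμ(w)` on continuous functions, obtained from `kernelOp` by
taking a one-point space as parameter space. -/
def kernelFunctional (μ : Measure W) (k : W → ℂ) (c : C(W, Y)) : C(Y, ℂ) →L[ℂ] ℂ :=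
  (ContinuousMap.evalCLM ℂ ()).comp (kernelOp μ k (ContinuousMap.const'.comp c))

lemma kernelFunctional_apply (hk : Integrable k μ) (c : C(W, Y)) (f : C(Y, ℂ)) :
    kernelFunctional μ k c f = ∫ w, k w * f (c w) ∂μ :=
  kernelOp_apply hk _ f ()

lemma norm_kernelFunctional_le (μ : Measure W) (k : W → ℂ) (c : C(W, Y)) :
    ‖kernelFunctional μ k c‖ ≤ ∫ w, ‖k w‖ ∂μ := by
  refine ContinuousLinearMap.opNorm_le_bound _ (integral_nonneg fun _ => norm_nonneg _) fun f => ?_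
  rw [kernelFunctional, ContinuousLinearMap.comp_apply, ContinuousMap.evalCLM_apply]
  refine (ContinuousMap.norm_coe_le_norm _ _).trans ?_
  exact ContinuousLinearMap.le_of_opNorm_le _ (norm_kernelOp_le _ _ _) f

end KernelOperator

instance : CompactSpace (closedPolydisc n) :=
  isCompact_iff_compactSpace.1 (isCompact_closedPolydisc n)

lemma zeroExt_of_mem (u : C(closedPolydisc n, ℂ)) {z : Fin n → ℂ}
    (hz : z ∈ closedPolydisc n) : zeroExt u z = u ⟨z, hz⟩ := dif_pos hz

@[simp] lemma zeroExt_coe (u : C(closedPolydisc n, ℂ)) (z : closedPolydisc n) :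
    zeroExt u z = u z := dif_pos z.2

lemma update_mem_closedPolydisc {z : Fin n → ℂ} (hz : z ∈ closedPolydisc n) (i : Fin n)
    {a : ℂ} (ha : ‖a‖ ≤ 1) : Function.update z i a ∈ closedPolydisc n := fun j => by
  rcases eq_or_ne j i with rfl | h
  · simpa using ha
  · simpa [h] using hz j

/-- The joint map `(a, z) ↦ (z_1, …, a, …, z_n)` with `a` in place `i`, on which the one-variable
operators are built. -/
def updatePoint (i : Fin n) :
    C(Metric.closedBall (0 : ℂ) 1 × closedPolydisc n, closedPolydisc n) where
  toFun p := ⟨Function.update p.2.1 i p.1.1,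
    update_mem_closedPolydisc p.2.2 i (mem_closedBall_zero_iff.1 p.1.2)⟩
  continuous_toFun := by fun_prop

/-- The product function `z ↦ ∏ u_i(z_i)` on the closed polydisc; products are the functions on
which the solution operators are computed. -/
def prodFn (u : Fin n → C(ℂ, ℂ)) : C(closedPolydisc n, ℂ) where
  toFun z := ∏ i, u i (z.1 i)
  continuous_toFun := continuous_finsetProd _ fun i _ =>
    (u i).continuous.comp ((continuous_apply i).comp continuous_subtype_val)

lemma prodFn_apply (u : Fin n → C(ℂ, ℂ)) (z : closedPolydisc n) :
    prodFn u z = ∏ i, u i (z.1 i) := rfl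

lemma prod_update_apply (u : Fin n → C(ℂ, ℂ)) (z : Fin n → ℂ) (i : Fin n) (v : C(ℂ, ℂ)) :
    ∏ j, Function.update u i v j (z j) = v (z i) * ∏ j ∈ Finset.univ.erase i, u j (z j) := by
  rw [← Finset.mul_prod_erase _ _ (Finset.mem_univ i), Function.update_self]
  congr 1
  refine Finset.prod_congr rfl fun j hj => ?_
  rw [Function.update_of_ne (Finset.ne_of_mem_erase hj)]

section Slot

variable {W : Type*} [TopologicalSpace W] [SecondCountableTopology W] [MeasurableSpace W]
  [OpensMeasurableSpace W]

/-- The operator that integrates the `i`-th variable of a function along the map `c` against the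
kernel `k`. The Cauchy operators `S_i` and `T_i` at a fixed value of the `i`-th variable are of this
form. -/
def slotOp (μ : Measure W) (c : C(W, Metric.closedBall (0 : ℂ) 1)) (k : W → ℂ) (i : Fin n) :
    C(closedPolydisc n, ℂ) →L[ℂ] C(closedPolydisc n, ℂ) :=
  kernelOp μ k ((updatePoint i).curry.comp c)

lemma slotOp_apply {μ : Measure W} (c : C(W, Metric.closedBall (0 : ℂ) 1)) {k : W → ℂ}
    (hk : Integrable k μ) (i : Fin n) (f : C(closedPolydisc n, ℂ)) (z : closedPolydisc n) :
    slotOp μ c k i f z = ∫ w, k w * f (updatePoint i (c w, z)) ∂μ :=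
  kernelOp_apply hk _ f z

lemma slotOp_prodFn {μ : Measure W} (c : C(W, Metric.closedBall (0 : ℂ) 1)) {k : W → ℂ}
    (hk : Integrable k μ) (i : Fin n) (u : Fin n → C(ℂ, ℂ)) :
    slotOp μ c k i (prodFn u) =
      prodFn (Function.update u i (ContinuousMap.const ℂ (∫ w, k w * u i (c w) ∂μ))) := by
  ext z
  rw [slotOp_apply c hk, prodFn_apply, prod_update_apply, ContinuousMap.const_apply,
    ← integral_mul_const]
  congr 1
  ext w
  rw [prodFn_apply, ← Finset.mul_prod_erase _ _ (Finset.mem_univ i), mul_assoc]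
  congr 2
  · simp [updatePoint]
  · refine Finset.prod_congr rfl fun j hj => ?_
    simp [updatePoint, Function.update_of_ne (Finset.ne_of_mem_erase hj)]

end Slot

/-- The parametrization of the unit circle by the angle. -/
def unitCircle : C(ℝ, Metric.closedBall (0 : ℂ) 1) where
  toFun θ := ⟨exp (θ * I), by simp⟩
  continuous_toFun := by fun_prop

/-- The radial retraction of the plane onto the closed unit disc. It is the identity on the disc and
defined everywhere, so that it can serve as integration path of a `slotOp`. -/
def discRetraction : C(ℂ, Metric.closedBall (0 : ℂ) 1) where
  toFun w := ⟨w / (max 1 ‖w‖ : ℝ), by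
    rw [mem_closedBall_zero_iff, norm_div, norm_real, Real.norm_of_nonneg (by positivity),
      div_le_one (by positivity)]
    exact le_max_right _ _⟩
  continuous_toFun := by
    refine Continuous.subtype_mk (Continuous.div (by fun_prop) (by fun_prop) fun w => ?_) _
    have : (0 : ℝ) < max 1 ‖w‖ := by positivity
    exact_mod_cast this.ne'

lemma discRetraction_of_mem {w : ℂ} (hw : w ∈ Metric.ball (0 : ℂ) 1) :
    (discRetraction w : ℂ) = w := by
  have : max 1 ‖w‖ = 1 := max_eq_left (mem_ball_zero_iff.1 hw).le
  simp [discRetraction, this]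

/-- The Cauchy kernel of the unit circle in the angular variable. -/
def circleKernel (a : ℂ) (θ : ℝ) : ℂ :=
  (2 * π * I)⁻¹ * (I * exp (θ * I) / (exp (θ * I) - a))

/-- The kernel of the Cauchy transform on the disc. -/
def discKernel (a w : ℂ) : ℂ := (2 * π * I)⁻¹ * (-2 * I / (w - a))

/-- The operator `S_i` with the parameter `a` in place of the `i`-th variable. -/
def circleOp (i : Fin n) (a : ℂ) : C(closedPolydisc n, ℂ) →L[ℂ] C(closedPolydisc n, ℂ) :=
  slotOp (volume.restrict (Icc 0 (2 * π))) unitCircle (circleKernel a) i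

/-- The operator `T_i` with the parameter `a` in place of the `i`-th variable. -/
def discOp (i : Fin n) (a : ℂ) : C(closedPolydisc n, ℂ) →L[ℂ] C(closedPolydisc n, ℂ) :=
  slotOp (volume.restrict (Metric.ball (0 : ℂ) 1)) discRetraction (discKernel a) i

lemma continuous_circleKernel {a : ℂ} (ha : ‖a‖ < 1) : Continuous (circleKernel a) := by
  refine continuous_const.mul (Continuous.div (by fun_prop) (by fun_prop) fun θ => ?_)
  simpa using polar_sub_ne_zero zero_le_one ha.ne' θ

lemma integrable_circleKernel {a : ℂ} (ha : ‖a‖ < 1) :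
    Integrable (circleKernel a) (volume.restrict (Icc 0 (2 * π))) :=
  (continuous_circleKernel ha).integrableOn_Icc

lemma integrableOn_norm_inv (R : ℝ) :
    IntegrableOn (fun w : ℂ => ‖w‖⁻¹) (Metric.ball 0 R) := by
  refine integrableOn_ball_of_norm_le_rpow (α := 1) (C := 1) (by simp) (by simp)
    (.of_forall fun t => ?_) (Measurable.aestronglyMeasurable (by fun_prop))
  rw [Real.rpow_neg_one]
  simp

lemma norm_discKernel (a w : ℂ) : ‖discKernel a w‖ = π⁻¹ * ‖w - a‖⁻¹ := by
  simp only [discKernel, norm_mul, norm_div, norm_inv, norm_neg, norm_I, norm_real,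
    RCLike.norm_ofNat, Real.norm_of_nonneg Real.pi_pos.le]
  field_simp

lemma norm_sub_inv_eq_indicator {a w : ℂ} (ha : ‖a‖ ≤ 1) (hw : w ∈ Metric.ball (0 : ℂ) 1) :
    ‖w - a‖⁻¹ = (Metric.ball (0 : ℂ) 2).indicator (fun w : ℂ => ‖w‖⁻¹) (w - a) := by
  rw [indicator_of_mem]
  rw [mem_ball_zero_iff] at hw ⊢
  linarith [norm_sub_le w a]

lemma integrable_indicator_norm_sub_inv (a : ℂ) (R : ℝ) :
    Integrable fun w => (Metric.ball (0 : ℂ) R).indicator (fun w : ℂ => ‖w‖⁻¹) (w - a) :=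
  ((integrableOn_norm_inv R).integrable_indicator measurableSet_ball).comp_sub_right a

lemma integrableOn_norm_sub_inv {a : ℂ} (ha : ‖a‖ ≤ 1) :
    IntegrableOn (fun w : ℂ => ‖w - a‖⁻¹) (Metric.ball 0 1) :=
  (integrable_indicator_norm_sub_inv a 2).integrableOn.congr_fun
    (fun _ hw => (norm_sub_inv_eq_indicator ha hw).symm) measurableSet_ball

lemma setIntegral_ball_norm_sub_inv_le {a : ℂ} (ha : ‖a‖ ≤ 1) :
    ∫ w in Metric.ball (0 : ℂ) 1, ‖w - a‖⁻¹ ≤ ∫ w in Metric.ball (0 : ℂ) 2, ‖w‖⁻¹ := by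
  rw [setIntegral_congr_fun measurableSet_ball fun _ hw => norm_sub_inv_eq_indicator ha hw,
    ← integral_indicator (s := Metric.ball (0 : ℂ) 2) measurableSet_ball,
    ← integral_sub_right_eq_self ((Metric.ball (0 : ℂ) 2).indicator _) a]
  exact setIntegral_le_integral (integrable_indicator_norm_sub_inv a 2)
    (.of_forall fun w => indicator_nonneg (fun _ _ => by positivity) _)

lemma integrable_discKernel {a : ℂ} (ha : ‖a‖ ≤ 1) :
    Integrable (discKernel a) (volume.restrict (Metric.ball (0 : ℂ) 1)) := by
  refine ((integrableOn_norm_sub_inv ha).const_mul π⁻¹).mono'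
    (Measurable.aestronglyMeasurable (by unfold discKernel; fun_prop)) (.of_forall fun w => ?_)
  rw [norm_discKernel]

lemma norm_discOp_le (i : Fin n) {a : ℂ} (ha : ‖a‖ ≤ 1) :
    ‖discOp i a‖ ≤ π⁻¹ * ∫ w in Metric.ball (0 : ℂ) 2, ‖w‖⁻¹ := by
  refine (norm_kernelOp_le _ _ _).trans ?_
  simp_rw [norm_discKernel]
  rw [integral_const_mul]
  gcongr
  exact setIntegral_ball_norm_sub_inv_le ha

lemma norm_circleKernel_le {a : ℂ} {R : ℝ} (hR : R < 1) (ha : ‖a‖ ≤ R) (θ : ℝ) :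
    ‖circleKernel a θ‖ ≤ (2 * π)⁻¹ * (1 - R)⁻¹ := by
  have hdist : 1 - R ≤ ‖exp (θ * I) - a‖ := by
    have := norm_sub_norm_le (exp (θ * I)) a
    rw [norm_exp_ofReal_mul_I] at this
    linarith
  have : 0 < 1 - R := sub_pos.2 hR
  simp only [circleKernel, norm_mul, norm_div, norm_inv, norm_I, norm_real, RCLike.norm_ofNat,
    Real.norm_of_nonneg Real.pi_pos.le, norm_exp_ofReal_mul_I, mul_one, one_div]
  gcongr

lemma norm_circleOp_le (i : Fin n) {a : ℂ} {R : ℝ} (hR : R < 1) (ha : ‖a‖ ≤ R) :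
    ‖circleOp i a‖ ≤ (1 - R)⁻¹ :=
  calc ‖circleOp i a‖ ≤ ∫ θ in Icc 0 (2 * π), ‖circleKernel a θ‖ := norm_kernelOp_le _ _ _
    _ ≤ ∫ _ in Icc 0 (2 * π), (2 * π)⁻¹ * (1 - R)⁻¹ :=
      integral_mono (integrable_circleKernel (ha.trans_lt hR)).norm (integrable_const _)
        (norm_circleKernel_le hR ha)
    _ = (1 - R)⁻¹ := by
      rw [setIntegral_const, Real.volume_real_Icc_of_le (by positivity), sub_zero, smul_eq_mul,
        mul_inv_cancel_left₀ (by positivity)]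

lemma integral_circleKernel_mul (f : ℂ → ℂ) (a : ℂ) :
    ∫ θ in Icc 0 (2 * π), circleKernel a θ * f (exp (θ * I)) = circleS f a := by
  rw [← circleMean_one_eq_circleS, circleMean, ← integral_const_mul]
  congr 1
  ext θ
  simp only [circleKernel, ofReal_one, one_mul, mul_one]
  ring

lemma integral_discKernel_mul (f : ℂ → ℂ) (a : ℂ) :
    ∫ w in Metric.ball (0 : ℂ) 1, discKernel a w * f w = discT f a := by
  rw [discT, ← integral_const_mul]
  congr 1
  ext w
  simp only [discKernel]
  ring

lemma circleOp_prodFn (i : Fin n) {a : ℂ} (ha : ‖a‖ < 1) (u : Fin n → C(ℂ, ℂ)) :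
    circleOp i a (prodFn u) =
      prodFn (Function.update u i (ContinuousMap.const ℂ (circleS (u i) a))) := by
  rw [circleOp, slotOp_prodFn _ (integrable_circleKernel ha), ← integral_circleKernel_mul]
  rfl

lemma discOp_prodFn (i : Fin n) {a : ℂ} (ha : ‖a‖ ≤ 1) (u : Fin n → C(ℂ, ℂ)) :
    discOp i a (prodFn u) =
      prodFn (Function.update u i (ContinuousMap.const ℂ (discT (u i) a))) := by
  rw [discOp, slotOp_prodFn _ (integrable_discKernel ha), ← integral_discKernel_mul,
    setIntegral_congr_fun measurableSet_ball fun w hw => ?_]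
  simp only [discRetraction_of_mem hw]

/-! ### The Nijenhuis–Woolf operator as a family of functionals -/

/-- The composition `S_m ⋯ S_1` evaluated at the coordinates `z_1, …, z_m`, as a bounded operator on
continuous functions. -/
def circleOps (z : Fin n → ℂ) : ℕ → C(closedPolydisc n, ℂ) →L[ℂ] C(closedPolydisc n, ℂ)
  | 0 => ContinuousLinearMap.id ℂ _
  | m + 1 => if h : m < n then (circleOp ⟨m, h⟩ (z ⟨m, h⟩)).comp (circleOps z m) else circleOps z m

/-- The functional `f ↦ T_j S_{j-1} ⋯ S_1 [f](z)`, a summand of the Nijenhuis–Woolf operator. -/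
def nwTerm (z : closedPolydisc n) (j : Fin n) : C(closedPolydisc n, ℂ) →L[ℂ] ℂ :=
  (ContinuousMap.evalCLM ℂ z).comp ((discOp j (z.1 j)).comp (circleOps z.1 j))

lemma circleOp_apply (i : Fin n) {a : ℂ} (ha : ‖a‖ < 1) (f : C(closedPolydisc n, ℂ))
    (ζ : closedPolydisc n) : circleOp i a f ζ =
      (2 * π * I)⁻¹ *
        circleIntegral (fun w => zeroExt f (Function.update ζ.1 i w) / (w - a)) 0 1 := by
  change _ = circleS (fun w => zeroExt f (Function.update ζ.1 i w)) a
  rw [← integral_circleKernel_mul, circleOp,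
    slotOp_apply _ (integrable_circleKernel ha)]
  congr 1
  ext θ
  congr 1
  exact (zeroExt_coe f _).symm

lemma discOp_apply (i : Fin n) {a : ℂ} (ha : ‖a‖ ≤ 1) (f : C(closedPolydisc n, ℂ))
    (ζ : closedPolydisc n) : discOp i a f ζ =
      (2 * π * I)⁻¹ * ∫ w in Metric.ball (0 : ℂ) 1,
        zeroExt f (Function.update ζ.1 i w) / (w - a) * (-2 * I) := by
  change _ = discT (fun w => zeroExt f (Function.update ζ.1 i w)) a
  rw [← integral_discKernel_mul, discOp, slotOp_apply _ (integrable_discKernel ha)]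
  refine setIntegral_congr_fun measurableSet_ball fun w hw => ?_
  congr 1
  rw [← zeroExt_coe]
  simp [updatePoint, discRetraction_of_mem hw]

lemma cauchyCircles_eq {z : Fin n → ℂ} (hz : z ∈ polydisc n) (f : C(closedPolydisc n, ℂ)) (m : ℕ)
    (ζ : closedPolydisc n) (hζ : ∀ i : Fin n, (i : ℕ) < m → ζ.1 i = z i) :
    cauchyCircles m (zeroExt f) ζ.1 = circleOps z m f ζ := by
  induction m generalizing ζ with
  | zero => simp [cauchyCircles, circleOps]
  | succ m ih =>
    rw [cauchyCircles, circleOps]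
    split_ifs with h
    · rw [ContinuousLinearMap.comp_apply, circleOp_apply _ (hz _), cauchyCircle,
        hζ ⟨m, h⟩ (Nat.lt_succ_self m)]
      congr 1
      refine circleIntegral.integral_congr zero_le_one fun w hw => ?_
      have hmem := update_mem_closedPolydisc ζ.2 ⟨m, h⟩ (mem_sphere_zero_iff_norm.1 hw).le
      rw [zeroExt_of_mem _ hmem, ih ⟨_, hmem⟩]
      intro i hi
      exact (Function.update_of_ne (Fin.ne_of_val_ne hi.ne) _ _).trans (hζ i (by lia))
    · exact ih ζ fun i hi => hζ i (by lia)

lemma cauchyDisc_cauchyCircles_eq (z : closedPolydisc n) (hz : z.1 ∈ polydisc n)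
    (f : C(closedPolydisc n, ℂ)) (j : Fin n) :
    cauchyDisc j (cauchyCircles (j : ℕ) (zeroExt f)) z.1 = nwTerm z j f := by
  rw [nwTerm, ContinuousLinearMap.comp_apply, ContinuousLinearMap.comp_apply,
    ContinuousMap.evalCLM_apply, discOp_apply _ (z.2 j), cauchyDisc]
  congr 1
  refine setIntegral_congr_fun measurableSet_ball fun w hw => ?_
  have hmem := update_mem_closedPolydisc z.2 j (mem_ball_zero_iff.1 hw).le
  rw [zeroExt_of_mem _ hmem, ← cauchyCircles_eq hz]
  intro i hi
  exact Function.update_of_ne (Fin.ne_of_lt hi) _ _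

/-- The functional `g ↦ T[g](z)`, with `T` the Nijenhuis–Woolf operator. Unlike `nijenhuisWoolf` it
is visibly linear and bounded for the sup norm. -/
def nwFunctional (z : closedPolydisc n) : (Fin n → C(closedPolydisc n, ℂ)) →L[ℂ] ℂ :=
  ∑ j, (nwTerm z j).comp (ContinuousLinearMap.proj j)

lemma nwFunctional_apply (z : closedPolydisc n) (g : Fin n → C(closedPolydisc n, ℂ)) :
    nwFunctional z g = ∑ j, nwTerm z j (g j) := by
  simp [nwFunctional]

lemma nijenhuisWoolf_eq (z : closedPolydisc n) (hz : z.1 ∈ polydisc n)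
    (g : Fin n → C(closedPolydisc n, ℂ)) : nijenhuisWoolf g z.1 = nwFunctional z g := by
  rw [nwFunctional_apply, nijenhuisWoolf]
  exact Finset.sum_congr rfl fun j _ => cauchyDisc_cauchyCircles_eq z hz (g j) j

lemma circleOps_prodFn {z : Fin n → ℂ} (hz : z ∈ polydisc n) (u : Fin n → C(ℂ, ℂ)) (m : ℕ) :
    circleOps z m (prodFn u) = prodFn fun i =>
      if (i : ℕ) < m then ContinuousMap.const ℂ (circleS (u i) (z i)) else u i := by
  induction m with
  | zero => simp [circleOps]
  | succ m ih =>
    rw [circleOps]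
    split_ifs with h
    · rw [ContinuousLinearMap.comp_apply, ih, circleOp_prodFn _ (hz _)]
      congr 1
      ext i : 1
      rcases eq_or_ne i ⟨m, h⟩ with rfl | hne
      · simp
      · have hlt : (i : ℕ) < m + 1 ↔ (i : ℕ) < m := by grind
        simp only [Function.update_of_ne hne, hlt]
    · rw [ih]
      congr 1
      ext i : 1
      have hlt : (i : ℕ) < m + 1 ↔ (i : ℕ) < m := by lia
      simp only [hlt]

/-- The factor in the `i`-th variable of `T_j S_{j-1} ⋯ S_1 [∏ u_i]`. -/
def nwFactor (u : Fin n → C(ℂ, ℂ)) (j i : Fin n) : ℂ → ℂ :=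
  if i < j then circleS (u i) else if i = j then discT (u i) else u i

lemma nwTerm_prodFn (z : closedPolydisc n) (hz : z.1 ∈ polydisc n) (u : Fin n → C(ℂ, ℂ))
    (j : Fin n) : nwTerm z j (prodFn u) = ∏ i, nwFactor u j i (z.1 i) := by
  rw [nwTerm, ContinuousLinearMap.comp_apply, ContinuousLinearMap.comp_apply,
    ContinuousMap.evalCLM_apply, circleOps_prodFn hz, discOp_prodFn _ (z.2 j), prodFn_apply]
  refine Finset.prod_congr rfl fun i _ => ?_
  rcases eq_or_ne i j with rfl | hne
  · simp [nwFactor]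
  · rw [Function.update_of_ne hne, nwFactor]
    by_cases h : i < j
    · simp [h]
    · simp [h, hne]

lemma prod_erase_nwFactor (u : Fin n → C(ℂ, ℂ)) (z : Fin n → ℂ) (j : Fin n) :
    ∏ i ∈ Finset.univ.erase j, nwFactor u j i (z i) =
      (∏ i with i < j, circleS (u i) (z i)) * ∏ i with j < i, u i (z i) := by
  have hsplit : Finset.univ.erase j = Finset.disjUnion {i | i < j} {i | j < i}
      (Finset.disjoint_filter.2 fun _ _ h => h.not_gt) := by
    ext i
    simp [lt_or_lt_iff_ne]
  rw [hsplit, Finset.prod_disjUnion]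
  congr 1
  · refine Finset.prod_congr rfl fun i hi => ?_
    rw [nwFactor, if_pos (Finset.mem_filter.1 hi).2]
  · refine Finset.prod_congr rfl fun i hi => ?_
    have h := (Finset.mem_filter.1 hi).2
    rw [nwFactor, if_neg h.not_gt, if_neg h.ne']

lemma nwFactor_self (u : Fin n → C(ℂ, ℂ)) (j : Fin n) : nwFactor u j j = discT (u j) := by
  simp [nwFactor]

lemma norm_circleOps_le {R : ℝ} (hR : R < 1) {z : Fin n → ℂ} (hz : ‖z‖ ≤ R) (m : ℕ) :
    ‖circleOps z m‖ ≤ ((1 - R)⁻¹) ^ m := by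
  have hone : 1 ≤ (1 - R)⁻¹ :=
    (one_le_inv₀ (sub_pos.2 hR)).2 (by linarith [(norm_nonneg z).trans hz])
  induction m with
  | zero => simpa [circleOps] using ContinuousLinearMap.norm_id_le
  | succ m ih =>
    rw [circleOps]
    split_ifs with h
    · refine (ContinuousLinearMap.opNorm_comp_le _ _).trans ?_
      rw [pow_succ']
      gcongr
      exact norm_circleOp_le _ hR ((norm_le_pi_norm z _).trans hz)
    · exact ih.trans (pow_le_pow_right₀ hone (Nat.le_succ m))

lemma exists_norm_nwTerm_le {R : ℝ} (hR : R < 1) (j : Fin n) :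
    ∃ C, 0 ≤ C ∧ ∀ z : closedPolydisc n, ‖z.1‖ ≤ R → ‖nwTerm z j‖ ≤ C := by
  have : 0 ≤ ∫ w in Metric.ball (0 : ℂ) 2, ‖w‖⁻¹ := integral_nonneg fun _ => by positivity
  have : 0 ≤ (1 - R)⁻¹ := inv_nonneg.2 (sub_nonneg.2 hR.le)
  refine ⟨(π⁻¹ * ∫ w in Metric.ball (0 : ℂ) 2, ‖w‖⁻¹) * ((1 - R)⁻¹) ^ (j : ℕ), by positivity,
    fun z hz => ContinuousLinearMap.opNorm_le_bound _ (by positivity) fun f => ?_⟩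
  rw [nwTerm, ContinuousLinearMap.comp_apply, ContinuousMap.evalCLM_apply]
  refine (ContinuousMap.norm_coe_le_norm _ _).trans
    ((ContinuousLinearMap.le_opNorm _ _).trans ?_)
  gcongr
  refine (ContinuousLinearMap.opNorm_comp_le _ _).trans ?_
  gcongr
  · exact norm_discOp_le _ (z.2 j)
  · exact norm_circleOps_le hR hz _

/-! ### The Cauchy torus integral and product test functions -/

/-- The parametrization of the distinguished boundary of the polydisc by the angles. -/
def torusPoint : C(Fin n → ℝ, closedPolydisc n) where
  toFun θ := ⟨fun i => exp (θ i * I), fun i => by simp⟩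
  continuous_toFun := by fun_prop

/-- The functional `u ↦ K[u](z)`, with `K` the Cauchy torus integral. -/
def torusFunctional (z : Fin n → ℂ) : C(closedPolydisc n, ℂ) →L[ℂ] ℂ :=
  kernelFunctional (angleMeasure (Fin n)) (fun θ => ∏ i, circleKernel (z i) (θ i)) torusPoint

lemma integrable_prod_circleKernel {z : Fin n → ℂ} (hz : z ∈ polydisc n) :
    Integrable (fun θ : Fin n → ℝ => ∏ i, circleKernel (z i) (θ i))
      (angleMeasure (Fin n)) :=
  Integrable.fintype_prod (f := fun i θ => circleKernel (z i) θ)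
    fun i => integrable_circleKernel (hz i)

lemma cauchyTorus_eq {z : Fin n → ℂ} (hz : z ∈ polydisc n) (u : C(closedPolydisc n, ℂ)) :
    cauchyTorus (zeroExt u) z = torusFunctional z u := by
  have hbox : (Icc (0 : Fin n → ℝ) fun _ => 2 * π) = univ.pi fun _ => Icc 0 (2 * π) :=
    (pi_univ_Icc _ _).symm
  rw [torusFunctional, kernelFunctional_apply (integrable_prod_circleKernel hz), angleMeasure,
    cauchyTorus, torusIntegral, hbox, volume_pi, Measure.restrict_pi_pi, ← integral_const_mul]
  congr 1 with θ
  have hmap : torusMap (0 : Fin n → ℂ) (fun _ => 1) θ = (torusPoint θ).1 := by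
    ext i; simp [torusMap, torusPoint]
  have hcoord : ∀ i, (torusPoint θ).1 i = exp (θ i * I) := fun i => rfl
  rw [hmap, zeroExt_coe, smul_eq_mul]
  simp only [hcoord, circleKernel, Finset.prod_mul_distrib, Finset.prod_div_distrib,
    Finset.prod_const, Finset.card_univ, Fintype.card_fin, ofReal_one, one_mul, inv_pow]
  ring

lemma torusFunctional_prodFn {z : Fin n → ℂ} (hz : z ∈ polydisc n) (u : Fin n → C(ℂ, ℂ)) :
    torusFunctional z (prodFn u) = ∏ i, circleS (u i) (z i) := by
  rw [torusFunctional, kernelFunctional_apply (integrable_prod_circleKernel hz)]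
  simp_rw [← integral_circleKernel_mul]
  rw [← integral_fintype_prod_eq_prod]
  congr 1
  ext θ
  rw [prodFn_apply, ← Finset.prod_mul_distrib]
  rfl

/-- Smooth functions of one variable with compact support; their products are the test functions on
which solution operators are compared. -/
def IsBump (f : C(ℂ, ℂ)) : Prop := ContDiff ℝ ∞ f ∧ HasCompactSupport f

lemma IsBump.contDiff_one {f : C(ℂ, ℂ)} (hf : IsBump f) : ContDiff ℝ 1 f := hf.1.of_le (by simp)

open Classical in
/-- The Wirtinger derivative `∂f/∂z̄` as a bundled continuous function, with `0` as junk value when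
it is not continuous. -/
def dbarC (f : C(ℂ, ℂ)) : C(ℂ, ℂ) := if h : Continuous (dbar f) then ⟨dbar f, h⟩ else 0

lemma IsBump.coe_dbarC {f : C(ℂ, ℂ)} (hf : IsBump f) : ⇑(dbarC f) = dbar f := by
  rw [dbarC, dif_pos (continuous_dbar hf.contDiff_one)]; rfl

/-- The coefficients of the form `∂̄(∏ u_i(z_i))`. -/
def dbarProd (u : Fin n → C(ℂ, ℂ)) (j : Fin n) : C(closedPolydisc n, ℂ) :=
  prodFn (Function.update u j (dbarC (u j)))

lemma dbarProd_apply {u : Fin n → C(ℂ, ℂ)} (hu : ∀ i, IsBump (u i)) (j : Fin n)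
    (z : closedPolydisc n) :
    dbarProd u j z = dbar (u j) (z.1 j) * ∏ i ∈ Finset.univ.erase j, u i (z.1 i) := by
  rw [dbarProd, prodFn_apply, prod_update_apply, (hu j).coe_dbarC]

lemma nwTerm_dbarProd {u : Fin n → C(ℂ, ℂ)} (hu : ∀ i, IsBump (u i)) (z : closedPolydisc n)
    (hz : z.1 ∈ polydisc n) (j : Fin n) : nwTerm z j (dbarProd u j) =
      discT (dbar (u j)) (z.1 j) * (∏ i with i < j, circleS (u i) (z.1 i)) *
        ∏ i with j < i, u i (z.1 i) := by
  rw [dbarProd, nwTerm_prodFn z hz, ← Finset.mul_prod_erase _ _ (Finset.mem_univ j),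
    prod_erase_nwFactor, nwFactor_self, Function.update_self, (hu j).coe_dbarC, ← mul_assoc]
  congr 1
  · congr 1
    refine Finset.prod_congr rfl fun i hi => ?_
    rw [Function.update_of_ne (Finset.mem_filter.1 hi).2.ne]
  · refine Finset.prod_congr rfl fun i hi => ?_
    rw [Function.update_of_ne (Finset.mem_filter.1 hi).2.ne']

lemma sum_lt_mul_prod_lt_mul_prod_gt {ι R : Type*} [Fintype ι] [LinearOrder ι] [CommRing R]
    (t u : ι → R) (k : ι) :
    ∑ i with i < k, t i * (∏ j with j < i, (u j - t j)) * ∏ j with i < j, u j =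
      ∏ i, u i - (∏ i with i < k, (u i - t i)) * ∏ i with k ≤ i, u i := by
  set g : ι → R := fun i => if i < k then t i else 0 with hg
  have hlt : ∀ i < k, u i - t i = u i - g i := fun i hi => by simp [hg, hi]
  have hge : ∀ i, k ≤ i → u i = u i - g i := fun i hi => by simp [hg, hi.not_gt]
  have hprod : (∏ i with i < k, (u i - t i)) * ∏ i with k ≤ i, u i = ∏ i, (u i - g i) := by
    rw [← Finset.prod_filter_mul_prod_filter_not Finset.univ (fun i => i < k)]
    simp only [not_lt]
    congr 1
    · exact Finset.prod_congr rfl fun i hi => hlt i (Finset.mem_filter.1 hi).2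
    · exact Finset.prod_congr rfl fun i hi => hge i (Finset.mem_filter.1 hi).2
  rw [hprod, Finset.prod_sub_ordered, sub_sub_cancel, Finset.sum_filter]
  refine Finset.sum_congr rfl fun i _ => ?_
  split_ifs with hi
  · rw [Finset.prod_congr rfl fun j hj => hlt j ((Finset.mem_filter.1 hj).2.trans hi)]
    simp [hg, hi]
  · simp [hg, hi]

lemma IsBump.circleS_eq_sub {f : C(ℂ, ℂ)} (hf : IsBump f) {a : ℂ} (ha : ‖a‖ < 1) :
    circleS f a = f a - discT (dbar f) a :=
  eq_sub_of_add_eq (circleS_add_discT_dbar hf.contDiff_one ha)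

lemma nwFunctional_dbarProd {u : Fin n → C(ℂ, ℂ)} (hu : ∀ i, IsBump (u i)) (z : closedPolydisc n)
    (hz : z.1 ∈ polydisc n) :
    nwFunctional z (dbarProd u) = prodFn u z - ∏ i, circleS (u i) (z.1 i) := by
  rw [nwFunctional_apply]
  simp_rw [nwTerm_dbarProd hu z hz, fun i => (hu i).circleS_eq_sub (hz i)]
  rw [Finset.prod_sub_ordered, prodFn_apply]
  ring

lemma sum_lt_nwTerm_dbarProd {u : Fin n → C(ℂ, ℂ)} (hu : ∀ i, IsBump (u i)) (z : closedPolydisc n)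
    (hz : z.1 ∈ polydisc n) (k : Fin n) :
    ∑ i with i < k, nwTerm z i (dbarProd u i) =
      prodFn u z - (∏ i with i < k, circleS (u i) (z.1 i)) * ∏ i with k ≤ i, u i (z.1 i) := by
  simp_rw [nwTerm_dbarProd hu z hz, fun i => (hu i).circleS_eq_sub (hz i)]
  exact sum_lt_mul_prod_lt_mul_prod_gt _ _ k

/-! ### Derivatives of product functions -/

lemma hasFDerivAt_prod_apply {a : Fin n → ℂ → ℂ} {z : Fin n → ℂ}
    (ha : ∀ i, DifferentiableAt ℝ (a i) (z i)) :
    HasFDerivAt (fun z : Fin n → ℂ => ∏ i, a i (z i))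
      (∑ i, (∏ j ∈ Finset.univ.erase i, a j (z j)) •
        (fderiv ℝ (a i) (z i)).comp (ContinuousLinearMap.proj i)) z :=
  HasFDerivAt.finsetProd (u := Finset.univ) (g := fun i (z : Fin n → ℂ) => a i (z i))
    (g' := fun i => (fderiv ℝ (a i) (z i)).comp (ContinuousLinearMap.proj i))
    fun i _ => (ha i).hasFDerivAt.comp z (hasFDerivAt_apply i z)

lemma wirtingerBar_prod {a : Fin n → ℂ → ℂ} {z : Fin n → ℂ}
    (ha : ∀ i, DifferentiableAt ℝ (a i) (z i)) (j : Fin n) :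
    wirtingerBar j (fun z : Fin n → ℂ => ∏ i, a i (z i)) z =
      dbar (a j) (z j) * ∏ i ∈ Finset.univ.erase j, a i (z i) := by
  have hsingle : ∀ v : ℂ, fderiv ℝ (fun z : Fin n → ℂ => ∏ i, a i (z i)) z (Pi.single j v) =
      (∏ i ∈ Finset.univ.erase j, a i (z i)) * fderiv ℝ (a j) (z j) v := fun v => by
    rw [(hasFDerivAt_prod_apply ha).fderiv, sum_apply, Finset.sum_eq_single j]
    · simp
    · intro i _ hij
      simp [Pi.single_eq_of_ne hij]
    · simp
  rw [wirtingerBar, hsingle, hsingle, dbar]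
  ring

/-! ### Mollification by product kernels -/

lemma polydisc_eq_ball (n : ℕ) : polydisc n = Metric.ball 0 1 := by
  ext z
  simp [polydisc, pi_norm_lt_iff]

lemma isOpen_polydisc (n : ℕ) : IsOpen (polydisc n) := by
  rw [polydisc_eq_ball]
  exact Metric.isOpen_ball

lemma measurableSet_polydisc (n : ℕ) : MeasurableSet (polydisc n) :=
  (isOpen_polydisc n).measurableSet

lemma continuousOn_zeroExt_polydisc (u : C(closedPolydisc n, ℂ)) :
    ContinuousOn (zeroExt u) (polydisc n) := (continuousOn_zeroExt u).mono (polydisc_subset n)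

/-- The radius of the `N`-th mollifier. The offset keeps the dilation factor `shrink N`, which is
`1 - 2 * mollRadius N`, positive. -/
def mollRadius (N : ℕ) : ℝ := 1 / (N + 3)

lemma mollRadius_pos (N : ℕ) : 0 < mollRadius N := by unfold mollRadius; positivity

lemma two_mul_mollRadius_lt_one (N : ℕ) : 2 * mollRadius N < 1 := by
  rw [mollRadius, mul_one_div, div_lt_one (by positivity)]
  linarith [N.cast_nonneg (α := ℝ)]

lemma tendsto_mollRadius : Tendsto mollRadius atTop (𝓝 0) := by
  refine ((tendsto_one_div_add_atTop_nhds_zero_nat (𝕜 := ℝ)).comp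
    (tendsto_add_atTop_nat 2)).congr fun N => ?_
  simp only [Function.comp_apply, mollRadius]
  push_cast
  ring

/-- The dilation factor `r` applied before mollifying, so that the mollification of a function on
the polydisc is defined up to the boundary. -/
def shrink (N : ℕ) : ℝ := 1 - 2 * mollRadius N

lemma shrink_pos (N : ℕ) : 0 < shrink N := sub_pos.2 (two_mul_mollRadius_lt_one N)

lemma norm_shrink_mul (N : ℕ) (z : ℂ) : ‖(shrink N : ℂ) * z‖ = shrink N * ‖z‖ := by
  rw [norm_mul, norm_real, Real.norm_of_nonneg (shrink_pos N).le]

/-- A bump function on the plane whose support has radius `mollRadius N`; its normalization is the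
`N`-th mollifier. -/
def mollBump (N : ℕ) : ContDiffBump (0 : ℂ) where
  rIn := mollRadius N / 2
  rOut := mollRadius N
  rIn_pos := half_pos (mollRadius_pos N)
  rIn_lt_rOut := half_lt_self (mollRadius_pos N)

/-- The mollifier `ψ` in one variable, of integral one. -/
def mollifier (N : ℕ) : C(ℂ, ℂ) where
  toFun x := ((mollBump N).normed volume x : ℝ)
  continuous_toFun := continuous_ofReal.comp (mollBump N).continuous_normed

lemma mollifier_apply (N : ℕ) (x : ℂ) : mollifier N x = ((mollBump N).normed volume x : ℝ) := rfl

lemma contDiff_mollifier (N : ℕ) : ContDiff ℝ ∞ (mollifier N) :=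
  ofRealCLM.contDiff.comp (mollBump N).contDiff_normed

lemma mollifier_eq_zero {N : ℕ} {x : ℂ} (hx : mollRadius N ≤ ‖x‖) : mollifier N x = 0 := by
  rw [mollifier_apply, ofReal_eq_zero, ← Function.notMem_support, ContDiffBump.support_normed_eq]
  simpa [mollBump] using hx

lemma tsupport_mollifier_subset (N : ℕ) :
    tsupport (mollifier N) ⊆ Metric.closedBall 0 (mollRadius N) := by
  refine closure_minimal (fun x hx => ?_) Metric.isClosed_closedBall
  rw [mem_closedBall_zero_iff]
  contrapose! hx
  exact Function.notMem_support.2 (mollifier_eq_zero hx.le)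

lemma dbar_mollifier_eq_zero {N : ℕ} {x : ℂ} (hx : mollRadius N < ‖x‖) :
    dbar (mollifier N) x = 0 :=
  dbar_eq_zero_of_notMem_tsupport fun h =>
    hx.not_ge (mem_closedBall_zero_iff.1 (tsupport_mollifier_subset N h))

/-- The one-variable function `z ↦ ψ(r z - w)`, the factor of the mollifying kernel. -/
def mollShift (N : ℕ) (w : ℂ) : C(ℂ, ℂ) :=
  (mollifier N).comp ⟨fun z => -w + shrink N * z, by fun_prop⟩

lemma isBump_mollShift (N : ℕ) (w : ℂ) : IsBump (mollShift N w) := by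
  refine ⟨(contDiff_mollifier N).comp (g := mollifier N) (f := fun z => -w + shrink N * z)
    (by fun_prop), ?_⟩
  refine HasCompactSupport.of_support_subset_isCompact
    (isCompact_closedBall 0 ((mollRadius N + ‖w‖) / shrink N)) fun z hz => ?_
  rw [mem_closedBall_zero_iff, le_div_iff₀' (shrink_pos N), ← norm_shrink_mul]
  contrapose! hz
  refine Function.notMem_support.2 (mollifier_eq_zero (?_ : mollRadius N ≤ ‖-w + shrink N * z‖))
  rw [neg_add_eq_sub]
  linarith [norm_sub_norm_le ((shrink N : ℂ) * z) w]

lemma dbar_mollShift (N : ℕ) (w z : ℂ) :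
    dbar (mollShift N w) z = shrink N * dbar (mollifier N) (-w + shrink N * z) :=
  dbar_comp_affine ((contDiff_mollifier N).differentiable (by simp)) (-w) (shrink N) z

/-- A function on the closed polydisc together with the coefficients of a `(0,1)`-form. Pairs of a
function and its `∂̄` are approximated in this space. -/
abbrev FormPair (n : ℕ) : Type := C(closedPolydisc n, ℂ) × (Fin n → C(closedPolydisc n, ℂ))

/-- The pair `(p, ∂̄p)` for the product function `p = ∏ u_i(z_i)`. -/
def prodPair (u : Fin n → C(ℂ, ℂ)) : FormPair n := (prodFn u, dbarProd u)

/-- The mollifying kernel `z ↦ ∏ ψ(r z_i - w_i)` with parameter `w`, together with its `∂̄`. -/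
def mollPair (N : ℕ) (w : Fin n → ℂ) : FormPair n := prodPair fun i => mollShift N (w i)

/-- The mollifying kernel at the point `z`, as a function of the integration variable `w`. -/
def mollKernel (N : ℕ) (z w : Fin n → ℂ) : ℂ := ∏ i, mollifier N (-w i + shrink N * z i)

lemma mollPair_snd_apply (N : ℕ) (w : Fin n → ℂ) (j : Fin n) (z : closedPolydisc n) :
    (mollPair N w).2 j z = shrink N * dbar (mollifier N) (-w j + shrink N * z.1 j) *
      ∏ i ∈ Finset.univ.erase j, mollifier N (-w i + shrink N * z.1 i) := by
  rw [← dbar_mollShift]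
  exact dbarProd_apply (fun i => isBump_mollShift N (w i)) j z

lemma wirtingerBar_mollKernel (N : ℕ) (z w : Fin n → ℂ) (j : Fin n) :
    wirtingerBar j (mollKernel N z) w = - (dbar (mollifier N) (-w j + shrink N * z j) *
      ∏ i ∈ Finset.univ.erase j, mollifier N (-w i + shrink N * z i)) := by
  have hd : Differentiable ℝ (mollifier N) := (contDiff_mollifier N).differentiable (by simp)
  have hreflect : dbar (fun x => mollifier N (-x + shrink N * z j)) (w j) =
      -dbar (mollifier N) (-w j + shrink N * z j) := by
    have h := dbar_comp_affine hd (shrink N * z j) (-1) (w j)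
    simpa only [ofReal_neg, ofReal_one, neg_one_mul, add_comm] using h
  refine (wirtingerBar_prod (a := fun i x => mollifier N (-x + shrink N * z i))
    (fun i => (hd _).comp _ (by fun_prop)) j).trans ?_
  rw [hreflect, neg_mul]

lemma mollPair_snd_eq (N : ℕ) (w : Fin n → ℂ) (j : Fin n) (z : closedPolydisc n) :
    (mollPair N w).2 j z = -(shrink N * wirtingerBar j (mollKernel N z.1) w) := by
  rw [mollPair_snd_apply, wirtingerBar_mollKernel]
  ring

/-- A closed polydisc inside the open unit polydisc which contains the supports of all the
mollifying kernels at points of the closed unit polydisc. -/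
def innerPolydisc (n N : ℕ) : Set (Fin n → ℂ) := Metric.closedBall 0 (1 - mollRadius N)

lemma isCompact_innerPolydisc (n N : ℕ) : IsCompact (innerPolydisc n N) := isCompact_closedBall _ _

lemma innerPolydisc_subset (n N : ℕ) : innerPolydisc n N ⊆ polydisc n := by
  rw [polydisc_eq_ball]
  exact Metric.closedBall_subset_ball (sub_lt_self _ (mollRadius_pos N))

lemma lt_norm_of_notMem_innerPolydisc {N : ℕ} {w z : Fin n → ℂ} (hw : w ∉ innerPolydisc n N)
    (hz : z ∈ closedPolydisc n) : ∃ i, mollRadius N < ‖-w i + shrink N * z i‖ := by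
  rw [innerPolydisc, mem_closedBall_zero_iff, pi_norm_le_iff_of_nonneg
    (by linarith [two_mul_mollRadius_lt_one N, mollRadius_pos N]), not_forall] at hw
  obtain ⟨i, hi⟩ := hw
  refine ⟨i, ?_⟩
  have hshrink : ‖(shrink N : ℂ) * z i‖ ≤ 1 - 2 * mollRadius N :=
    (norm_shrink_mul N (z i)).trans_le (mul_le_of_le_one_right (shrink_pos N).le (hz i))
  have hsub := norm_sub_norm_le (w i) ((shrink N : ℂ) * z i)
  rw [norm_sub_rev, sub_eq_neg_add ((shrink N : ℂ) * z i)] at hsub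
  linarith

lemma mollKernel_eq_zero {N : ℕ} {w z : Fin n → ℂ} (hw : w ∉ innerPolydisc n N)
    (hz : z ∈ closedPolydisc n) : mollKernel N z w = 0 := by
  obtain ⟨i, hi⟩ := lt_norm_of_notMem_innerPolydisc hw hz
  exact Finset.prod_eq_zero (Finset.mem_univ i) (mollifier_eq_zero hi.le)

lemma wirtingerBar_mollKernel_eq_zero {N : ℕ} {w z : Fin n → ℂ} (hw : w ∉ innerPolydisc n N)
    (hz : z ∈ closedPolydisc n) (j : Fin n) : wirtingerBar j (mollKernel N z) w = 0 := by
  obtain ⟨i, hi⟩ := lt_norm_of_notMem_innerPolydisc hw hz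
  rw [wirtingerBar_mollKernel, neg_eq_zero]
  rcases eq_or_ne i j with rfl | h
  · rw [dbar_mollifier_eq_zero hi, zero_mul]
  · rw [Finset.prod_eq_zero (Finset.mem_erase.2 ⟨h, Finset.mem_univ i⟩) (mollifier_eq_zero hi.le),
      mul_zero]

lemma contDiff_mollKernel (N : ℕ) (z : Fin n → ℂ) : ContDiff ℝ ∞ (mollKernel N z) :=
  contDiff_prod fun i _ => (contDiff_mollifier N).comp (by fun_prop)

lemma isTest_mollKernel (N : ℕ) {z : Fin n → ℂ} (hz : z ∈ closedPolydisc n) :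
    IsTest (mollKernel N z) := by
  have hsub : Function.support (mollKernel N z) ⊆ innerPolydisc n N := fun w hw =>
    not_imp_comm.1 (mollKernel_eq_zero · hz) hw
  exact ⟨contDiff_mollKernel N z,
    HasCompactSupport.of_support_subset_isCompact (isCompact_innerPolydisc n N) hsub,
    (closure_minimal hsub (isCompact_innerPolydisc n N).isClosed).trans (innerPolydisc_subset n N)⟩

lemma continuous_mollPair (N : ℕ) : Continuous (mollPair N : (Fin n → ℂ) → FormPair n) := by
  have hm : Continuous (mollifier N) := (mollifier N).continuous
  have hd : Continuous (dbar (mollifier N)) :=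
    continuous_dbar ((contDiff_mollifier N).of_le (by simp))
  have hc : ∀ i, Continuous fun p : (Fin n → ℂ) × closedPolydisc n =>
      -p.1 i + shrink N * p.2.1 i := fun i =>
    ((continuous_apply i).comp continuous_fst).neg.add
      (continuous_const.mul
        ((continuous_apply i).comp (continuous_subtype_val.comp continuous_snd)))
  refine Continuous.prodMk ?_ (continuous_pi fun j => ?_)
  · exact ContinuousMap.continuous_of_continuous_uncurry (fun w => (mollPair N w).1)
      (continuous_finsetProd Finset.univ fun i _ => hm.comp (hc i))
  · refine ContinuousMap.continuous_of_continuous_uncurry (fun w => (mollPair N w).2 j) ?_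
    simp only [Function.uncurry_def, mollPair_snd_apply]
    exact (continuous_const.mul (hd.comp (hc j))).mul
      (continuous_finsetProd _ fun i _ => hm.comp (hc i))

/-- The mollification of `v` after dilation, and its `∂̄`. The pair is defined as a Bochner integral
of pairs `(p, ∂̄p)` with product functions `p`. -/
def mollify (N : ℕ) (v : (Fin n → ℂ) → ℂ) : FormPair n :=
  ∫ w in innerPolydisc n N, v w • mollPair N w

lemma integrableOn_smul_mollPair (N : ℕ) {v : (Fin n → ℂ) → ℂ} (hv : ContinuousOn v (polydisc n)) :
    IntegrableOn (fun w => v w • mollPair N w) (innerPolydisc n N) :=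
  ((hv.mono (innerPolydisc_subset n N)).smul
    (continuous_mollPair N).continuousOn).integrableOn_compact (isCompact_innerPolydisc n N)

lemma setIntegral_polydisc_eq_setIntegral_innerPolydisc {N : ℕ} {f : (Fin n → ℂ) → ℂ}
    (hf : ∀ w ∉ innerPolydisc n N, f w = 0) :
    ∫ w in polydisc n, f w = ∫ w in innerPolydisc n N, f w :=
  setIntegral_eq_of_subset_of_forall_sdiff_eq_zero (measurableSet_polydisc n)
    (innerPolydisc_subset n N) fun w hw => hf w hw.2

lemma mollify_fst_apply (N : ℕ) {v : (Fin n → ℂ) → ℂ} (hv : ContinuousOn v (polydisc n))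
    (z : closedPolydisc n) :
    (mollify N v).1 z = ∫ w in polydisc n, v w * mollKernel N z.1 w := by
  rw [setIntegral_polydisc_eq_setIntegral_innerPolydisc fun w hw => by
    rw [mollKernel_eq_zero hw z.2, mul_zero]]
  exact (((ContinuousMap.evalCLM ℂ z).comp (ContinuousLinearMap.fst ℂ _ _)).integral_comp_comm
    (integrableOn_smul_mollPair N hv)).symm

lemma mollify_snd_apply (N : ℕ) {v : (Fin n → ℂ) → ℂ} (hv : ContinuousOn v (polydisc n))
    (j : Fin n) (z : closedPolydisc n) : (mollify N v).2 j z =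
      -(shrink N * ∫ w in polydisc n, v w * wirtingerBar j (mollKernel N z.1) w) := by
  rw [setIntegral_polydisc_eq_setIntegral_innerPolydisc fun w hw => by
    rw [wirtingerBar_mollKernel_eq_zero hw z.2, mul_zero], ← integral_const_mul, ← integral_neg]
  refine (((ContinuousMap.evalCLM ℂ z).comp ((ContinuousLinearMap.proj j).comp
    (ContinuousLinearMap.snd ℂ _ _))).integral_comp_comm
      (integrableOn_smul_mollPair N hv)).symm.trans ?_
  congr 1 with w
  change v w * (mollPair N w).2 j z = _
  rw [mollPair_snd_eq]
  ring

lemma mollify_mem {S : Submodule ℂ (FormPair n)} (hS : IsClosed (S : Set (FormPair n)))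
    (h : ∀ u : Fin n → C(ℂ, ℂ), (∀ i, IsBump (u i)) → prodPair u ∈ S) (N : ℕ)
    {v : (Fin n → ℂ) → ℂ} (hv : ContinuousOn v (polydisc n)) : mollify N v ∈ S := by
  have := hS
  rw [← Submodule.Quotient.mk_eq_zero, ← Submodule.mkQ_apply, ← Submodule.mkQL_apply, mollify,
    ← S.mkQL.integral_comp_comm (integrableOn_smul_mollPair N hv)]
  refine integral_eq_zero_of_ae (.of_forall fun w => ?_)
  change S.mkQL (v w • mollPair N w) = 0
  rw [Submodule.mkQL_apply, Submodule.mkQ_apply, Submodule.Quotient.mk_eq_zero]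
  exact S.smul_mem _ (h _ fun i => isBump_mollShift N (w i))

lemma mollKernel_eq_ofReal (N : ℕ) (z w : Fin n → ℂ) :
    mollKernel N z w = ((∏ i, (mollBump N).normed volume (-w i + shrink N * z i) : ℝ) : ℂ) :=
  (ofReal_prod _ _).symm

lemma integral_prod_normed_mollBump (N : ℕ) (z : Fin n → ℂ) :
    ∫ w : Fin n → ℂ, ∏ i, (mollBump N).normed volume (-w i + shrink N * z i) = 1 := by
  rw [integral_fintype_prod_volume_eq_prod
    (fun i x => (mollBump N).normed volume (-x + shrink N * z i))]
  refine Finset.prod_eq_one fun i _ => ?_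
  simp_rw [neg_add_eq_sub]
  rw [integral_sub_left_eq_self ((mollBump N).normed volume), ContDiffBump.integral_normed]

lemma mollKernel_eq_zero_of_notMem_polydisc {N : ℕ} {w z : Fin n → ℂ} (hw : w ∉ polydisc n)
    (hz : z ∈ closedPolydisc n) : mollKernel N z w = 0 :=
  mollKernel_eq_zero (fun h => hw (innerPolydisc_subset n N h)) hz

lemma integral_mollKernel (N : ℕ) {z : Fin n → ℂ} (hz : z ∈ closedPolydisc n) :
    ∫ w in polydisc n, mollKernel N z w = 1 := by
  rw [setIntegral_eq_integral_of_forall_compl_eq_zero fun w hw =>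
    mollKernel_eq_zero_of_notMem_polydisc hw hz]
  simp_rw [mollKernel_eq_ofReal]
  rw [integral_complex_ofReal, integral_prod_normed_mollBump, ofReal_one]

lemma integral_norm_mollKernel (N : ℕ) {z : Fin n → ℂ} (hz : z ∈ closedPolydisc n) :
    ∫ w in polydisc n, ‖mollKernel N z w‖ = 1 := by
  rw [setIntegral_eq_integral_of_forall_compl_eq_zero fun w hw => by
    rw [mollKernel_eq_zero_of_notMem_polydisc hw hz, norm_zero],
    ← integral_prod_normed_mollBump N z]
  congr 1 with w
  rw [mollKernel_eq_ofReal, norm_real, Real.norm_of_nonneg]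
  exact Finset.prod_nonneg fun i _ => (mollBump N).nonneg_normed _

lemma integrableOn_mollKernel (N : ℕ) (z : Fin n → ℂ) :
    IntegrableOn (mollKernel N z) (polydisc n) :=
  ((contDiff_mollKernel N z).continuous.continuousOn.integrableOn_compact
    (isCompact_closedPolydisc n)).mono_set (polydisc_subset n)

lemma integrableOn_mul_mollKernel (N : ℕ) (u : C(closedPolydisc n, ℂ)) (z : Fin n → ℂ) :
    IntegrableOn (fun w => zeroExt u w * mollKernel N z w) (polydisc n) :=
  (((continuousOn_zeroExt u).mul
    (contDiff_mollKernel N z).continuous.continuousOn).integrableOn_compact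
      (isCompact_closedPolydisc n)).mono_set (polydisc_subset n)

lemma dist_le_of_mollKernel_ne_zero {N : ℕ} {w z : Fin n → ℂ} (hz : z ∈ closedPolydisc n)
    (h : mollKernel N z w ≠ 0) : dist w z ≤ 3 * mollRadius N := by
  have hpos := mollRadius_pos N
  refine (dist_pi_le_iff (by positivity)).2 fun i => ?_
  have hker : ‖-w i + shrink N * z i‖ < mollRadius N := by
    contrapose! h
    exact Finset.prod_eq_zero (Finset.mem_univ i) (mollifier_eq_zero h)
  have hdil : ‖((2 * mollRadius N : ℝ) : ℂ) * z i‖ ≤ 2 * mollRadius N := by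
    rw [norm_mul, norm_real, Real.norm_of_nonneg (by positivity)]
    exact mul_le_of_le_one_right (by positivity) (hz i)
  have hsplit : w i - z i = -(-w i + shrink N * z i) - (2 * mollRadius N : ℝ) * z i := by
    simp only [shrink]; push_cast; ring
  rw [dist_eq_norm, hsplit]
  refine (norm_sub_le _ _).trans ?_
  rw [norm_neg]
  linarith

lemma mollify_fst_sub_apply (N : ℕ) (u : C(closedPolydisc n, ℂ)) (z : closedPolydisc n) :
    (mollify N (zeroExt u)).1 z - u z =
      ∫ w in polydisc n, (zeroExt u w - u z) * mollKernel N z.1 w := by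
  simp_rw [sub_mul]
  rw [integral_sub (integrableOn_mul_mollKernel N u z.1)
    ((integrableOn_mollKernel N z.1).const_mul _), integral_const_mul,
    integral_mollKernel N z.2, mul_one, mollify_fst_apply N (continuousOn_zeroExt_polydisc u)]

lemma norm_mollify_fst_sub_le {N : ℕ} {u : C(closedPolydisc n, ℂ)} {ε : ℝ} (hε : 0 ≤ ε)
    (hu : ∀ w z, dist w z ≤ 3 * mollRadius N → dist (u w) (u z) ≤ ε) :
    ‖(mollify N (zeroExt u)).1 - u‖ ≤ ε := by
  refine (ContinuousMap.norm_le _ hε).2 fun z => ?_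
  rw [ContinuousMap.sub_apply, mollify_fst_sub_apply]
  calc ‖∫ w in polydisc n, (zeroExt u w - u z) * mollKernel N z.1 w‖
      ≤ ∫ w in polydisc n, ε * ‖mollKernel N z.1 w‖ := by
        refine norm_integral_le_of_norm_le ((integrableOn_mollKernel N z.1).norm.const_mul _) ?_
        filter_upwards [ae_restrict_mem (measurableSet_polydisc n)] with w hw
        by_cases h0 : mollKernel N z.1 w = 0
        · simp [h0]
        rw [norm_mul, zeroExt_of_mem u (polydisc_subset n hw), ← dist_eq_norm]
        gcongr
        exact hu _ _ (dist_le_of_mollKernel_ne_zero z.2 h0)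
    _ = ε := by rw [integral_const_mul, integral_norm_mollKernel N z.2, mul_one]

lemma tendsto_mollify (u : C(closedPolydisc n, ℂ)) :
    Tendsto (fun N => (mollify N (zeroExt u)).1) atTop (𝓝 u) := by
  refine Metric.tendsto_nhds.2 fun δ hδ => ?_
  obtain ⟨η, hη, hu⟩ := Metric.uniformContinuous_iff.1
    (CompactSpace.uniformContinuous_of_continuous u.continuous) (δ / 2) (half_pos hδ)
  have hlim : Tendsto (fun N => 3 * mollRadius N) atTop (𝓝 0) := by
    simpa using tendsto_mollRadius.const_mul 3
  filter_upwards [hlim.eventually_lt_const hη] with N hN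
  rw [dist_eq_norm]
  exact (norm_mollify_fst_sub_le (half_pos hδ).le fun w z hwz => (hu (hwz.trans_lt hN)).le).trans_lt
    (half_lt_self hδ)

/-! ### Families of functionals and their pairings with weights -/

section Families

variable {X E F : Type*} [TopologicalSpace X] [NormedAddCommGroup E] [NormedSpace ℂ E]
  [NormedAddCommGroup F] [NormedSpace ℂ F]

/-- The vectors on which a family of operators depends continuously on the parameter in `s`; it is
closed when the family is bounded on `s`, which reduces continuity to a spanning set. -/
def continuousOnSubmodule (Λ : X → E →L[ℂ] F) (s : Set X) : Submodule ℂ E where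
  carrier := {f | ContinuousOn (fun x => Λ x f) s}
  zero_mem' := by simpa only [mem_ofPred_eq, map_zero] using continuousOn_const
  add_mem' hf hg := by simpa only [mem_ofPred_eq, map_add] using ContinuousOn.fun_add hf hg
  smul_mem' a f hf := by simpa only [mem_ofPred_eq, map_smul] using ContinuousOn.fun_const_smul hf a

lemma isClosed_continuousOnSubmodule {Λ : X → E →L[ℂ] F} {s : Set X} {C : ℝ}
    (hC : ∀ x ∈ s, ‖Λ x‖ ≤ C) : IsClosed (continuousOnSubmodule Λ s : Set E) := by
  refine isClosed_of_closure_subset fun f hf => ?_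
  obtain ⟨f', hf', hlim⟩ := mem_closure_iff_seq_limit.1 hf
  refine TendstoUniformlyOn.continuousOn (F := fun k x => Λ x (f' k)) (p := atTop) ?_
    (.of_forall hf')
  have h0 : Tendsto (fun k => C * ‖f - f' k‖) atTop (𝓝 0) := by
    simpa using ((tendsto_const_nhds (x := f)).sub hlim).norm.const_mul C
  refine Metric.tendstoUniformlyOn_iff.2 fun ε hε => ?_
  filter_upwards [h0.eventually_lt_const hε] with k hk x hx
  rw [dist_eq_norm, ← map_sub]
  exact ((Λ x).le_of_opNorm_le (hC x hx) _).trans_lt hk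

/-- The continuous functions with compact support in the open polydisc, such as the test functions
and their derivatives. -/
structure IsWeight (φ : (Fin n → ℂ) → ℂ) : Prop where
  continuous : Continuous φ
  hasCompactSupport : HasCompactSupport φ
  tsupport_subset : tsupport φ ⊆ polydisc n

lemma IsWeight.exists_norm_le {φ : (Fin n → ℂ) → ℂ} (hφ : IsWeight φ) :
    ∃ R < 1, ∀ z ∈ tsupport φ, ‖z‖ ≤ R := by
  obtain ⟨R, hR, hsub⟩ := exists_lt_subset_ball (isClosed_tsupport φ)
    (hφ.tsupport_subset.trans (polydisc_eq_ball n).subset)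
  exact ⟨R, hR, fun z hz => (mem_ball_zero_iff.1 (hsub hz)).le⟩

lemma IsWeight.integrable_mul {v φ : (Fin n → ℂ) → ℂ} (hφ : IsWeight φ)
    (hv : ContinuousOn v (polydisc n)) : Integrable fun z => v z * φ z := by
  refine Continuous.integrable_of_hasCompactSupport (continuous_iff_continuousAt.2 fun z => ?_)
    hφ.hasCompactSupport.mul_left
  by_cases hz : z ∈ tsupport φ
  · exact (hv.continuousAt ((isOpen_polydisc n).mem_nhds (hφ.tsupport_subset hz))).mul
      hφ.continuous.continuousAt
  · refine (continuousAt_const (y := (0 : ℂ))).congr ?_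
    filter_upwards [notMem_tsupport_iff_eventuallyEq.1 hz] with w hw
    rw [hw, Pi.zero_apply, mul_zero]

/-- Families of functionals that are bounded on compact subsets of the open polydisc and depend
continuously (in the weak-* sense) on the point there. -/
structure IsRegularFamily (Λ : (Fin n → ℂ) → E →L[ℂ] ℂ) : Prop where
  bound : ∀ R < 1, ∃ C, ∀ z, ‖z‖ ≤ R → ‖Λ z‖ ≤ C
  continuousOn : ∀ f, ContinuousOn (fun z => Λ z f) (polydisc n)

namespace IsRegularFamily

variable {Λ Λ' : (Fin n → ℂ) → E →L[ℂ] ℂ}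

lemma zero : IsRegularFamily fun _ : Fin n → ℂ => (0 : E →L[ℂ] ℂ) where
  bound _ _ := ⟨0, fun _ _ => norm_zero.le⟩
  continuousOn _ := continuousOn_const

lemma comp (hΛ : IsRegularFamily Λ) (A : F →L[ℂ] E) :
    IsRegularFamily fun z => (Λ z).comp A where
  bound R hR := by
    obtain ⟨C, hC⟩ := hΛ.bound R hR
    exact ⟨C * ‖A‖, fun z hz => ((Λ z).opNorm_comp_le A).trans (by gcongr; exact hC z hz)⟩
  continuousOn f := hΛ.continuousOn (A f)

lemma sub (hΛ : IsRegularFamily Λ) (hΛ' : IsRegularFamily Λ') :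
    IsRegularFamily fun z => Λ z - Λ' z where
  bound R hR := by
    obtain ⟨C, hC⟩ := hΛ.bound R hR
    obtain ⟨C', hC'⟩ := hΛ'.bound R hR
    exact ⟨C + C', fun z hz => (norm_sub_le _ _).trans (add_le_add (hC z hz) (hC' z hz))⟩
  continuousOn f := (hΛ.continuousOn f).sub (hΛ'.continuousOn f)

lemma sum {ι : Type*} {s : Finset ι} {Λ : ι → (Fin n → ℂ) → E →L[ℂ] ℂ}
    (hΛ : ∀ i, IsRegularFamily (Λ i)) : IsRegularFamily fun z => ∑ i ∈ s, Λ i z where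
  bound R hR := by
    choose C hC using fun i => (hΛ i).bound R hR
    exact ⟨∑ i ∈ s, C i, fun z hz => norm_sum_le_of_le s fun i _ => hC i z hz⟩
  continuousOn f := by
    simpa only [sum_apply] using continuousOn_finsetSum s fun i _ => (hΛ i).continuousOn f

end IsRegularFamily

open Classical in
/-- The pairing `f ↦ ∫ Λ_z(f) φ(z)` of a family of functionals with a weight, with `0` as junk value
when the family is not regular or `φ` is not a weight. -/
def pairing (Λ : (Fin n → ℂ) → E →L[ℂ] ℂ) (φ : (Fin n → ℂ) → ℂ) : E →L[ℂ] ℂ :=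
  if h : IsRegularFamily Λ ∧ IsWeight φ then
    LinearMap.mkContinuousOfExistsBound
      { toFun := fun f => ∫ z in polydisc n, Λ z f * φ z
        map_add' := fun f g => by
          simp only [map_add, add_mul]
          exact integral_add (h.2.integrable_mul (h.1.continuousOn f)).integrableOn
            (h.2.integrable_mul (h.1.continuousOn g)).integrableOn
        map_smul' := fun a f => by
          simp only [map_smul, smul_eq_mul, mul_assoc, integral_const_mul, RingHom.id_apply] } <| by
      obtain ⟨R, hR, hφR⟩ := h.2.exists_norm_le
      obtain ⟨C, hC⟩ := h.1.bound R hR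
      refine ⟨C * ∫ z in polydisc n, ‖φ z‖, fun f => ?_⟩
      rw [mul_right_comm, ← integral_const_mul]
      refine norm_integral_le_of_norm_le ((h.2.continuous.integrable_of_hasCompactSupport
        h.2.hasCompactSupport).norm.integrableOn.const_mul _) (.of_forall fun z => ?_)
      rw [norm_mul]
      by_cases h0 : φ z = 0
      · simp [h0]
      · gcongr
        exact (Λ z).le_of_opNorm_le (hC z (hφR z (subset_tsupport φ h0))) f
  else 0

lemma pairing_apply {Λ : (Fin n → ℂ) → E →L[ℂ] ℂ} (hΛ : IsRegularFamily Λ)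
    {φ : (Fin n → ℂ) → ℂ} (hφ : IsWeight φ) (f : E) :
    pairing Λ φ f = ∫ z in polydisc n, Λ z f * φ z := by
  rw [pairing, dif_pos ⟨hΛ, hφ⟩]; rfl

open Classical in
/-- Extension by zero of a family of functionals parametrized by the closed polydisc. -/
def familyExt (Λ : closedPolydisc n → E →L[ℂ] ℂ) (z : Fin n → ℂ) : E →L[ℂ] ℂ :=
  if h : z ∈ closedPolydisc n then Λ ⟨z, h⟩ else 0

lemma familyExt_of_mem (Λ : closedPolydisc n → E →L[ℂ] ℂ) {z : Fin n → ℂ} (hz : z ∈ polydisc n) :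
    familyExt Λ z = Λ ⟨z, polydisc_subset n hz⟩ := dif_pos _

lemma norm_familyExt_le {Λ : closedPolydisc n → E →L[ℂ] ℂ} {z : Fin n → ℂ} {C : ℝ} (hC : 0 ≤ C)
    (h : ∀ hz : z ∈ closedPolydisc n, ‖Λ ⟨z, hz⟩‖ ≤ C) : ‖familyExt Λ z‖ ≤ C := by
  unfold familyExt
  split_ifs with hz
  exacts [h hz, norm_zero.trans_le hC]

end Families

/-- Evaluation at a point of `ℂⁿ`, zero off the closed polydisc. -/
def evalExt (z : Fin n → ℂ) : C(closedPolydisc n, ℂ) →L[ℂ] ℂ :=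
  familyExt (fun z => ContinuousMap.evalCLM ℂ z) z

lemma evalExt_apply (z : Fin n → ℂ) (f : C(closedPolydisc n, ℂ)) : evalExt z f = zeroExt f z := by
  unfold evalExt familyExt zeroExt
  split_ifs <;> rfl

lemma isRegularFamily_evalExt : IsRegularFamily (evalExt (n := n)) where
  bound _ _ := ⟨1, fun z _ => norm_familyExt_le zero_le_one fun _ =>
    ContinuousLinearMap.opNorm_le_bound _ zero_le_one fun f => by
      rw [one_mul]; exact f.norm_coe_le_norm _⟩
  continuousOn f := by simpa only [evalExt_apply] using continuousOn_zeroExt_polydisc f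

/-- The `j`-th Nijenhuis–Woolf summand at a point of `ℂⁿ`, zero off the closed polydisc. -/
def nwTermExt (j : Fin n) (z : Fin n → ℂ) : C(closedPolydisc n, ℂ) →L[ℂ] ℂ :=
  familyExt (fun z => nwTerm z j) z

lemma nwTermExt_prodFn (u : Fin n → C(ℂ, ℂ)) (j : Fin n) {z : Fin n → ℂ} (hz : z ∈ polydisc n) :
    nwTermExt j z (prodFn u) = ∏ i, nwFactor u j i (z i) := by
  rw [nwTermExt, familyExt_of_mem _ hz]
  exact nwTerm_prodFn ⟨z, polydisc_subset n hz⟩ hz u j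

lemma contDiffOn_nwFactor {u : Fin n → C(ℂ, ℂ)} (hu : ∀ i, IsBump (u i)) (j i : Fin n) :
    ContDiffOn ℝ 1 (nwFactor u j i) (Metric.ball 0 1) := by
  unfold nwFactor
  split_ifs
  · exact ((differentiableOn_circleS (u i).continuous).contDiffOn
      Metric.isOpen_ball).restrict_scalars ℝ
  · exact contDiffOn_discT (hu i).1 (hu i).2
  · exact (hu i).contDiff_one.contDiffOn

lemma contDiffOn_prod_apply {a : Fin n → ℂ → ℂ}
    (ha : ∀ i, ContDiffOn ℝ 1 (a i) (Metric.ball 0 1)) :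
    ContDiffOn ℝ 1 (fun z : Fin n → ℂ => ∏ i, a i (z i)) (polydisc n) :=
  contDiffOn_prod fun i _ => (ha i).comp (contDiff_apply ℝ ℂ i).contDiffOn
    fun _ hz => mem_ball_zero_iff.2 (hz i)

lemma mem_of_forall_prodFn_mem {S : Submodule ℂ C(closedPolydisc n, ℂ)}
    (hS : IsClosed (S : Set C(closedPolydisc n, ℂ)))
    (h : ∀ u : Fin n → C(ℂ, ℂ), (∀ i, IsBump (u i)) → prodFn u ∈ S) (f : C(closedPolydisc n, ℂ)) :
    f ∈ S :=
  hS.mem_of_tendsto (tendsto_mollify f) <| .of_forall fun N =>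
    mollify_mem (S := S.comap (LinearMap.fst ℂ _ _)) (hS.preimage continuous_fst)
      h N (continuousOn_zeroExt_polydisc f)

lemma isRegularFamily_nwTermExt (j : Fin n) : IsRegularFamily (nwTermExt j) := by
  have hbound : ∀ R < 1, ∃ C, ∀ z, ‖z‖ ≤ R → ‖nwTermExt j z‖ ≤ C := fun R hR => by
    obtain ⟨C, hC₀, hC⟩ := exists_norm_nwTerm_le hR j
    exact ⟨C, fun z hz => norm_familyExt_le hC₀ fun hz' => hC ⟨z, hz'⟩ hz⟩
  refine ⟨hbound, fun f z hz => ?_⟩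
  obtain ⟨R, hzR, hR⟩ := exists_between (mem_ball_zero_iff.1 (polydisc_eq_ball n ▸ hz))
  obtain ⟨C, hC⟩ := hbound R hR
  have hsub : Metric.ball 0 R ⊆ polydisc n :=
    (Metric.ball_subset_ball hR.le).trans (polydisc_eq_ball n).superset
  have hf : f ∈ continuousOnSubmodule (nwTermExt j) (Metric.ball 0 R) :=
    mem_of_forall_prodFn_mem
      (isClosed_continuousOnSubmodule fun w hw => hC w (mem_ball_zero_iff.1 hw).le)
      (fun u hu => ((contDiffOn_prod_apply (contDiffOn_nwFactor hu j)).continuousOn.mono hsub).congr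
        fun w hw => nwTermExt_prodFn u j (hsub hw)) f
  exact (hf.continuousAt (Metric.isOpen_ball.mem_nhds
    (mem_ball_zero_iff.2 hzR))).continuousWithinAt

/-! ### Integration by parts -/

lemma IsTest.isWeight {φ : (Fin n → ℂ) → ℂ} (hφ : IsTest φ) : IsWeight φ :=
  ⟨hφ.1.continuous, hφ.2.1, hφ.2.2⟩

lemma IsTest.isWeight_fderiv {φ : (Fin n → ℂ) → ℂ} (hφ : IsTest φ) (e : Fin n → ℂ) :
    IsWeight fun z => fderiv ℝ φ z e where
  continuous := (hφ.1.continuous_fderiv (by simp)).clm_apply continuous_const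
  hasCompactSupport := hφ.2.1.fderiv_apply ℝ e
  tsupport_subset := (tsupport_fderiv_apply_subset ℝ e).trans hφ.2.2

lemma tsupport_wirtingerBar_subset (φ : (Fin n → ℂ) → ℂ) (k : Fin n) :
    tsupport (wirtingerBar k φ) ⊆ tsupport φ := by
  refine closure_minimal (fun z hz => ?_) (isClosed_tsupport φ)
  by_contra h
  exact hz (by simp [wirtingerBar, fderiv_of_notMem_tsupport ℝ h])

lemma IsTest.isWeight_wirtingerBar {φ : (Fin n → ℂ) → ℂ} (hφ : IsTest φ) (k : Fin n) :
    IsWeight (wirtingerBar k φ) where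
  continuous := continuous_const.mul
    ((hφ.isWeight_fderiv _).continuous.add (continuous_const.mul (hφ.isWeight_fderiv _).continuous))
  hasCompactSupport :=
    hφ.2.1.mono' ((subset_tsupport _).trans (tsupport_wirtingerBar_subset φ k))
  tsupport_subset := (tsupport_wirtingerBar_subset φ k).trans hφ.2.2

lemma IsWeight.setIntegral_mul {φ : (Fin n → ℂ) → ℂ} (hφ : IsWeight φ) (v : (Fin n → ℂ) → ℂ) :
    ∫ z in polydisc n, v z * φ z = ∫ z, v z * φ z :=
  setIntegral_eq_integral_of_forall_compl_eq_zero fun z hz => by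
    rw [image_eq_zero_of_notMem_tsupport fun h => hz (hφ.tsupport_subset h), mul_zero]

section IntegrationByParts

variable {V φ : (Fin n → ℂ) → ℂ}

lemma continuousOn_fderiv_apply_polydisc (hV : ContDiffOn ℝ 1 V (polydisc n)) (e : Fin n → ℂ) :
    ContinuousOn (fun z => fderiv ℝ V z e) (polydisc n) :=
  (hV.continuousOn_fderiv_of_isOpen (isOpen_polydisc n) le_rfl).clm_apply continuousOn_const

lemma integral_mul_fderiv_eq_neg (hV : ContDiffOn ℝ 1 V (polydisc n)) (hφ : IsTest φ)
    (e : Fin n → ℂ) : ∫ z, V z * fderiv ℝ φ z e = -∫ z, fderiv ℝ V z e * φ z :=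
  integral_mul_fderiv_eq_neg_fderiv_mul_of_integrable
    (hφ.isWeight.integrable_mul (continuousOn_fderiv_apply_polydisc hV e))
    ((hφ.isWeight_fderiv e).integrable_mul hV.continuousOn)
    (hφ.isWeight.integrable_mul hV.continuousOn)
    (fun _ hz => (hV.differentiableOn (by simp)).differentiableAt
      ((isOpen_polydisc n).mem_nhds (hφ.2.2 hz)))
    (fun z _ => hφ.1.differentiable (by simp) z)

lemma setIntegral_mul_wirtingerBar (hV : ContDiffOn ℝ 1 V (polydisc n)) (hφ : IsTest φ)
    (k : Fin n) :
    ∫ z in polydisc n, V z * wirtingerBar k φ z = -∫ z in polydisc n, wirtingerBar k V z * φ z := by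
  have hleft : ∀ z, V z * wirtingerBar k φ z = (1 / 2) * (V z * fderiv ℝ φ z (Pi.single k 1) +
      I * (V z * fderiv ℝ φ z (Pi.single k I))) := fun z => by rw [wirtingerBar]; ring
  have hright : ∀ z, wirtingerBar k V z * φ z = (1 / 2) * (fderiv ℝ V z (Pi.single k 1) * φ z +
      I * (fderiv ℝ V z (Pi.single k I) * φ z)) := fun z => by rw [wirtingerBar]; ring
  have hφi : ∀ e, Integrable fun z => V z * fderiv ℝ φ z e := fun e =>
    (hφ.isWeight_fderiv e).integrable_mul hV.continuousOn
  have hVi : ∀ e, Integrable fun z => fderiv ℝ V z e * φ z := fun e =>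
    hφ.isWeight.integrable_mul (continuousOn_fderiv_apply_polydisc hV e)
  rw [(hφ.isWeight_wirtingerBar k).setIntegral_mul, hφ.isWeight.setIntegral_mul]
  simp_rw [hleft, hright]
  rw [integral_const_mul, integral_const_mul, integral_add (hφi _) ((hφi _).const_mul _),
    integral_add (hVi _) ((hVi _).const_mul _), integral_const_mul, integral_const_mul,
    integral_mul_fderiv_eq_neg hV hφ, integral_mul_fderiv_eq_neg hV hφ]
  ring

end IntegrationByParts

/-! ### The Nijenhuis–Woolf operator solves the equation -/

/-- `∂̄v = g` in the sense of distributions, for a function `v` defined on `ℂⁿ` of which only the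
values on the open polydisc matter. -/
def IsWeakSolution (v : (Fin n → ℂ) → ℂ) (g : Fin n → C(closedPolydisc n, ℂ)) : Prop :=
  ∀ φ : (Fin n → ℂ) → ℂ, IsTest φ → ∀ j : Fin n,
    ∫ z in polydisc n, v z * wirtingerBar j φ z = -∫ z in polydisc n, zeroExt (g j) z * φ z

lemma apply_mollify_eq {l₁ l₂ : FormPair n →L[ℂ] ℂ}
    (h : ∀ u : Fin n → C(ℂ, ℂ), (∀ i, IsBump (u i)) → l₁ (prodPair u) = l₂ (prodPair u)) (N : ℕ)
    {v : (Fin n → ℂ) → ℂ} (hv : ContinuousOn v (polydisc n)) :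
    l₁ (mollify N v) = l₂ (mollify N v) :=
  mollify_mem (S := LinearMap.eqLocus l₁.toLinearMap l₂.toLinearMap)
    (isClosed_eq l₁.continuous l₂.continuous) h N hv

/-- The coefficient of `dz̄_k` in the form of a pair. -/
def formCoeff (k : Fin n) : FormPair n →L[ℂ] C(closedPolydisc n, ℂ) :=
  (ContinuousLinearMap.proj k).comp (ContinuousLinearMap.snd ℂ _ _)

/-- The functional that sends `(p, ∂̄p)`, for a product function `p`, to the derivative
`∂/∂z̄_k` of the `j`-th Nijenhuis–Woolf summand `T_j S_{j-1} ⋯ S_1 p` at `z`. -/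
def nwDbar (j k : Fin n) (z : Fin n → ℂ) : FormPair n →L[ℂ] ℂ :=
  if j < k then (nwTermExt j z).comp (formCoeff k)
  else if j = k then (evalExt z).comp (ContinuousLinearMap.fst ℂ _ _) -
    ∑ i with i < k, (nwTermExt i z).comp (formCoeff i)
  else 0

lemma isRegularFamily_nwDbar (j k : Fin n) : IsRegularFamily (nwDbar j k) := by
  unfold nwDbar
  split_ifs
  · exact (isRegularFamily_nwTermExt j).comp _
  · exact (isRegularFamily_evalExt.comp _).sub
      (IsRegularFamily.sum fun i => (isRegularFamily_nwTermExt i).comp _)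
  · exact IsRegularFamily.zero

section ProdFn

variable {u : Fin n → C(ℂ, ℂ)} (hu : ∀ i, IsBump (u i)) {z : Fin n → ℂ} (hz : z ∈ polydisc n)
include hu hz

lemma wirtingerBar_prod_nwFactor (j k : Fin n) :
    wirtingerBar k (fun z : Fin n → ℂ => ∏ i, nwFactor u j i (z i)) z =
      dbar (nwFactor u j k) (z k) * ∏ i ∈ Finset.univ.erase k, nwFactor u j i (z i) :=
  wirtingerBar_prod (fun i => ((contDiffOn_nwFactor hu j i).differentiableOn
    (by simp)).differentiableAt (Metric.isOpen_ball.mem_nhds (mem_ball_zero_iff.2 (hz i)))) k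

lemma wirtingerBar_prod_nwFactor_of_lt {j k : Fin n} (hjk : j < k) :
    wirtingerBar k (fun z : Fin n → ℂ => ∏ i, nwFactor u j i (z i)) z =
      nwTermExt j z (dbarProd u k) := by
  have hk : ∀ v : Fin n → C(ℂ, ℂ), nwFactor v j k = v k := fun v => by
    rw [nwFactor, if_neg hjk.not_gt, if_neg hjk.ne']
  rw [wirtingerBar_prod_nwFactor hu hz, dbarProd, nwTermExt_prodFn _ _ hz,
    ← Finset.mul_prod_erase _ _ (Finset.mem_univ k), hk, hk, Function.update_self,
    (hu k).coe_dbarC]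
  congr 1
  refine Finset.prod_congr rfl fun i hi => ?_
  rw [nwFactor, nwFactor, Function.update_of_ne (Finset.ne_of_mem_erase hi)]

lemma wirtingerBar_prod_nwFactor_self (k : Fin n) :
    wirtingerBar k (fun z : Fin n → ℂ => ∏ i, nwFactor u k i (z i)) z =
      evalExt z (prodFn u) - ∑ i with i < k, nwTermExt i z (dbarProd u i) := by
  have hsum := sum_lt_nwTerm_dbarProd hu ⟨z, polydisc_subset n hz⟩ hz k
  have hle : ∏ i with k ≤ i, u i (z i) = u k (z k) * ∏ i with k < i, u i (z i) := by
    have hins : Finset.univ.filter (k ≤ ·) = insert k (Finset.univ.filter (k < ·)) := by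
      ext i; simp [le_iff_eq_or_lt, eq_comm]
    rw [hins, Finset.prod_insert (by simp)]
  simp only [evalExt, nwTermExt, familyExt_of_mem _ hz, ContinuousMap.evalCLM_apply]
  rw [hsum, sub_sub_cancel, hle, wirtingerBar_prod_nwFactor hu hz, nwFactor_self,
    dbar_discT (hu k).1 (hu k).2 (hz k), prod_erase_nwFactor, mul_left_comm]

lemma wirtingerBar_prod_nwFactor_of_gt {j k : Fin n} (hkj : k < j) :
    wirtingerBar k (fun z : Fin n → ℂ => ∏ i, nwFactor u j i (z i)) z = 0 := by
  rw [wirtingerBar_prod_nwFactor hu hz, nwFactor, if_pos hkj, dbar_eq_zero_of_differentiableAt,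
    zero_mul]
  exact (differentiableOn_circleS (u k).continuous).differentiableAt
    (Metric.isOpen_ball.mem_nhds (mem_ball_zero_iff.2 (hz k)))

lemma nwDbar_prodPair (j k : Fin n) : nwDbar j k z (prodPair u) =
    wirtingerBar k (fun z : Fin n → ℂ => ∏ i, nwFactor u j i (z i)) z := by
  rcases lt_trichotomy j k with hjk | rfl | hkj
  · rw [nwDbar, if_pos hjk, wirtingerBar_prod_nwFactor_of_lt hu hz hjk]
    rfl
  · rw [nwDbar, if_neg (lt_irrefl j), if_pos rfl, wirtingerBar_prod_nwFactor_self hu hz, sub_apply,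
      sum_apply]
    rfl
  · rw [nwDbar, if_neg hkj.not_gt, if_neg hkj.ne', wirtingerBar_prod_nwFactor_of_gt hu hz hkj]
    rfl

end ProdFn

section Pairing

variable {φ : (Fin n → ℂ) → ℂ}

lemma pairing_nwTermExt_prodFn {u : Fin n → C(ℂ, ℂ)} (hu : ∀ i, IsBump (u i)) (hφ : IsTest φ)
    (j k : Fin n) : pairing (nwTermExt j) (wirtingerBar k φ) (prodFn u) =
      -pairing (nwDbar j k) φ (prodPair u) := by
  rw [pairing_apply (isRegularFamily_nwTermExt j) (hφ.isWeight_wirtingerBar k),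
    pairing_apply (isRegularFamily_nwDbar j k) hφ.isWeight]
  calc ∫ z in polydisc n, nwTermExt j z (prodFn u) * wirtingerBar k φ z
      = ∫ z in polydisc n, (∏ i, nwFactor u j i (z i)) * wirtingerBar k φ z :=
        setIntegral_congr_fun (measurableSet_polydisc n) fun z hz => by
          simp only [nwTermExt_prodFn u j hz]
    _ = -∫ z in polydisc n,
          wirtingerBar k (fun z : Fin n → ℂ => ∏ i, nwFactor u j i (z i)) z * φ z :=
        setIntegral_mul_wirtingerBar (contDiffOn_prod_apply (contDiffOn_nwFactor hu j)) hφ k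
    _ = -∫ z in polydisc n, nwDbar j k z (prodPair u) * φ z := by
        congr 1
        exact setIntegral_congr_fun (measurableSet_polydisc n) fun z hz => by
          simp only [nwDbar_prodPair hu hz]

lemma pairing_nwTermExt_mollify (hφ : IsTest φ) (j k : Fin n) (N : ℕ) {v : (Fin n → ℂ) → ℂ}
    (hv : ContinuousOn v (polydisc n)) :
    pairing (nwTermExt j) (wirtingerBar k φ) (mollify N v).1 =
      -pairing (nwDbar j k) φ (mollify N v) :=
  apply_mollify_eq (l₁ := (pairing (nwTermExt j) (wirtingerBar k φ)).comp
    (ContinuousLinearMap.fst ℂ _ (Fin n → C(closedPolydisc n, ℂ))))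
    (l₂ := -pairing (nwDbar j k) φ) (fun _ hu => pairing_nwTermExt_prodFn hu hφ j k) N hv

lemma mollify_snd_comm {g : Fin n → C(closedPolydisc n, ℂ)} (hg : IsDbarClosed g) (N : ℕ)
    (j k : Fin n) : (mollify N (zeroExt (g j))).2 k = (mollify N (zeroExt (g k))).2 j := by
  ext z
  rw [mollify_snd_apply N (continuousOn_zeroExt_polydisc _),
    mollify_snd_apply N (continuousOn_zeroExt_polydisc _), hg _ (isTest_mollKernel N z.2) j k]

-- This is where closedness enters: the symmetry `hP` makes the terms with `j < k` cancel the sum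
-- subtracted in the term with `j = k`.
lemma sum_nwDbar {P : Fin n → FormPair n} (hP : ∀ j k, (P j).2 k = (P k).2 j) (k : Fin n)
    (z : Fin n → ℂ) : ∑ j, nwDbar j k z (P j) = evalExt z (P k).1 := by
  have hterm : ∀ j, nwDbar j k z (P j) = (if j < k then nwTermExt j z ((P k).2 j) else 0) +
      if j = k then evalExt z (P k).1 - ∑ i with i < k, nwTermExt i z ((P k).2 i) else 0 := by
    intro j
    rw [← hP j k, nwDbar]
    rcases lt_trichotomy j k with hjk | rfl | hkj
    · simp only [if_pos hjk, if_neg hjk.ne, add_zero]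
      rfl
    · simp only [lt_irrefl, if_false, if_true, zero_add, sub_apply, sum_apply]
      rfl
    · simp only [if_neg hkj.not_gt, if_neg hkj.ne', add_zero]
      rfl
  simp_rw [hterm]
  rw [Finset.sum_add_distrib, ← Finset.sum_filter, Finset.sum_ite_eq' Finset.univ k,
    if_pos (Finset.mem_univ k), add_sub_cancel]

lemma sum_pairing_nwDbar {P : Fin n → FormPair n} (hP : ∀ j k, (P j).2 k = (P k).2 j)
    (hφ : IsWeight φ) (k : Fin n) :
    ∑ j, pairing (nwDbar j k) φ (P j) = pairing evalExt φ (P k).1 := by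
  simp_rw [fun j => pairing_apply (isRegularFamily_nwDbar j k) hφ,
    pairing_apply isRegularFamily_evalExt hφ, ← sum_nwDbar hP, Finset.sum_mul]
  exact (integral_finsetSum _ fun j _ =>
    (hφ.integrable_mul ((isRegularFamily_nwDbar j k).continuousOn _)).integrableOn).symm

/-- The Nijenhuis–Woolf operator at a point of `ℂⁿ`, zero off the closed polydisc. -/
def nwExt (z : Fin n → ℂ) : (Fin n → C(closedPolydisc n, ℂ)) →L[ℂ] ℂ :=
  ∑ j, (nwTermExt j z).comp (ContinuousLinearMap.proj j)

lemma nwExt_of_mem {z : Fin n → ℂ} (hz : z ∈ polydisc n) :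
    nwExt z = nwFunctional ⟨z, polydisc_subset n hz⟩ := by
  simp only [nwExt, nwTermExt, familyExt_of_mem _ hz, nwFunctional]

lemma isRegularFamily_nwExt : IsRegularFamily (nwExt (n := n)) :=
  IsRegularFamily.sum fun j => (isRegularFamily_nwTermExt j).comp _

lemma pairing_nwExt (hφ : IsWeight φ) (g : Fin n → C(closedPolydisc n, ℂ)) :
    pairing nwExt φ g = ∑ j, pairing (nwTermExt j) φ (g j) := by
  simp_rw [pairing_apply isRegularFamily_nwExt hφ,
    fun j => pairing_apply (isRegularFamily_nwTermExt j) hφ, nwExt, sum_apply, Finset.sum_mul]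
  exact integral_finsetSum _ fun j _ =>
    (hφ.integrable_mul ((isRegularFamily_nwTermExt j).continuousOn _)).integrableOn

end Pairing

lemma isWeakSolution_nwExt {g : Fin n → C(closedPolydisc n, ℂ)} (hg : IsDbarClosed g) :
    IsWeakSolution (fun z => nwExt z g) g := by
  intro φ hφ k
  set gN : ℕ → Fin n → FormPair n := fun N j => mollify N (zeroExt (g j))
  have hmoll : ∀ N, pairing nwExt (wirtingerBar k φ) (fun j => (gN N j).1) =
      -pairing evalExt φ (gN N k).1 := fun N => by
    rw [pairing_nwExt (hφ.isWeight_wirtingerBar k),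
      ← sum_pairing_nwDbar (mollify_snd_comm hg N) hφ.isWeight, ← Finset.sum_neg_distrib]
    exact Finset.sum_congr rfl fun j _ =>
      pairing_nwTermExt_mollify hφ j k N (continuousOn_zeroExt_polydisc (g j))
  simp_rw [← evalExt_apply]
  rw [← pairing_apply isRegularFamily_nwExt (hφ.isWeight_wirtingerBar k),
    ← pairing_apply isRegularFamily_evalExt hφ.isWeight]
  refine tendsto_nhds_unique (((pairing nwExt (wirtingerBar k φ)).continuous.tendsto g).comp
    (tendsto_pi_nhds.2 fun j => tendsto_mollify (g j))) ?_
  exact (((pairing evalExt φ).continuous.tendsto (g k)).comp (tendsto_mollify (g k))).neg.congr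
    fun N => (hmoll N).symm

section Slice

variable (P : Fin n → Prop) [DecidablePred P]

/-- The point of Henkin's cycle with the coordinates `ρ e^{iθ_k}` for the indices `k` with `P k`,
and those of `z` for the other indices. Replacing the tuple `J` of Henkin's formula by the predicate
`P` of not being listed in `J` makes the summands depend on sets of indices only. -/
def slicePoint (z : Fin n → ℂ) (ρ : ℝ) (θ : {k // P k} → ℝ) : Fin n → ℂ :=
  fun i => if h : P i then ρ * exp (θ ⟨i, h⟩ * I) else z i

/-- The parameter domain of Henkin's cycle in the coordinates `(ρ, θ)`. -/
def sliceDomain (z : Fin n → ℂ) : Set (ℝ × ({k // P k} → ℝ)) :=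
  {p | (0 ≤ p.1 ∧ p.1 ≤ 1 ∧ ∀ i, ¬ P i → p.1 ≤ ‖z i‖) ∧ ∀ k, 0 ≤ p.2 k ∧ p.2 k ≤ 2 * π}

/-- The summand of Henkin's operator in which the variables `ζ_k` with `P k` are integrated. -/
def sliceIntegral (g : Fin n → C(closedPolydisc n, ℂ)) (z : Fin n → ℂ) : ℂ :=
  ((2 * π * I) ^ Fintype.card {k // P k})⁻¹ *
    ∫ p in sliceDomain P z,
      ∑ s : {k // P k}, zeroExt (g s) (slicePoint P z p.1 p.2) *
        (2 * I * p.1 * ∏ k ∈ Finset.univ.erase s, (I * p.1 * exp (p.2 k * I))) /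
          ∏ k : {k // P k}, (slicePoint P z p.1 p.2 k - z k)

lemma sliceIntegral_congr {P Q : Fin n → Prop} [hP : DecidablePred P] [hQ : DecidablePred Q]
    (h : P = Q) (g : Fin n → C(closedPolydisc n, ℂ)) (z : Fin n → ℂ) :
    sliceIntegral P g z = sliceIntegral Q g z := by
  subst h
  rw [Subsingleton.elim hP hQ]

lemma card_rest {r : ℕ} (J : Fin r ↪ Fin n) : Fintype.card (Rest J) = n - r := by
  have h : (Finset.univ.filter fun k => ∀ a, J a ≠ k) = (Finset.univ.map J)ᶜ := by
    ext k; simp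
  rw [Fintype.card_subtype, h, Finset.card_compl]
  simp

lemma henkinDomain_eq_sliceDomain {r : ℕ} (J : Fin r ↪ Fin n) (z : Fin n → ℂ) :
    henkinDomain J z = sliceDomain (fun k => ∀ a, J a ≠ k) z := by
  ext p
  simp only [henkinDomain, sliceDomain, mem_ofPred_eq, not_forall, not_not, forall_exists_index,
    forall_apply_eq_imp_iff]

lemma henkinIntegral_eq_sliceIntegral {r : ℕ} (J : Fin r ↪ Fin n)
    (g : Fin n → C(closedPolydisc n, ℂ)) (z : Fin n → ℂ) :
    henkinIntegral J g z = sliceIntegral (fun k => k ∉ Finset.univ.map J) g z := by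
  have hP : (fun k => k ∉ Finset.univ.map J) = fun k => ∀ a, J a ≠ k := by
    ext k; simp
  rw [sliceIntegral_congr hP, henkinIntegral, sliceIntegral, henkinDomain_eq_sliceDomain, card_rest]
  rfl

/-- A factor of the kernel of a summand of Henkin's operator: the pullback of
`(2πi)⁻¹ dζ / (ζ - a)` under `ζ = ρ e^{iθ}`, where `b` says whether the differential `dζ̄` of the
form has the same index, in which case `dζ̄ ∧ dζ = 2iρ dρ ∧ dθ` replaces `iρ e^{iθ} dθ`. -/
def sliceFactor (b : Prop) [Decidable b] (a : ℂ) (ρ θ : ℝ) : ℂ :=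
  (2 * π * I)⁻¹ * (if b then 2 * I * ρ else I * ρ * exp (θ * I)) / (ρ * exp (θ * I) - a)

/-- The characteristic function of `(-∞, t]`, which encodes one of the conditions `ρ ≤ |z_j|`. -/
def radialCut (t ρ : ℝ) : ℂ := if ρ ≤ t then 1 else 0

lemma norm_radialCut_le (t ρ : ℝ) : ‖radialCut t ρ‖ ≤ 1 := by
  unfold radialCut; split_ifs <;> simp

lemma measurable_radialCut (t : ℝ) : Measurable (radialCut t) :=
  Measurable.ite measurableSet_Iic measurable_const measurable_const

lemma measurable_sliceFactor (b : Prop) [Decidable b] (a : ℂ) :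
    Measurable fun p : ℝ × ℝ => sliceFactor b a p.1 p.2 := by
  unfold sliceFactor
  split_ifs <;> fun_prop

lemma norm_sliceFactor_le (b : Prop) [Decidable b] (a : ℂ) {ρ : ℝ} (hρ : 0 ≤ ρ) (θ : ℝ) :
    ‖sliceFactor b a ρ θ‖ ≤ ρ / ‖ρ * exp (θ * I) - a‖ := by
  have hpi := Real.pi_gt_three
  have hnum : ‖(if b then 2 * I * ρ else I * ρ * exp (θ * I) : ℂ)‖ ≤ 2 * ρ := by
    split_ifs
    · simp [abs_of_nonneg hρ]
    · simp only [norm_mul, norm_I, norm_exp_ofReal_mul_I, norm_real, Real.norm_of_nonneg hρ]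
      linarith
  have hconst : ‖(2 * π * I : ℂ)⁻¹‖ ≤ 2⁻¹ := by
    simp only [norm_inv, norm_mul, norm_I, norm_real, Real.norm_of_nonneg Real.pi_pos.le,
      Complex.norm_ofNat]
    gcongr
    linarith
  rw [sliceFactor, norm_div, norm_mul]
  gcongr
  linarith [mul_le_mul hconst hnum (norm_nonneg _) (by norm_num)]

/-- The kernel that the coefficient of `dζ̄_s` is integrated against in the summand of Henkin's
operator given by `P`; the conditions `ρ ≤ |z_j|` are part of the kernel, so that the domain of
integration does not depend on `z`. -/
def sliceKernel (z : Fin n → ℂ) (s : {k // P k}) (p : ℝ × ({k // P k} → ℝ)) : ℂ :=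
  (∏ i with ¬ P i, radialCut ‖z i‖ p.1) * ∏ k, sliceFactor (k = s) (z k) p.1 (p.2 k)

lemma measurable_sliceKernel (z : Fin n → ℂ) (s : {k // P k}) :
    Measurable (sliceKernel P z s) := by
  refine (Finset.measurable_fun_prod _ fun i _ => ?_).mul
    (Finset.measurable_fun_prod _ fun k _ => ?_)
  · exact (measurable_radialCut _).comp measurable_fst
  · exact (measurable_sliceFactor (k = s) (z k)).comp (f := fun p : ℝ × ({k // P k} → ℝ) =>
      (p.1, p.2 k)) (by fun_prop)

lemma polarMeasure_eq (ι : Type*) [Fintype ι] : polarMeasure ι = volume.restrict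
    (Icc 0 1 ×ˢ univ.pi fun _ : ι => Icc 0 (2 * π)) := by
  rw [polarMeasure, angleMeasure, Measure.volume_eq_prod, ← Measure.prod_restrict, volume_pi,
    Measure.restrict_pi_pi]

lemma ae_mem_polarMeasure (ι : Type*) [Fintype ι] :
    ∀ᵐ p ∂polarMeasure ι, p.1 ∈ Icc (0 : ℝ) 1 := by
  rw [polarMeasure_eq]
  filter_upwards [ae_restrict_mem (measurableSet_Icc.prod
    (MeasurableSet.univ_pi fun _ => measurableSet_Icc))] with p hp using hp.1

lemma norm_sliceKernel_le (z : Fin n → ℂ) (s : {k // P k}) {p : ℝ × ({k // P k} → ℝ)}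
    (hp : 0 ≤ p.1) : ‖sliceKernel P z s p‖ ≤ polarKernel (fun k : {k // P k} => z k) p := by
  rw [sliceKernel, norm_mul, norm_prod, norm_prod, polarKernel]
  refine (mul_le_of_le_one_left (Finset.prod_nonneg fun _ _ => norm_nonneg _)
    (Finset.prod_le_one (fun _ _ => norm_nonneg _) fun i _ => norm_radialCut_le _ _)).trans ?_
  exact Finset.prod_le_prod (fun _ _ => norm_nonneg _) fun k _ => norm_sliceFactor_le _ _ hp _

lemma ae_norm_sliceKernel_le (z : Fin n → ℂ) (s : {k // P k}) :
    ∀ᵐ p ∂polarMeasure {k // P k},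
      ‖sliceKernel P z s p‖ ≤ polarKernel (fun k : {k // P k} => z k) p := by
  filter_upwards [ae_mem_polarMeasure {k // P k}] with p hp using norm_sliceKernel_le P z s hp.1

lemma integrable_sliceKernel (z : closedPolydisc n) (s : {k // P k}) :
    Integrable (sliceKernel P z.1 s) (polarMeasure {k // P k}) :=
  (integrable_polarKernel fun k : {k // P k} => z.2 k).mono'
    (measurable_sliceKernel P z.1 s).aestronglyMeasurable (ae_norm_sliceKernel_le P z.1 s)

lemma exists_integral_norm_sliceKernel_le : ∃ C, ∀ (z : closedPolydisc n) (s : {k // P k}),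
    ∫ p, ‖sliceKernel P z.1 s p‖ ∂polarMeasure {k // P k} ≤ C := by
  obtain ⟨C, hC⟩ := exists_integral_polarKernel_le {k // P k}
  exact ⟨C, fun z s => (integral_mono_ae (integrable_sliceKernel P z s).norm
    (integrable_polarKernel fun k => z.2 k) (ae_norm_sliceKernel_le P z.1 s)).trans
      (hC _ fun k => z.2 k)⟩

/-- The parametrization `slicePoint` of Henkin's cycle, extended to a continuous map by clamping
the radius to `[0, 1]`. -/
def sliceMap (z : closedPolydisc n) : C(ℝ × ({k // P k} → ℝ), closedPolydisc n) where
  toFun p := ⟨slicePoint P z.1 (max 0 (min p.1 1)) p.2, fun i => by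
    unfold slicePoint
    split_ifs
    · rw [norm_mul, norm_exp_ofReal_mul_I, mul_one, norm_real,
        Real.norm_of_nonneg (le_max_left _ _)]
      exact max_le zero_le_one (min_le_right _ _)
    · exact z.2 i⟩
  continuous_toFun := by
    refine Continuous.subtype_mk (continuous_pi fun i => ?_) _
    unfold slicePoint
    split_ifs <;> fun_prop

lemma coe_sliceMap (z : closedPolydisc n) {p : ℝ × ({k // P k} → ℝ)} (hp : p.1 ∈ Icc (0 : ℝ) 1) :
    (sliceMap P z p).1 = slicePoint P z.1 p.1 p.2 := by
  change slicePoint P z.1 (max 0 (min p.1 1)) p.2 = _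
  rw [min_eq_left hp.2, max_eq_right hp.1]

lemma integrable_sliceKernel_mul (z : closedPolydisc n) (s : {k // P k})
    (f : C(closedPolydisc n, ℂ)) :
    Integrable (fun p => sliceKernel P z.1 s p * f (sliceMap P z p)) (polarMeasure {k // P k}) :=
  (integrable_sliceKernel P z s).mul_bdd (c := ‖f‖)
    (f.continuous.comp (sliceMap P z).continuous).aestronglyMeasurable
    (.of_forall fun _ => f.norm_coe_le_norm _)

/-- A summand of Henkin's operator at `z`, as a bounded functional of the coefficients of the
form. -/
def sliceFunctional (z : closedPolydisc n) : (Fin n → C(closedPolydisc n, ℂ)) →L[ℂ] ℂ :=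
  ∑ s : {k // P k}, (kernelFunctional (polarMeasure {k // P k}) (sliceKernel P z.1 s)
    (sliceMap P z)).comp (ContinuousLinearMap.proj s.1)

lemma sliceFunctional_apply (z : closedPolydisc n) (g : Fin n → C(closedPolydisc n, ℂ)) :
    sliceFunctional P z g = ∑ s : {k // P k}, ∫ p, sliceKernel P z.1 s p * g s (sliceMap P z p)
      ∂polarMeasure {k // P k} := by
  simp [sliceFunctional, kernelFunctional_apply (integrable_sliceKernel P z _)]

lemma exists_norm_sliceFunctional_le :
    ∃ C, ∀ z : closedPolydisc n, ‖sliceFunctional P z‖ ≤ C := by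
  obtain ⟨C, hC⟩ := exists_integral_norm_sliceKernel_le P
  refine ⟨∑ _s : {k // P k}, C, fun z => (norm_sum_le _ _).trans (Finset.sum_le_sum fun s _ => ?_)⟩
  refine (ContinuousLinearMap.opNorm_comp_le _ _).trans ?_
  refine (mul_le_of_le_one_right (norm_nonneg _) ?_).trans
    ((norm_kernelFunctional_le _ _ _).trans (hC z s))
  exact ContinuousLinearMap.opNorm_le_bound _ zero_le_one fun g => by
    rw [one_mul]; exact norm_le_pi_norm g s.1

/-- The condition `ρ ≤ |z_i|` for all `i` without `P i`, on the parameters `(ρ, θ)`. -/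
def cutDomain (z : Fin n → ℂ) : Set (ℝ × ({k // P k} → ℝ)) :=
  {p | ∀ i, ¬ P i → p.1 ≤ ‖z i‖}

omit [DecidablePred P] in
lemma measurableSet_cutDomain (z : Fin n → ℂ) : MeasurableSet (cutDomain P z) := by
  simp only [cutDomain, ofPred_forall]
  exact MeasurableSet.iInter fun i => MeasurableSet.iInter fun _ =>
    measurableSet_le measurable_fst measurable_const

lemma restrict_sliceDomain (z : Fin n → ℂ) :
    volume.restrict (sliceDomain P z) = (polarMeasure {k // P k}).restrict (cutDomain P z) := by
  have h : sliceDomain P z =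
      cutDomain P z ∩ Icc 0 1 ×ˢ univ.pi fun _ : {k // P k} => Icc 0 (2 * π) := by
    ext p
    simp only [sliceDomain, cutDomain, mem_ofPred_eq, mem_inter_iff, mem_prod, mem_Icc,
      mem_univ_pi]
    tauto
  rw [polarMeasure_eq, Measure.restrict_restrict (measurableSet_cutDomain P z), h]

lemma prod_radialCut (z : Fin n → ℂ) (p : ℝ × ({k // P k} → ℝ)) :
    ∏ i with ¬ P i, radialCut ‖z i‖ p.1 = (cutDomain P z).indicator 1 p := by
  classical
  simp only [radialCut, Finset.prod_ite_zero, Finset.prod_const_one, Finset.mem_filter,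
    Finset.mem_univ, true_and, indicator_apply, cutDomain, mem_ofPred_eq, Pi.one_apply]

lemma prod_sliceFactor (z : Fin n → ℂ) (s : {k // P k}) (ρ : ℝ) (θ : {k // P k} → ℝ) :
    ∏ k : {k // P k}, sliceFactor (k = s) (z k) ρ (θ k) =
      ((2 * π * I) ^ Fintype.card {k // P k})⁻¹ *
        ((2 * I * ρ * ∏ k ∈ Finset.univ.erase s, (I * ρ * exp (θ k * I))) /
          ∏ k : {k // P k}, (slicePoint P z ρ θ k - z k)) := by
  have hpt : ∀ k : {k // P k}, slicePoint P z ρ θ k = ρ * exp (θ k * I) := fun k => dif_pos k.2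
  have hnum : ∏ k : {k // P k}, (if k = s then 2 * I * (ρ : ℂ) else I * ρ * exp (θ k * I)) =
      2 * I * ρ * ∏ k ∈ Finset.univ.erase s, (I * ρ * exp (θ k * I)) := by
    rw [← Finset.mul_prod_erase _ _ (Finset.mem_univ s), if_pos rfl,
      Finset.prod_congr rfl fun k hk => if_neg (Finset.ne_of_mem_erase hk)]
  simp only [sliceFactor, Finset.prod_div_distrib, Finset.prod_mul_distrib, Finset.prod_const,
    Finset.card_univ, inv_pow, hpt] at hnum ⊢
  rw [hnum, mul_div_assoc]

lemma sliceIntegral_eq (z : closedPolydisc n) (g : Fin n → C(closedPolydisc n, ℂ)) :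
    sliceIntegral P g z.1 = sliceFunctional P z g := by
  rw [sliceFunctional_apply,
    ← integral_finsetSum _ fun s _ => integrable_sliceKernel_mul P z s (g s),
    sliceIntegral, restrict_sliceDomain, ← integral_indicator (measurableSet_cutDomain P z.1),
    ← integral_const_mul]
  refine integral_congr_ae ?_
  filter_upwards [ae_mem_polarMeasure {k // P k}] with p hp
  simp only [sliceKernel, prod_radialCut, prod_sliceFactor]
  by_cases hmem : p ∈ cutDomain P z.1
  · simp only [indicator_of_mem hmem, Pi.one_apply, one_mul, Finset.mul_sum]
    refine Finset.sum_congr rfl fun s _ => ?_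
    rw [← zeroExt_coe, coe_sliceMap P z hp]
    ring
  · simp only [indicator_of_notMem hmem, mul_zero, zero_mul, Finset.sum_const_zero]

end Slice

/-! ### Henkin's operator as a bounded functional -/

lemma integral_sliceFactor_mul (b : Prop) [Decidable b] (h f : ℂ → ℂ) (a : ℂ) (ρ : ℝ) :
    ∫ θ in Icc 0 (2 * π), sliceFactor b a ρ θ * (if b then h else f) (ρ * exp (θ * I)) =
      if b then radialDensity h a ρ else circleMean f a ρ := by
  unfold sliceFactor
  split_ifs
  · rw [radialDensity, ← integral_const_mul]
    exact integral_congr_ae (.of_forall fun θ => by ring)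
  · rw [circleMean, ← integral_const_mul]
    exact integral_congr_ae (.of_forall fun θ => by ring)

section Product

variable (P : Fin n → Prop) [DecidablePred P]

lemma dbarProd_sliceMap {u : Fin n → C(ℂ, ℂ)} (hu : ∀ i, IsBump (u i)) (z : closedPolydisc n)
    (s : {k // P k}) {p : ℝ × ({k // P k} → ℝ)} (hp : p.1 ∈ Icc (0 : ℝ) 1) :
    dbarProd u s (sliceMap P z p) = (∏ i with ¬ P i, u i (z.1 i)) *
      ∏ k : {k // P k}, (if k = s then dbar (u k) else u k) (p.1 * exp (p.2 k * I)) := by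
  rw [dbarProd, prodFn_apply, coe_sliceMap P z hp, ← Finset.prod_filter_mul_prod_filter_not _ P,
    mul_comm]
  congr 1
  · refine Finset.prod_congr rfl fun i hi => ?_
    have h := (Finset.mem_filter.1 hi).2
    rw [slicePoint, dif_neg h, Function.update_of_ne]
    rintro rfl
    exact h s.2
  · rw [Finset.prod_subtype (p := P) _ (by simp)]
    refine Finset.prod_congr rfl fun k _ => ?_
    rw [slicePoint, dif_pos k.2]
    split_ifs with h
    · subst h
      rw [Function.update_self, (hu k).coe_dbarC]
    · rw [Function.update_of_ne fun hks => h (Subtype.ext hks)]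

/-- The integrand, in polar coordinates, of a summand of Henkin's operator for the form
`∂̄(∏ u_i(z_i))`: a product of functions of one angle each. -/
def sliceIntegrand (u : Fin n → C(ℂ, ℂ)) (z : Fin n → ℂ) (s : {k // P k})
    (p : ℝ × ({k // P k} → ℝ)) : ℂ :=
  (∏ i with ¬ P i, radialCut ‖z i‖ p.1 * u i (z i)) * ∏ k : {k // P k},
    (sliceFactor (k = s) (z k) p.1 (p.2 k) *
      (if k = s then dbar (u k) else u k) (p.1 * exp (p.2 k * I)))

/-- The density in `ρ` that remains of `sliceIntegrand` after integration over the angles. -/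
def sliceDensity (u : Fin n → C(ℂ, ℂ)) (z : Fin n → ℂ) (s : {k // P k}) (ρ : ℝ) : ℂ :=
  (∏ i with ¬ P i, radialCut ‖z i‖ ρ * u i (z i)) * ∏ k : {k // P k},
    if k = s then radialDensity (dbar (u k)) (z k) ρ else circleMean (u k) (z k) ρ

lemma integral_sliceIntegrand_angle (u : Fin n → C(ℂ, ℂ)) (z : Fin n → ℂ) (s : {k // P k})
    (ρ : ℝ) :
    ∫ θ, sliceIntegrand P u z s (ρ, θ) ∂angleMeasure {k // P k} = sliceDensity P u z s ρ := by
  simp only [sliceIntegrand, sliceDensity, angleMeasure]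
  rw [integral_const_mul, integral_fintype_prod_eq_prod (fun (k : {k // P k}) (θ : ℝ) =>
    sliceFactor (k = s) (z k) ρ θ * (if k = s then dbar (u k) else u k) (ρ * exp (θ * I)))]
  simp_rw [fun k : {k // P k} => integral_sliceFactor_mul (k = s) (dbar (u k)) (u k) (z k) ρ]

variable {u : Fin n → C(ℂ, ℂ)} (hu : ∀ i, IsBump (u i)) (z : closedPolydisc n) (s : {k // P k})

include hu

lemma sliceKernel_mul_dbarProd_ae_eq :
    (fun p => sliceKernel P z.1 s p * dbarProd u s (sliceMap P z p))
      =ᵐ[polarMeasure {k // P k}] sliceIntegrand P u z.1 s := by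
  filter_upwards [ae_mem_polarMeasure {k // P k}] with p hp
  rw [dbarProd_sliceMap P hu z s hp]
  simp only [sliceKernel, sliceIntegrand, Finset.prod_mul_distrib]
  ring

lemma integrable_sliceIntegrand :
    Integrable (sliceIntegrand P u z.1 s) (polarMeasure {k // P k}) :=
  (integrable_sliceKernel_mul P z s (dbarProd u s)).congr
    (sliceKernel_mul_dbarProd_ae_eq P hu z s)

lemma integrableOn_sliceDensity : IntegrableOn (sliceDensity P u z.1 s) (Icc 0 1) := by
  have h := integrable_sliceIntegrand P hu z s
  rw [polarMeasure] at h
  simpa only [integral_sliceIntegrand_angle, IntegrableOn] using h.integral_prod_left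

lemma integral_sliceKernel_mul_dbarProd :
    ∫ p, sliceKernel P z.1 s p * dbarProd u s (sliceMap P z p) ∂polarMeasure {k // P k} =
      ∫ ρ in Icc 0 1, sliceDensity P u z.1 s ρ := by
  have h := integrable_sliceIntegrand P hu z s
  rw [integral_congr_ae (sliceKernel_mul_dbarProd_ae_eq P hu z s)]
  rw [polarMeasure] at h ⊢
  simp only [integral_prod _ h, integral_sliceIntegrand_angle]

lemma sliceFunctional_dbarProd :
    sliceFunctional P z (dbarProd u) = ∫ ρ in Icc 0 1, ∑ s, sliceDensity P u z.1 s ρ := by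
  rw [integral_finsetSum _ fun s _ => integrableOn_sliceDensity P hu z s, sliceFunctional_apply]
  exact Finset.sum_congr rfl fun s _ => integral_sliceKernel_mul_dbarProd P hu z s

end Product

section SumOverFinsets

variable {ι R : Type*} [Fintype ι] [DecidableEq ι] [CommSemiring R]

lemma prod_subtype_ite_eq (m r : ι → R) (M : Finset ι) (s : {k // k ∉ M}) :
    ∏ k : {k // k ∉ M}, (if k = s then r k else m k) =
      (∏ k ∈ Finset.univ.erase s.1 \ M, m k) * r s := by
  have h : Finset.univ.erase s.1 \ M = Mᶜ.erase s.1 := by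
    ext i
    simp [and_comm]
  simp only [Subtype.ext_iff]
  rw [← Finset.prod_subtype Mᶜ (by simp) fun k => if k = s.1 then r k else m k,
    ← Finset.prod_erase_mul _ _ (Finset.mem_compl.2 s.2), if_pos rfl,
    Finset.prod_congr rfl fun k hk => if_neg (Finset.ne_of_mem_erase hk), h]

lemma sum_finset_sum_prod (y m r : ι → R) :
    ∑ M : Finset ι, ∑ s : {k // k ∉ M}, (∏ i with ¬ i ∉ M, y i) *
      ∏ k : {k // k ∉ M}, (if k = s then r k else m k) =
    ∑ s, (∏ k ∈ Finset.univ.erase s, (y k + m k)) * r s := by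
  have hinner : ∀ M : Finset ι, ∑ s : {k // k ∉ M}, (∏ i with ¬ i ∉ M, y i) *
      ∏ k : {k // k ∉ M}, (if k = s then r k else m k) =
      ∑ s ∈ Mᶜ, (∏ i ∈ M, y i) * ((∏ k ∈ Finset.univ.erase s \ M, m k) * r s) := fun M => by
    rw [Finset.sum_subtype (p := fun k => k ∉ M) (F := inferInstance) Mᶜ (by simp)]
    simp only [prod_subtype_ite_eq, not_not, Finset.filter_univ_mem]
  simp_rw [hinner]
  rw [Finset.sum_comm' (t' := Finset.univ) (s' := fun s => (Finset.univ.erase s).powerset)]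
  · refine Finset.sum_congr rfl fun s _ => ?_
    rw [Finset.prod_add, Finset.sum_mul]
    exact Finset.sum_congr rfl fun M _ => by ring
  · intro M s
    simp [Finset.subset_erase]

end SumOverFinsets

section Radial

variable {ι : Type*} [Fintype ι] [DecidableEq ι]

lemma radialCut_mul_add_circleMean {f : ℂ → ℂ} (hf : Continuous f) {a : ℂ} {ρ : ℝ} (hρ : 0 ≤ ρ)
    (hne : ρ ≠ ‖a‖) :
    radialCut ‖a‖ ρ * f a + circleMean f a ρ = circleRemainder f a ρ + f a := by
  rw [circleMean_eq hf hρ hne, radialCut]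
  rcases lt_or_gt_of_ne hne with h | h
  · rw [if_pos h.le, if_neg h.not_gt]; ring
  · rw [if_neg h.not_ge, if_pos h]; ring

lemma integral_sum_prod_circleRemainder {f : ι → ℂ → ℂ} (hf : ∀ i, ContDiff ℝ 1 (f i))
    (z : ι → ℂ) :
    ∫ ρ in Icc (0 : ℝ) 1, ∑ s, (∏ k ∈ Finset.univ.erase s,
        (circleRemainder (f k) (z k) ρ + f k (z k))) * radialDensity (dbar (f s)) (z s) ρ =
      (∏ k, (f k (z k) - discT (dbar (f k)) (z k))) - ∏ k, f k (z k) := by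
  have hcont : ∀ s : Finset ι, ContinuousOn (fun ρ : ℝ => ∏ k ∈ s,
      (circleRemainder (f k) (z k) ρ + f k (z k))) (Icc 0 1) := fun s =>
    continuousOn_finsetProd _ fun k _ =>
      (continuousOn_circleRemainder_Icc (hf k) (z k)).add continuousOn_const
  have hinteg : IntegrableOn (fun ρ : ℝ => ∑ s, (∏ k ∈ Finset.univ.erase s,
        (circleRemainder (f k) (z k) ρ + f k (z k))) * radialDensity (dbar (f s)) (z s) ρ)
      (Icc 0 1) := integrable_finsetSum _ fun s _ =>
    (integrableOn_radialDensity (continuous_dbar (hf s)) (z s)).continuousOn_mul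
      (hcont _) isCompact_Icc
  have hderiv : ∀ ρ ∈ Ioo (0 : ℝ) 1 \ range fun k => ‖z k‖,
      HasDerivAt (fun ρ => ∏ k, (circleRemainder (f k) (z k) ρ + f k (z k)))
        (∑ s, (∏ k ∈ Finset.univ.erase s, (circleRemainder (f k) (z k) ρ + f k (z k))) *
          radialDensity (dbar (f s)) (z s) ρ) ρ := fun ρ hρ => by
    simpa only [smul_eq_mul] using HasDerivAt.fun_finsetProd (u := Finset.univ)
      (f := fun k ρ => circleRemainder (f k) (z k) ρ + f k (z k)) fun k _ =>
        (hasDerivAt_circleRemainder (hf k) hρ.1.1.le fun h => hρ.2 ⟨k, h.symm⟩).add_const _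
  rw [integral_Icc_eq_integral_Ioc, ← intervalIntegral.integral_of_le zero_le_one,
    integral_eq_of_hasDerivAt_off_countable_of_le _ _ zero_le_one
      (countable_range fun k => ‖z k‖) (hcont Finset.univ) hderiv
      ((intervalIntegrable_iff_integrableOn_Icc_of_le zero_le_one).2 hinteg)]
  simp only [circleRemainder_zero, zero_add,
    fun k => circleRemainder_one_eq_neg_discT (hf k) (z k), neg_add_eq_sub]

lemma integral_sum_prod_circleMean {f : ι → ℂ → ℂ} (hf : ∀ i, ContDiff ℝ 1 (f i)) (z : ι → ℂ) :
    ∫ ρ in Icc (0 : ℝ) 1, ∑ s, (∏ k ∈ Finset.univ.erase s,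
        (radialCut ‖z k‖ ρ * f k (z k) + circleMean (f k) (z k) ρ)) *
          radialDensity (dbar (f s)) (z s) ρ =
      (∏ k, (f k (z k) - discT (dbar (f k)) (z k))) - ∏ k, f k (z k) := by
  rw [← integral_sum_prod_circleRemainder hf z]
  have hne : ∀ᵐ ρ : ℝ, ∀ k, ρ ≠ ‖z k‖ := ae_all_iff.2 fun k => Measure.ae_ne _ _
  refine integral_congr_ae ?_
  filter_upwards [ae_restrict_mem measurableSet_Icc, ae_restrict_of_ae hne] with ρ hρ hk
  simp only [fun k => radialCut_mul_add_circleMean (hf k).continuous hρ.1 (hk k)]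

end Radial

/-- Henkin's operator at a point of the closed polydisc, as a bounded functional. The sum runs over
the sets `M` of indices that are kept fixed; for the full set the summand is an empty sum. -/
def henkinFunctional (z : closedPolydisc n) : (Fin n → C(closedPolydisc n, ℂ)) →L[ℂ] ℂ :=
  -∑ M : Finset (Fin n), sliceFunctional (fun k => k ∉ M) z

lemma henkinFunctional_apply (z : closedPolydisc n) (g : Fin n → C(closedPolydisc n, ℂ)) :
    henkinFunctional z g = -∑ M : Finset (Fin n), sliceFunctional (fun k => k ∉ M) z g := by
  simp [henkinFunctional, sum_apply]

lemma exists_norm_henkinFunctional_le (n : ℕ) :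
    ∃ C, ∀ z : closedPolydisc n, ‖henkinFunctional z‖ ≤ C := by
  choose C hC using fun M : Finset (Fin n) => exists_norm_sliceFunctional_le fun k => k ∉ M
  refine ⟨∑ M, C M, fun z => ?_⟩
  rw [henkinFunctional, norm_neg]
  exact (norm_sum_le _ _).trans (Finset.sum_le_sum fun M _ => hC M z)

lemma henkinFunctional_dbarProd {u : Fin n → C(ℂ, ℂ)} (hu : ∀ i, IsBump (u i))
    (z : closedPolydisc n) :
    henkinFunctional z (dbarProd u) =
      prodFn u z - ∏ k, (u k (z.1 k) - discT (dbar (u k)) (z.1 k)) := by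
  have hsum : ∑ M : Finset (Fin n), sliceFunctional (fun k => k ∉ M) z (dbarProd u) =
      (∏ k, (u k (z.1 k) - discT (dbar (u k)) (z.1 k))) - ∏ k, u k (z.1 k) := by
    simp_rw [sliceFunctional_dbarProd _ hu]
    rw [← integral_finsetSum _ fun M _ => integrable_finsetSum _ fun s _ =>
        integrableOn_sliceDensity (fun k => k ∉ M) hu z s,
      ← integral_sum_prod_circleMean fun k => (hu k).contDiff_one]
    simp only [sliceDensity, ← sum_finset_sum_prod]
  rw [henkinFunctional_apply, hsum, prodFn_apply, neg_sub]

/-- The key by which the tuples of Henkin's formula are sorted: decreasing modulus, then increasing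
index. -/
def sortKey (z : Fin n → ℂ) (i : Fin n) : ℝ ×ₗ Fin n := toLex (-‖z i‖, i)

lemma sortKey_injective (z : Fin n → ℂ) : Function.Injective (sortKey z) := fun _ _ h =>
  congrArg (fun x => (ofLex x).2) h

lemma isDecreasing_iff_strictMono {r : ℕ} (z : Fin n → ℂ) (J : Fin r ↪ Fin n) :
    IsDecreasing z J ↔ StrictMono (sortKey z ∘ J) := by
  refine forall_congr' fun a => forall_congr' fun b => imp_congr_right fun _ => ?_
  simp only [Function.comp_apply, sortKey, Prod.Lex.toLex_lt_toLex, neg_lt_neg_iff, neg_inj]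
  rw [eq_comm (a := ‖z (J b)‖)]

lemma eq_of_isDecreasing {r : ℕ} {z : Fin n → ℂ} {J J' : Fin r ↪ Fin n} (hJ : IsDecreasing z J)
    (hJ' : IsDecreasing z J') (h : Finset.univ.map J = Finset.univ.map J') : J = J' := by
  rw [isDecreasing_iff_strictMono] at hJ hJ'
  have hrange : range J = range J' := by
    simpa using congrArg (fun s : Finset (Fin n) => (s : Set (Fin n))) h
  have hcomp := (hJ.range_inj hJ').1 (by rw [range_comp, range_comp, hrange])
  exact DFunLike.ext _ _ fun a => sortKey_injective z (congrFun hcomp a)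

lemma exists_isDecreasing (z : Fin n → ℂ) (M : Finset (Fin n)) :
    ∃ J : Fin M.card ↪ Fin n, IsDecreasing z J ∧ Finset.univ.map J = M := by
  set e := (M.map ⟨sortKey z, sortKey_injective z⟩).orderEmbOfFin (Finset.card_map _)
  have hmem : ∀ a, ∃ i ∈ M, sortKey z i = e a := fun a => by
    simpa only [Finset.mem_map, Function.Embedding.coeFn_mk] using
      Finset.orderEmbOfFin_mem (M.map ⟨sortKey z, sortKey_injective z⟩) (Finset.card_map _) a
  choose f hfM hf using hmem
  have hinj : Function.Injective f := fun a b h => e.injective (by rw [← hf, ← hf, h])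
  refine ⟨⟨f, hinj⟩, ?_, ?_⟩
  · rw [isDecreasing_iff_strictMono]
    exact (funext hf : sortKey z ∘ f = e) ▸ e.strictMono
  · refine Finset.eq_of_subset_of_card_le (fun i hi => ?_) (by simp)
    obtain ⟨a, _, rfl⟩ := Finset.mem_map.1 hi
    exact hfM a

open Classical in
lemma sum_henkinIntegral_eq (z : closedPolydisc n) (g : Fin n → C(closedPolydisc n, ℂ)) (r : ℕ) :
    (∑ J : Fin r ↪ Fin n, if IsDecreasing z.1 J then henkinIntegral J g z.1 else 0) =
      ∑ M ∈ Finset.powersetCard r Finset.univ, sliceFunctional (fun k => k ∉ M) z g := by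
  rw [← Finset.sum_filter]
  refine Finset.sum_bij (fun J _ => Finset.univ.map J) (fun J _ => ?_) (fun J hJ J' hJ' h => ?_)
    (fun M hM => ?_) fun J _ => ?_
  · simp [Finset.mem_powersetCard]
  · exact eq_of_isDecreasing (Finset.mem_filter.1 hJ).2 (Finset.mem_filter.1 hJ').2 h
  · obtain rfl := (Finset.mem_powersetCard.1 hM).2
    obtain ⟨J, hJ, hJM⟩ := exists_isDecreasing z.1 M
    exact ⟨J, by simpa using hJ, hJM⟩
  · rw [henkinIntegral_eq_sliceIntegral, sliceIntegral_eq]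

lemma sliceFunctional_univ (z : closedPolydisc n) :
    sliceFunctional (fun k => k ∉ (Finset.univ : Finset (Fin n))) z = 0 := by
  have : IsEmpty {k : Fin n // k ∉ (Finset.univ : Finset (Fin n))} :=
    ⟨fun k => k.2 (Finset.mem_univ _)⟩
  exact Fintype.sum_empty _

lemma henkin_eq (z : closedPolydisc n) (g : Fin n → C(closedPolydisc n, ℂ)) :
    henkin g z.1 = henkinFunctional z g := by
  rw [henkinFunctional_apply, ← Finset.powerset_univ, Finset.sum_powerset, Finset.sum_range_succ,
    Finset.powersetCard_self, Finset.sum_singleton, sliceFunctional_univ, Finset.card_univ,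
    Fintype.card_fin, henkin]
  simp only [sum_henkinIntegral_eq, zero_apply, add_zero]

/-! ### The canonical solution -/

lemma tendsto_shrink : Tendsto shrink atTop (𝓝 1) := by
  have h := (tendsto_const_nhds (x := (1 : ℝ))).sub (tendsto_mollRadius.const_mul 2)
  rwa [mul_zero, sub_zero] at h

lemma mollify_snd_eq {v : (Fin n → ℂ) → ℂ} (hv : ContinuousOn v (polydisc n))
    {g : Fin n → C(closedPolydisc n, ℂ)} (hvg : IsWeakSolution v g) (N : ℕ) (j : Fin n) :
    (mollify N v).2 j = (shrink N : ℂ) • (mollify N (zeroExt (g j))).1 := by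
  ext z
  rw [mollify_snd_apply N hv, hvg _ (isTest_mollKernel N z.2), ContinuousMap.smul_apply,
    mollify_fst_apply N (continuousOn_zeroExt_polydisc _), smul_eq_mul, mul_neg, neg_neg]

lemma tendsto_mollify_snd {v : (Fin n → ℂ) → ℂ} (hv : ContinuousOn v (polydisc n))
    {g : Fin n → C(closedPolydisc n, ℂ)} (hvg : IsWeakSolution v g) :
    Tendsto (fun N => (mollify N v).2) atTop (𝓝 g) := by
  refine tendsto_pi_nhds.2 fun j => ?_
  simp_rw [mollify_snd_eq hv hvg]
  simpa using ((continuous_ofReal.tendsto 1).comp tendsto_shrink).smul (tendsto_mollify (g j))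

lemma mem_of_isDbarSolution {S : Submodule ℂ (FormPair n)} (hS : IsClosed (S : Set (FormPair n)))
    (h : ∀ u : Fin n → C(ℂ, ℂ), (∀ i, IsBump (u i)) → prodPair u ∈ S)
    {u : C(closedPolydisc n, ℂ)} {g : Fin n → C(closedPolydisc n, ℂ)} (hu : IsDbarSolution u g) :
    (u, g) ∈ S :=
  hS.mem_of_tendsto ((tendsto_mollify u).prodMk_nhds
    (tendsto_mollify_snd (continuousOn_zeroExt_polydisc u) hu))
    (.of_forall fun N => mollify_mem hS h N (continuousOn_zeroExt_polydisc u))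

-- The weak solution `nwExt` is only known to be continuous in the open polydisc, so that the first
-- components of its mollifications need not converge uniformly; the second components do.
lemma mem_of_isDbarClosed {S : Submodule ℂ (Fin n → C(closedPolydisc n, ℂ))}
    (hS : IsClosed (S : Set (Fin n → C(closedPolydisc n, ℂ))))
    (h : ∀ u : Fin n → C(ℂ, ℂ), (∀ i, IsBump (u i)) → dbarProd u ∈ S)
    {g : Fin n → C(closedPolydisc n, ℂ)} (hg : IsDbarClosed g) : g ∈ S :=
  hS.mem_of_tendsto (tendsto_mollify_snd (isRegularFamily_nwExt.continuousOn g)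
    (isWeakSolution_nwExt hg)) (.of_forall fun N => mollify_mem
      (S := S.comap (LinearMap.snd ℂ (C(closedPolydisc n, ℂ)) _)) (hS.preimage continuous_snd) h N
      (isRegularFamily_nwExt.continuousOn g))

lemma eq_torusFunctional_add_nwFunctional {u : C(closedPolydisc n, ℂ)}
    {g : Fin n → C(closedPolydisc n, ℂ)} (hu : IsDbarSolution u g) (z : closedPolydisc n)
    (hz : z.1 ∈ polydisc n) : u z = torusFunctional z.1 u + nwFunctional z g := by
  let Λ : FormPair n →L[ℂ] ℂ := (ContinuousMap.evalCLM ℂ z - torusFunctional z.1).comp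
    (ContinuousLinearMap.fst ℂ _ _) - (nwFunctional z).comp (ContinuousLinearMap.snd ℂ _ _)
  have hΛ : u z - torusFunctional z.1 u - nwFunctional z g = 0 :=
    mem_of_isDbarSolution (S := Λ.ker) Λ.isClosed_ker (fun w hw => by
      change prodFn w z - torusFunctional z.1 (prodFn w) - nwFunctional z (dbarProd w) = 0
      rw [torusFunctional_prodFn hz, nwFunctional_dbarProd hw z hz, sub_self]) hu
  linear_combination hΛ

lemma henkinFunctional_eq_nwFunctional {g : Fin n → C(closedPolydisc n, ℂ)} (hg : IsDbarClosed g)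
    (z : closedPolydisc n) (hz : z.1 ∈ polydisc n) : henkinFunctional z g = nwFunctional z g := by
  refine mem_of_isDbarClosed (S := (henkinFunctional z).toLinearMap.eqLocus
    (nwFunctional z).toLinearMap)
    (isClosed_eq (henkinFunctional z).continuous (nwFunctional z).continuous) (fun u hu => ?_) hg
  change henkinFunctional z (dbarProd u) = nwFunctional z (dbarProd u)
  rw [henkinFunctional_dbarProd hu, nwFunctional_dbarProd hu z hz]
  congr 1
  refine Finset.prod_congr rfl fun k _ => ?_
  rw [← circleS_add_discT_dbar (hu k).contDiff_one (hz k), add_sub_cancel_right]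

lemma continuous_henkinFunctional_dbarProd {u : Fin n → C(ℂ, ℂ)} (hu : ∀ i, IsBump (u i)) :
    Continuous fun z => henkinFunctional z (dbarProd u) := by
  simp_rw [henkinFunctional_dbarProd hu]
  refine (prodFn u).continuous.sub (continuous_finsetProd _ fun k _ => ?_)
  have hcoord : Continuous fun z : closedPolydisc n => z.1 k :=
    (continuous_apply k).comp continuous_subtype_val
  exact ((u k).continuous.comp hcoord).sub
    ((continuousOn_discT_dbar (hu k).contDiff_one).comp_continuous hcoord
      fun z => mem_closedBall_zero_iff.2 (z.2 k))

lemma continuous_henkinFunctional {g : Fin n → C(closedPolydisc n, ℂ)} (hg : IsDbarClosed g) :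
    Continuous fun z => henkinFunctional z g := by
  obtain ⟨C, hC⟩ := exists_norm_henkinFunctional_le n
  exact continuousOn_univ.1 <| mem_of_isDbarClosed
    (S := continuousOnSubmodule henkinFunctional univ)
    (isClosed_continuousOnSubmodule fun z _ => hC z)
    (fun _ hu => (continuous_henkinFunctional_dbarProd hu).continuousOn) hg

lemma dense_polydisc : Dense {z : closedPolydisc n | z.1 ∈ polydisc n} := by
  refine Subtype.dense_iff.2 fun z hz => ?_
  have hz' : z ∈ closure (polydisc n) := by
    rw [polydisc_eq_ball, closure_ball 0 one_ne_zero, mem_closedBall_zero_iff,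
      pi_norm_le_iff_of_nonneg zero_le_one]
    exact hz
  refine closure_mono (fun w hw => ?_) hz'
  exact ⟨⟨w, polydisc_subset n hw⟩, hw, rfl⟩

lemma eq_of_eqOn_polydisc {u v : C(closedPolydisc n, ℂ)}
    (h : ∀ z : closedPolydisc n, z.1 ∈ polydisc n → u z = v z) : u = v :=
  ContinuousMap.coe_injective (u.continuous.ext_on dense_polydisc v.continuous h)

/-- The solution operator of `∂̄u = g` with `K[u] = 0`, given by Henkin's formula. -/
def canonicalSolution (n : ℕ) : closedForms n →ₗ[ℂ] C(closedPolydisc n, ℂ) where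
  toFun g := ⟨fun z => henkinFunctional z g.1, continuous_henkinFunctional g.2⟩
  map_add' g h := by ext z; exact map_add (henkinFunctional z) g.1 h.1
  map_smul' c g := by ext z; exact map_smul (henkinFunctional z) c g.1

lemma canonicalSolution_apply (g : closedForms n) (z : closedPolydisc n) :
    canonicalSolution n g z = henkinFunctional z g.1 := rfl

lemma canonicalSolution_eq_nwFunctional (g : closedForms n) (z : closedPolydisc n)
    (hz : z.1 ∈ polydisc n) : canonicalSolution n g z = nwFunctional z g.1 :=
  henkinFunctional_eq_nwFunctional g.2 z hz

lemma isDbarSolution_canonicalSolution (g : closedForms n) :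
    IsDbarSolution (canonicalSolution n g) g.1 := fun φ hφ j => by
  rw [← isWeakSolution_nwExt g.2 φ hφ j]
  refine setIntegral_congr_fun (measurableSet_polydisc n) fun z hz => ?_
  simp only [zeroExt_of_mem _ (polydisc_subset n hz), nwExt_of_mem hz,
    canonicalSolution_eq_nwFunctional g ⟨z, polydisc_subset n hz⟩ hz]

lemma cauchyTorus_canonicalSolution (g : closedForms n) {z : Fin n → ℂ} (hz : z ∈ polydisc n) :
    cauchyTorus (zeroExt (canonicalSolution n g)) z = 0 := by
  have h := eq_torusFunctional_add_nwFunctional (isDbarSolution_canonicalSolution g)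
    ⟨z, polydisc_subset n hz⟩ hz
  rw [canonicalSolution_eq_nwFunctional g _ hz, right_eq_add] at h
  rw [cauchyTorus_eq hz, h]

lemma eq_canonicalSolution {g : closedForms n} {u : C(closedPolydisc n, ℂ)}
    (hu : IsDbarSolution u g.1) (hK : ∀ z ∈ polydisc n, cauchyTorus (zeroExt u) z = 0) :
    u = canonicalSolution n g := by
  refine eq_of_eqOn_polydisc fun z hz => ?_
  rw [eq_torusFunctional_add_nwFunctional hu z hz, ← cauchyTorus_eq hz, hK _ hz, zero_add,
    canonicalSolution_eq_nwFunctional g z hz]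

end Polydisc

end

theorem corollary1_general (n : ℕ) :
    ∃ L : Polydisc.closedForms n →ₗ[ℂ] C(Polydisc.closedPolydisc n, ℂ),
      (∀ g : Polydisc.closedForms n, Polydisc.IsDbarSolution (L g) g) ∧
      (∀ g : Polydisc.closedForms n, ∀ z ∈ Polydisc.polydisc n,
        Polydisc.cauchyTorus (Polydisc.zeroExt (L g)) z = 0) ∧
      (∀ (g : Polydisc.closedForms n) (u : C(Polydisc.closedPolydisc n, ℂ)),
        Polydisc.IsDbarSolution u g →
        (∀ z ∈ Polydisc.polydisc n, Polydisc.cauchyTorus (Polydisc.zeroExt u) z = 0) →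
        u = L g) ∧
      (∀ (g : Polydisc.closedForms n) (z : Polydisc.closedPolydisc n),
        L g z = Polydisc.henkin (g : Fin n → C(Polydisc.closedPolydisc n, ℂ)) z) ∧
      (∀ (g : Polydisc.closedForms n) (z : Polydisc.closedPolydisc n),
        (z : Fin n → ℂ) ∈ Polydisc.polydisc n →
          L g z = Polydisc.nijenhuisWoolf
            (g : Fin n → C(Polydisc.closedPolydisc n, ℂ)) z) := by
  refine ⟨Polydisc.canonicalSolution n, Polydisc.isDbarSolution_canonicalSolution,
    fun g z hz => Polydisc.cauchyTorus_canonicalSolution g hz,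
    fun g u hu hK => Polydisc.eq_canonicalSolution hu hK, fun g z => ?_, fun g z hz => ?_⟩
  · rw [Polydisc.henkin_eq, Polydisc.canonicalSolution_apply]
  · rw [Polydisc.nijenhuisWoolf_eq z hz, Polydisc.canonicalSolution_eq_nwFunctional g z hz]

theorem corollary1 (n : ℕ) (hn : 1 ≤ n) :
    ∃ L : Polydisc.closedForms n →ₗ[ℂ] C(Polydisc.closedPolydisc n, ℂ),
      -- `L` solves the equation, `K L = 0`, and this determines `L`
      (∀ g : Polydisc.closedForms n, Polydisc.IsDbarSolution (L g) g) ∧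
      (∀ g : Polydisc.closedForms n, ∀ z ∈ Polydisc.polydisc n,
        Polydisc.cauchyTorus (Polydisc.zeroExt (L g)) z = 0) ∧
      (∀ (g : Polydisc.closedForms n) (u : C(Polydisc.closedPolydisc n, ℂ)),
        Polydisc.IsDbarSolution u g →
        (∀ z ∈ Polydisc.polydisc n, Polydisc.cauchyTorus (Polydisc.zeroExt u) z = 0) →
        u = L g) ∧
      -- `L = H`
      (∀ (g : Polydisc.closedForms n) (z : Polydisc.closedPolydisc n),
        L g z = Polydisc.henkin (g : Fin n → C(Polydisc.closedPolydisc n, ℂ)) z) ∧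
      -- `L = T` on forms of class `C^{k+α}`
      (∀ (k : ℕ) (α : NNReal), 0 < α → α < 1 → ∀ g : Polydisc.closedForms n,
        (∀ j, Polydisc.IsHolder k α ((g : Fin n → C(Polydisc.closedPolydisc n, ℂ)) j)) →
        ∀ z : Polydisc.closedPolydisc n, (z : Fin n → ℂ) ∈ Polydisc.polydisc n →
          L g z = Polydisc.nijenhuisWoolf
            (g : Fin n → C(Polydisc.closedPolydisc n, ℂ)) z) := by
  obtain ⟨L, hL, hKL, huniq, hH, hT⟩ := corollary1_general n
  exact ⟨L, hL, hKL, huniq, hH, fun _ _ _ _ g _ => hT g⟩
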